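/- Let $\sigma\ge 1$ be an integer and $g_\sigma(x)=-\log P(\mathrm{Poisson}(x)\ge\sigma)$ for $x>0$. Then $\lambda_\sigma=\int_0^\infty g_\sigma(x)\,dx$ is finite, and the following holds. For $n\ge 1$ let $G_{\rm puz}$ be the ring (cycle graph) on $V=\mathbb Z_n$, and let $G_{\rm ppl}$ be the Erdős–Rényi random graph on $V$ in which every pair of distinct vertices is joined independently with probability $p=p(n)\in[0,1]$. Jigsaw percolation with verification threshold $\sigma$, link threshold $\tau=1$ and exemption threshold $\theta=\infty$ is the following dynamics on partitions of $V$. The partition $\mathcal P_0$ consists of all singletons. Given $\mathcal P_t$, join two distinct sets $W,W'\in\mathcal P_t$ by an edge if there are $v\in W$ and $v'\in W'$ that are adjacent in both $G_{\rm puz}$ and $G_{\rm ppl}$, or if a vertex of one of the two sets has at least $\sigma$ $G_{\rm ppl}$-neighbors and at least one $G_{\rm puz}$-neighbor in the other set; $\mathcal P_{t+1}$ is obtained by merging all sets of $\mathcal P_t$ that lie in the same connected component of the resulting graph. Let $T_f=\min\{t:\mathcal P_{t+1}=\mathcal P_t\}$ be the time when the dynamics stops. Let $\lambda>0$ and assume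 that $p\sim\lambda/\log n$ as $n\to\infty$. (a) If $\lambda<\lambda_\sigma$, then there is a constant $C$, depending only on $\sigma$ and $\lambda$, such that $P\left(\frac{T_f}{\log n}\le C\right)\to 1$ as $n\to\infty$. (b) If $\lambda>\lambda_\sigma$, then $\frac{\log T_f}{\log n}\to\frac{\lambda_\sigma}{\lambda}$ in probability as $n\to\infty$; that is, $P\left(\left|\frac{\log T_f}{\log n}-\frac{\lambda_\sigma}{\lambda}\right|\ge\varepsilon\right)\to 0$ for every $\varepsilon>0$. -/

import Mathlib

open Filter Topology MeasureTheory ProbabilityTheory Asymptotics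
open scoped ENNReal NNReal

noncomputable section

/-- The number of `G`-neighbours of `v` in the set `S` (never counting `v` itself). -/
def nbrCount {V : Type*} (G : SimpleGraph V) (v : V) (S : Set V) : ℕ∞ :=
  (G.neighborSet v ∩ S).encard

/-- At least one of the three joining rules holds for the ordered pair of clusters `W`, `W'`, with
verification threshold `σ`, link threshold `τ` and exemption threshold `θ`: there are doubly
connected vertices in `W` and `W'`; or some vertex of `W` has at least `θ` puzzle neighbours in
`W'`; or some vertex of `W` has at least `σ` people neighbours and at least `τ` puzzle neighbours
in `W'`. -/
def JoinRule {V : Type*} (puz ppl : SimpleGraph V) (σ τ : ℕ) (θ : ℕ∞) (W W' : Set V) : Prop :=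
  (∃ v ∈ W, ∃ v' ∈ W', puz.Adj v v' ∧ ppl.Adj v v') ∨
  (∃ v ∈ W, θ ≤ nbrCount puz v W') ∨
  (∃ v ∈ W, (σ : ℕ∞) ≤ nbrCount ppl v W' ∧ (τ : ℕ∞) ≤ nbrCount puz v W')

/-- A partition of `V` is encoded by its equivalence relation; this is the set of vertices in the
cluster `a`. -/
def clusterSet {V : Type*} (P : Setoid V) (a : Quotient P) : Set V :=
  {v | Quotient.mk P v = a}

/-- The graph on the clusters of a partition, with an unoriented edge between two different
clusters whenever the joining rule holds for them in one of the two orders. -/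
def clusterGraph {V : Type*} (puz ppl : SimpleGraph V) (σ τ : ℕ) (θ : ℕ∞) (P : Setoid V) :
    SimpleGraph (Quotient P) :=
  SimpleGraph.fromRel fun a b => JoinRule puz ppl σ τ θ (clusterSet P a) (clusterSet P b)

/-- One step of jigsaw percolation: all clusters in the same connected component of the cluster
graph are merged. -/
def jigsawStep {V : Type*} (puz ppl : SimpleGraph V) (σ τ : ℕ) (θ : ℕ∞) (P : Setoid V) :
    Setoid V :=
  Setoid.comap (Quotient.mk P) (clusterGraph puz ppl σ τ θ P).reachableSetoid

/-- The partition at time `t` of jigsaw percolation started from the partition `P₀`. -/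
def jigsaw {V : Type*} (puz ppl : SimpleGraph V) (σ τ : ℕ) (θ : ℕ∞) (P₀ : Setoid V) (t : ℕ) :
    Setoid V :=
  (jigsawStep puz ppl σ τ θ)^[t] P₀

/-- The first time at which jigsaw percolation, started from the partition into singletons, does
not change in the next step. -/
def jigsawStopTime {V : Type*} (puz ppl : SimpleGraph V) (σ τ : ℕ) (θ : ℕ∞) : ℕ :=
  sInf {t | jigsaw puz ppl σ τ θ ⊥ (t + 1) = jigsaw puz ppl σ τ θ ⊥ t}

/-- On a finite vertex set the dynamics does stop, so that the infimum in the definition of the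
stopping time is a minimum. -/
theorem jigsaw_stops {V : Type*} [Finite V] (puz ppl : SimpleGraph V) (σ τ : ℕ) (θ : ℕ∞)
    (P₀ : Setoid V) :
    ∃ t, jigsaw puz ppl σ τ θ P₀ (t + 1) = jigsaw puz ppl σ τ θ P₀ t := by
  have hle : ∀ P, P ≤ jigsawStep puz ppl σ τ θ P := by
    intro P x y h
    have hq : Quotient.mk P x = Quotient.mk P y := Quotient.sound h
    change (clusterGraph puz ppl σ τ θ P).Reachable (Quotient.mk P x) (Quotient.mk P y)
    rw [hq]
  have hmono : Monotone (jigsaw puz ppl σ τ θ P₀) := by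
    refine monotone_nat_of_le_succ fun t => ?_
    simp only [jigsaw, Function.iterate_succ_apply']
    exact hle _
  have hfin : Finite (Setoid V) :=
    Finite.of_injective (fun P : Setoid V => fun x y => P x y)
      (fun P Q h => Setoid.ext fun x y => by
        have := congrFun (congrFun h x) y
        simpa using this)
  obtain ⟨t, ht⟩ := WellFoundedGT.monotone_chain_condition ⟨_, hmono⟩
  exact ⟨t, (ht (t + 1) (Nat.le_succ t)).symm⟩

/-- `g_σ(x) = -log P(Poisson(x) ≥ σ)`, for `x ≥ 0`. -/
def gFun (σ : ℕ) (x : ℝ) : ℝ :=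
  -Real.log ((poissonMeasure x.toNNReal).real {k : ℕ | σ ≤ k})

/-- The critical constant `λ_σ = ∫_0^∞ g_σ(x) dx`. -/
def lambdaCrit (σ : ℕ) : ℝ :=
  ∫ x in Set.Ioi (0 : ℝ), gFun σ x

/-- The time at which jigsaw percolation on the ring with `n` vertices and people graph `G` stops,
for verification threshold `σ`, link threshold `1` and exemption threshold `∞`. -/
def ringStopTime (σ n : ℕ) (G : SimpleGraph (Fin n)) : ℕ :=
  jigsawStopTime (SimpleGraph.cycleGraph n) G σ 1 ⊤

end

/-! The ring is covered by the line `ℤ`, and the people graph is pulled back to a periodic graph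
`unroll G` on `ℤ`, whose edges inside a window of `n` consecutive integers are independent. Call an
interval internally spanned (`Spanned`) if mergers of adjacent intervals that use only people edges
inside it build it up from its vertices. On a scale of `log n`, clusters and internally spanned
intervals are the same thing.

An interval of length `k` absorbs the next vertex with probability `P(Bin(k, p) ≥ σ)`, which is
close to `P(Poisson(p k) ≥ σ)`. If growth happens in this way, one vertex after the other, then an
interval gets from length `σ` to a large multiple of `1 / p` with probability
`∏ k, P(Poisson(p k) ≥ σ) = exp (-(lambdaCrit σ + o(1)) / p)`, the exponent being a Riemann sum for
the integral of `gFun σ`. As `1 / p ∼ log n / lam`, this is `n ^ (-lambdaCrit σ / lam + o(1))`.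

That this is a lower bound for the probability of spanning (`eventually_exp_le_ringProb_spanned`) is
the independence of the successive absorptions. The upper bound (`exists_ringProb_spanned_le_exp`)
says that no other way of spanning is substantially more likely. It is proved by an induction on the
length (`ringProb_spanned_le`). By `Spanned.descent`, a spanned interval either contains a spanned
one that is shorter by a small multiple of `1 / p`, or consists essentially of two disjoint spanned
ones that are not short. In the first case almost all vertices of the small annulus in between must
have `σ` neighbours in the inner interval, as there are few people edges inside the annulus
(`ringProb_inter_spanned_le`); in the second case the two costs add up to more than the cost of
the whole, since short intervals grow with the greatest difficulty.

The subcritical case follows by a union bound: with high probability no interval whose length lies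
between a large multiple of `1 / p` and its double is internally spanned. A cluster cannot jump over
this range of lengths, so that all clusters are internally spanned intervals of length `O(log n)`,
and such an interval is completed in as many steps as it has vertices (`ringStopTime_le`).

In the supercritical case, spanned intervals of these lengths appear at distance
`n ^ (lambdaCrit σ / lam + o(1))` from each other. From a spanned interval of length `(log n) ^ 3`
the cluster grows by one vertex per step on either side, as every vertex has `σ` people neighbours
in the last `(log n) ^ 3` vertices before it. This gives the upper bound for the stopping time and
shows that the whole ring is merged in the end (`ringClusters_eq_top`). For the lower bound, a
stretch of the ring that is shorter than `n ^ (lambdaCrit σ / lam)` contains no spanned interval of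
critical length; influences from outside travel through it at a speed of `O(log n)` vertices per
step, so that the clusters in its middle stay short for a long time (`le_ringStopTime`). -/

/-! ### Internally spanned intervals -/

open Classical in
/-- The number of `H`-neighbours of `x` in the finite set `Y`. -/
noncomputable def degIn {V : Type*} (H : SimpleGraph V) (x : V) (Y : Finset V) : ℕ :=
  (Y.filter (H.Adj x)).card

theorem degIn_mono {V : Type*} (H : SimpleGraph V) (x : V) {Y Z : Finset V} (h : Y ⊆ Z) :
    degIn H x Y ≤ degIn H x Z := by
  classical
  exact Finset.card_le_card (Finset.filter_subset_filter _ h)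

theorem exists_adj_of_degIn_pos {V : Type*} {H : SimpleGraph V} {x : V} {Y : Finset V}
    (h : 0 < degIn H x Y) : ∃ y ∈ Y, H.Adj x y := by
  classical
  obtain ⟨y, hy⟩ := Finset.card_pos.1 h
  exact ⟨y, (Finset.mem_filter.1 hy).1, (Finset.mem_filter.1 hy).2⟩

/-- If no neighbour of `x` in `Z` lies outside `Y`, then `x` has as many neighbours in `Y`. -/
theorem degIn_le_of_forall {V : Type*} {H : SimpleGraph V} {x : V} {Y Z : Finset V}
    (h : ∀ y ∈ Z, H.Adj x y → y ∈ Y) : degIn H x Z ≤ degIn H x Y := by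
  classical
  refine Finset.card_le_card fun y hy => ?_
  rw [Finset.mem_filter] at hy ⊢
  exact ⟨h y hy.1 hy.2, hy.2⟩

/-- The joining rule for the adjacent intervals `[a, b)` and `[b, c)` of `ℤ`, regarded as a line of
puzzle edges: there is a people edge across the gap, or one of the two vertices at the gap has at
least `σ` people neighbours in the other interval. -/
def Linked (σ : ℕ) (H : SimpleGraph ℤ) (a b c : ℤ) : Prop :=
  H.Adj (b - 1) b ∨ σ ≤ degIn H (b - 1) (Finset.Ico b c) ∨ σ ≤ degIn H b (Finset.Ico a b)

/-- The interval `[a, b)` is internally spanned: successive merging of adjacent intervals, using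
people edges inside `[a, b)` only, turns its singletons into the whole of `[a, b)`. -/
inductive Spanned (σ : ℕ) (H : SimpleGraph ℤ) : ℤ → ℤ → Prop
  | single (a : ℤ) : Spanned σ H a (a + 1)
  | merge {a b c : ℤ} : Spanned σ H a b → Spanned σ H b c → Linked σ H a b c → Spanned σ H a c

section Spanned

variable {σ : ℕ} {H : SimpleGraph ℤ}

theorem Linked.mono {a a' b c c' : ℤ} (h : Linked σ H a b c) (ha : a' ≤ a) (hc : c ≤ c') :
    Linked σ H a' b c' := by
  rcases h with h | h | h
  · exact Or.inl h
  · exact Or.inr (Or.inl (h.trans (degIn_mono _ _ (Finset.Ico_subset_Ico le_rfl hc))))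
  · exact Or.inr (Or.inr (h.trans (degIn_mono _ _ (Finset.Ico_subset_Ico ha le_rfl))))

theorem Spanned.lt {a b : ℤ} (h : Spanned σ H a b) : a < b := by
  induction h <;> omega

/-- The union of two overlapping internally spanned intervals is internally spanned. -/
theorem Spanned.union {a b c d : ℤ} (h₁ : Spanned σ H a c) (h₂ : Spanned σ H b d)
    (hab : a ≤ b) (hbc : b < c) (hcd : c ≤ d) : Spanned σ H a d := by
  induction h₂ generalizing c with
  | single b =>
    obtain rfl : c = b + 1 := by omega
    exact h₁
  | @merge b m d hbm hmd hl ih₁ ih₂ =>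
    have := hbm.lt
    have := hmd.lt
    rcases le_or_gt c m with hcm | hcm
    · exact (ih₁ h₁ hab hbc hcm).merge hmd (hl.mono hab le_rfl)
    · exact ih₂ h₁ (by omega) hcm hcd

/-- Overlapping internally spanned intervals lie in a common one, namely their union. -/
theorem Spanned.exists_union {a b c d : ℤ} (h₁ : Spanned σ H a b) (h₂ : Spanned σ H c d)
    (h : c < b) (h' : a < d) : Spanned σ H (min a c) (max b d) := by
  rcases le_total a c with hac | hac <;> rcases le_total b d with hbd | hbd
  · rw [min_eq_left hac, max_eq_right hbd]
    exact h₁.union h₂ hac h hbd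
  · rw [min_eq_left hac, max_eq_left hbd]
    exact h₁
  · rw [min_eq_right hac, max_eq_right hbd]
    exact h₂
  · rw [min_eq_right hac, max_eq_left hbd]
    exact h₂.union h₁ hac h' hbd

/-- Every gap inside an internally spanned interval has been closed by some merger. -/
theorem Spanned.exists_linked {a b : ℤ} (h : Spanned σ H a b) {x : ℤ} (hx : a < x) (hx' : x < b) :
    ∃ u w, a ≤ u ∧ w ≤ b ∧ Linked σ H u x w := by
  induction h with
  | single a => omega
  | @merge a m c ham hmc hl ih₁ ih₂ =>
    have := ham.lt
    have := hmc.lt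
    rcases lt_trichotomy x m with hxm | rfl | hxm
    · obtain ⟨u, w, hu, hw, hl'⟩ := ih₁ hx hxm
      exact ⟨u, w, hu, by omega, hl'⟩
    · exact ⟨a, c, le_rfl, le_rfl, hl⟩
    · obtain ⟨u, w, hu, hw, hl'⟩ := ih₂ hxm hx'
      exact ⟨u, w, by omega, hw, hl'⟩

/-- Let `[c, d)` be a subinterval of the internally spanned interval `[a, b)`, and let `x` be a
vertex of `[a, b) \ [c, d)` to the right of it, but not next to it. Unless `x` has `σ` neighbours
in `[c, d)`, there is a people edge inside `[a, b) \ [c, d)` at `x` or at `x - 1`. This is because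
the merger that closed the gap between `x - 1` and `x` joined a set on the right of `x - 1`, which
does not meet `[c, d)`. -/
theorem Spanned.right_annulus (hσ : 1 ≤ σ) {a b c d x : ℤ} (h : Spanned σ H a b) (hac : a ≤ c)
    (hcd : c ≤ d) (hx : d < x) (hxb : x < b) :
    σ ≤ degIn H x (Finset.Ico c d) ∨
      (∃ y ∈ Finset.Ico a b \ Finset.Ico c d, H.Adj x y) ∨
      (∃ y ∈ Finset.Ico a b \ Finset.Ico c d, H.Adj (x - 1) y) := by
  obtain ⟨u, w, hu, hw, hl⟩ := h.exists_linked (x := x) (by omega) hxb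
  rcases hl with hl | hl | hl
  · right; right
    exact ⟨x, by simp only [Finset.mem_sdiff, Finset.mem_Ico]; omega, hl⟩
  · right; right
    obtain ⟨y, hy, hxy⟩ := exists_adj_of_degIn_pos (hσ.trans hl)
    refine ⟨y, ?_, hxy⟩
    simp only [Finset.mem_sdiff, Finset.mem_Ico] at hy ⊢
    omega
  · by_cases hout : ∃ y ∈ Finset.Ico a b \ Finset.Ico c d, H.Adj x y
    · exact Or.inr (Or.inl hout)
    · left
      refine hl.trans (degIn_le_of_forall fun y hy hxy => ?_)
      by_contra hyc
      refine hout ⟨y, ?_, hxy⟩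
      rw [Finset.mem_sdiff]
      refine ⟨?_, hyc⟩
      simp only [Finset.mem_Ico] at hy ⊢
      omega

/-- The mirror image of `Spanned.right_annulus`. -/
theorem Spanned.left_annulus (hσ : 1 ≤ σ) {a b c d x : ℤ} (h : Spanned σ H a b)
    (hcd : c ≤ d) (hdb : d ≤ b) (hx : x + 1 < c) (hxa : a ≤ x) :
    σ ≤ degIn H x (Finset.Ico c d) ∨
      (∃ y ∈ Finset.Ico a b \ Finset.Ico c d, H.Adj x y) ∨
      (∃ y ∈ Finset.Ico a b \ Finset.Ico c d, H.Adj (x + 1) y) := by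
  obtain ⟨u, w, hu, hw, hl⟩ := h.exists_linked (x := x + 1) (by omega) (by omega)
  rw [Linked, add_sub_cancel_right] at hl
  rcases hl with hl | hl | hl
  · right; left
    exact ⟨x + 1, by simp only [Finset.mem_sdiff, Finset.mem_Ico]; omega, hl⟩
  · by_cases hout : ∃ y ∈ Finset.Ico a b \ Finset.Ico c d, H.Adj x y
    · exact Or.inr (Or.inl hout)
    · left
      refine hl.trans (degIn_le_of_forall fun y hy hxy => ?_)
      by_contra hyc
      refine hout ⟨y, ?_, hxy⟩
      rw [Finset.mem_sdiff]
      refine ⟨?_, hyc⟩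
      simp only [Finset.mem_Ico] at hy ⊢
      omega
  · right; right
    obtain ⟨y, hy, hxy⟩ := exists_adj_of_degIn_pos (hσ.trans hl)
    refine ⟨y, ?_, hxy⟩
    simp only [Finset.mem_sdiff, Finset.mem_Ico] at hy ⊢
    omega

/-- Following the larger part of the mergers that built an internally spanned interval `[a, b)`
backwards, one finds a spanned subinterval whose length is smaller by an amount in `[s, 2s]`, unless
before that two spanned intervals of length at least `s` have merged. -/
theorem Spanned.descent {s : ℤ} (hs : 1 ≤ s) {a b : ℤ} (h : Spanned σ H a b)
    (hab : 2 * s ≤ b - a) :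
    (∃ c d, a ≤ c ∧ d ≤ b ∧ Spanned σ H c d ∧ s ≤ (b - a) - (d - c) ∧ (b - a) - (d - c) ≤ 2 * s) ∨
    (∃ c e d, a ≤ c ∧ d ≤ b ∧ Spanned σ H c e ∧ Spanned σ H e d ∧ s ≤ e - c ∧ s ≤ d - e ∧
      (b - a) - (d - c) < s) := by
  suffices key : ∀ c d, Spanned σ H c d → a ≤ c → d ≤ b → (b - a) - (d - c) < s →
      (∃ c d, a ≤ c ∧ d ≤ b ∧ Spanned σ H c d ∧ s ≤ (b - a) - (d - c) ∧
        (b - a) - (d - c) ≤ 2 * s) ∨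
      (∃ c e d, a ≤ c ∧ d ≤ b ∧ Spanned σ H c e ∧ Spanned σ H e d ∧ s ≤ e - c ∧ s ≤ d - e ∧
        (b - a) - (d - c) < s) from key a b h le_rfl le_rfl (by omega)
  intro c d hcd
  induction hcd with
  | single c => intro _ _ _; omega
  | @merge c e d hce hed hl ih₁ ih₂ =>
    intro hac hdb hlt
    have := hce.lt
    have := hed.lt
    by_cases h₁ : e - c < s
    · by_cases h₂ : s ≤ (b - a) - (d - e)
      · exact Or.inl ⟨e, d, by omega, hdb, hed, h₂, by omega⟩
      · exact ih₂ (by omega) hdb (by omega)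
    · by_cases h₃ : d - e < s
      · by_cases h₂ : s ≤ (b - a) - (e - c)
        · exact Or.inl ⟨c, e, hac, by omega, hce, h₂, by omega⟩
        · exact ih₁ hac (by omega) (by omega)
      · exact Or.inr ⟨c, e, d, hac, hdb, hce, hed, by omega, by omega, hlt⟩

/-- Whether `[a, b)` is internally spanned is decided by the people edges inside `[a, b)`. -/
theorem Spanned.congr {H' : SimpleGraph ℤ} {a b : ℤ} (h : Spanned σ H a b)
    (hH : ∀ x ∈ Finset.Ico a b, ∀ y ∈ Finset.Ico a b, H.Adj x y → H'.Adj x y) :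
    Spanned σ H' a b := by
  classical
  induction h with
  | single a => exact .single a
  | @merge a m c ham hmc hl ih₁ ih₂ =>
    have h₁ := ham.lt
    have h₂ := hmc.lt
    simp only [Finset.mem_Ico] at *
    refine (ih₁ fun x hx y hy => hH x (by omega) y (by omega)).merge
      (ih₂ fun x hx y hy => hH x (by omega) y (by omega)) ?_
    have hdeg : ∀ x ∈ Finset.Ico a c, ∀ Y ⊆ Finset.Ico a c, degIn H x Y ≤ degIn H' x Y := by
      intro x hx Y hY
      refine Finset.card_le_card fun y hy => ?_
      rw [Finset.mem_filter] at hy ⊢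
      refine ⟨hy.1, hH x (Finset.mem_Ico.1 hx) y (Finset.mem_Ico.1 (hY hy.1)) hy.2⟩
    rcases hl with hl | hl | hl
    · exact Or.inl (hH _ (by omega) _ (by omega) hl)
    · exact Or.inr (Or.inl (hl.trans (hdeg _ (by simp only [Finset.mem_Ico]; omega) _
        (Finset.Ico_subset_Ico h₁.le le_rfl))))
    · exact Or.inr (Or.inr (hl.trans (hdeg _ (by simp only [Finset.mem_Ico]; omega) _
        (Finset.Ico_subset_Ico le_rfl h₂.le))))

/-- Internal spanning by growth to the right from the vertex `a`. -/
theorem spanned_of_growth (a : ℤ) (m : ℕ)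
    (h : ∀ k : ℕ, 1 ≤ k → k < m → H.Adj (a + k - 1) (a + k) ∨
      σ ≤ degIn H (a + k) (Finset.Ico a (a + k))) (hm : 1 ≤ m) : Spanned σ H a (a + m) := by
  induction m, hm using Nat.le_induction with
  | base => exact_mod_cast Spanned.single a
  | succ m hm ih =>
    have h₁ := ih fun k hk hkm => h k hk (by omega)
    have h₂ : Spanned σ H (a + m) (a + (m + 1 : ℕ)) := by
      have := Spanned.single (σ := σ) (H := H) (a + m)
      push_cast
      rwa [← add_assoc]
    refine h₁.merge h₂ ?_
    rcases h m hm (by omega) with h' | h'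
    · exact Or.inl h'
    · exact Or.inr (Or.inr h')

end Spanned

/-! ### The ring as a quotient of the line -/

/-- The covering map from `ℤ` to the ring with `n` vertices. -/
def ringPt (n : ℕ) [NeZero n] (i : ℤ) : Fin n :=
  ⟨(i % n).toNat, by
    have h : (0 : ℤ) < n := by exact_mod_cast NeZero.pos n
    have := Int.emod_nonneg i h.ne'
    have := Int.emod_lt_of_pos i h
    omega⟩

/-- The people graph on the ring, unrolled to a periodic graph on `ℤ`. -/
def unroll {n : ℕ} [NeZero n] (G : SimpleGraph (Fin n)) : SimpleGraph ℤ :=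
  G.comap (ringPt n)

section Ring

variable {n : ℕ} [NeZero n] {G : SimpleGraph (Fin n)} {σ : ℕ}

theorem ringPt_eq_iff {i j : ℤ} : ringPt n i = ringPt n j ↔ i % n = j % n := by
  have h : (0 : ℤ) < n := by exact_mod_cast NeZero.pos n
  have h₁ := Int.emod_nonneg i h.ne'
  have h₂ := Int.emod_nonneg j h.ne'
  rw [ringPt, ringPt, Fin.mk.injEq]
  omega

theorem ringPt_natCast (x : Fin n) : ringPt n (x : ℤ) = x := by
  ext
  simp only [ringPt]
  rw [Int.emod_eq_of_lt (by omega) (by omega)]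
  simp

theorem ringPt_surjective : Function.Surjective (ringPt n) := fun x => ⟨x, ringPt_natCast x⟩

theorem ringPt_add_mul (i k : ℤ) : ringPt n (i + k * n) = ringPt n i := by
  rw [ringPt_eq_iff, Int.add_mul_emod_self_right]

theorem ringPt_injOn (a : ℤ) {b : ℤ} (hb : b ≤ a + n) : Set.InjOn (ringPt n) (Set.Ico a b) := by
  intro i hi j hj hij
  rw [ringPt_eq_iff, Int.emod_eq_emod_iff_emod_sub_eq_zero] at hij
  obtain ⟨k, hk⟩ := Int.dvd_of_emod_eq_zero hij
  rw [Set.mem_Ico] at hi hj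
  have hlt : |(n : ℤ) * k| < n * 1 := by
    rw [← hk, abs_lt]
    omega
  rw [abs_mul, Nat.abs_cast] at hlt
  have hk1 : |k| < 1 := lt_of_mul_lt_mul_left hlt (by positivity)
  rw [Int.abs_lt_one_iff] at hk1
  rw [hk1] at hk
  omega

theorem ringPt_sub_one_val (i : ℤ) (hn : 2 ≤ n) :
    (ringPt n (i + 1) - ringPt n i).val = 1 := by
  have h : (0 : ℤ) < n := by exact_mod_cast NeZero.pos n
  have h₁ := Int.emod_nonneg i h.ne'
  have h₂ := Int.emod_lt_of_pos i h
  rw [Fin.sub_def]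
  simp only [ringPt]
  have : (i + 1) % n = (i % n + 1) % n := by simp
  rw [this]
  obtain ⟨r, hr⟩ := Int.eq_ofNat_of_zero_le h₁
  rw [hr] at h₂ ⊢
  have hr' : r < n := by exact_mod_cast h₂
  rcases (show r + 1 < n ∨ r + 1 = n by omega) with h' | h'
  · rw [Int.emod_eq_of_lt (by omega) (by omega)]
    have : n - (r : ℤ).toNat + ((r : ℤ) + 1).toNat = 1 + n := by omega
    rw [this, Nat.add_mod_right, Nat.mod_eq_of_lt (by omega)]
  · have : ((r : ℤ) + 1) % n = 0 := by
      have : (r : ℤ) + 1 = n := by exact_mod_cast h'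
      rw [this, Int.emod_self]
    rw [this]
    have : n - (r : ℤ).toNat + (0 : ℤ).toNat = 1 := by simp; omega
    rw [this, Nat.mod_eq_of_lt (by omega)]

theorem cycleGraph_adj_ringPt (i : ℤ) (hn : 2 ≤ n) :
    (SimpleGraph.cycleGraph n).Adj (ringPt n i) (ringPt n (i + 1)) := by
  rw [SimpleGraph.cycleGraph_adj']
  exact Or.inr (ringPt_sub_one_val i hn)

/-- The ring neighbours of `ringPt n i` are `ringPt n (i - 1)` and `ringPt n (i + 1)`. -/
theorem eq_ringPt_of_cycleGraph_adj {i : ℤ} {v : Fin n}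
    (h : (SimpleGraph.cycleGraph n).Adj (ringPt n i) v) :
    v = ringPt n (i - 1) ∨ v = ringPt n (i + 1) := by
  have hn : 2 ≤ n := by
    by_contra hlt
    have hn1 : n = 1 := by have := NeZero.pos n; omega
    subst hn1
    exact SimpleGraph.cycleGraph_one_adj h
  rw [SimpleGraph.cycleGraph_adj'] at h
  rcases h with h | h
  · left
    have := ringPt_sub_one_val (n := n) (i - 1) hn
    rw [sub_add_cancel] at this
    have := Fin.ext (h.trans this.symm)
    exact sub_right_injective this
  · right
    have := Fin.ext (h.trans (ringPt_sub_one_val (n := n) i hn).symm)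
    exact sub_left_injective this

theorem unroll_adj_shift (x y k : ℤ) :
    (unroll G).Adj (x + k * n) (y + k * n) ↔ (unroll G).Adj x y := by
  simp only [unroll, SimpleGraph.comap_adj, ringPt_add_mul]

theorem degIn_le_degIn_unroll_shift (x u v k : ℤ) : degIn (unroll G) x (Finset.Ico u v) ≤
    degIn (unroll G) (x + k * n) (Finset.Ico (u + k * n) (v + k * n)) := by
  classical
  refine Finset.card_le_card_of_injOn (fun y => y + k * n) (fun y hy => ?_)
    (fun y _ z _ h => by simpa using h)
  simp only [Finset.coe_filter, Set.mem_ofPred_eq, Finset.mem_Ico] at hy ⊢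
  exact ⟨by omega, (unroll_adj_shift x y k).2 hy.2⟩

theorem Linked.unroll_shift {a b c : ℤ} (h : Linked σ (unroll G) a b c) (k : ℤ) :
    Linked σ (unroll G) (a + k * n) (b + k * n) (c + k * n) := by
  have hb : b + k * n - 1 = b - 1 + k * n := by ring
  rw [Linked, hb]
  rcases h with h | h | h
  · exact Or.inl ((unroll_adj_shift _ _ _).2 h)
  · exact Or.inr (Or.inl (h.trans (degIn_le_degIn_unroll_shift _ _ _ _)))
  · exact Or.inr (Or.inr (h.trans (degIn_le_degIn_unroll_shift _ _ _ _)))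

theorem Spanned.unroll_shift {a b : ℤ} (h : Spanned σ (unroll G) a b) (k : ℤ) :
    Spanned σ (unroll G) (a + k * n) (b + k * n) := by
  induction h with
  | single a =>
    rw [add_right_comm]
    exact .single _
  | merge _ _ hl ih₁ ih₂ => exact ih₁.merge ih₂ (hl.unroll_shift k)

end Ring

/-! ### Steps of the dynamics -/

section Step

variable {V : Type*} {puz ppl : SimpleGraph V} {σ τ : ℕ} {θ : ℕ∞} {P : Setoid V}

theorem mem_clusterSet_mk {x v : V} : v ∈ clusterSet P (Quotient.mk P x) ↔ P v x :=
  Quotient.eq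

theorem le_jigsawStep : P ≤ jigsawStep puz ppl σ τ θ P := by
  intro x y h
  have hq : Quotient.mk P x = Quotient.mk P y := Quotient.sound h
  change (clusterGraph puz ppl σ τ θ P).Reachable (Quotient.mk P x) (Quotient.mk P y)
  rw [hq]

theorem jigsawStep_of_joinRule {x y : V}
    (h : JoinRule puz ppl σ τ θ {v | P v x} {v | P v y}) :
    jigsawStep puz ppl σ τ θ P x y := by
  change (clusterGraph puz ppl σ τ θ P).Reachable (Quotient.mk P x) (Quotient.mk P y)
  by_cases hxy : Quotient.mk P x = Quotient.mk P y
  · rw [hxy]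
  · refine SimpleGraph.Adj.reachable ?_
    rw [clusterGraph, SimpleGraph.fromRel_adj]
    refine ⟨hxy, Or.inl ?_⟩
    have hset : ∀ z, clusterSet P (Quotient.mk P z) = {v | P v z} := fun z =>
      Set.ext fun v => mem_clusterSet_mk
    simpa only [hset] using h

/-- A set of vertices that contains `x`, is a union of clusters, and is closed under the joining
rule contains the cluster of `x` after the next step. -/
theorem jigsawStep_induction {R : V → Prop} {x y : V} (h : jigsawStep puz ppl σ τ θ P x y)
    (hx : R x) (hP : ∀ z z', P z z' → R z → R z')
    (hR : ∀ z z', R z → JoinRule puz ppl σ τ θ {v | P v z} {v | P v z'} ∨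
      JoinRule puz ppl σ τ θ {v | P v z'} {v | P v z} → R z') : R y := by
  change (clusterGraph puz ppl σ τ θ P).Reachable (Quotient.mk P x) (Quotient.mk P y) at h
  have hset : ∀ z, clusterSet P (Quotient.mk P z) = {v | P v z} := fun z =>
    Set.ext fun v => mem_clusterSet_mk
  rw [SimpleGraph.reachable_iff_reflTransGen] at h
  have key : ∀ q, Relation.ReflTransGen (clusterGraph puz ppl σ τ θ P).Adj (Quotient.mk P x) q →
      ∀ z, Quotient.mk P z = q → R z := by
    intro q hq
    induction hq with
    | refl =>
      intro z hz
      exact hP x z (Quotient.exact hz.symm) hx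
    | @tail q r _ hqr ih =>
      intro z hz
      obtain ⟨w, rfl⟩ := Quotient.exists_rep q
      subst hz
      rw [clusterGraph, SimpleGraph.fromRel_adj] at hqr
      have := hqr.2
      have hset' : ∀ z, clusterSet P (⟦z⟧ : Quotient P) = {v | P v z} := hset
      simp only [hset'] at this
      exact hR w z (ih w rfl) this
  exact key _ h y rfl

theorem jigsaw_succ (P₀ : Setoid V) (t : ℕ) : jigsaw puz ppl σ τ θ P₀ (t + 1) =
    jigsawStep puz ppl σ τ θ (jigsaw puz ppl σ τ θ P₀ t) := by
  simp only [jigsaw, Function.iterate_succ_apply']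

theorem jigsaw_mono (P₀ : Setoid V) : Monotone (jigsaw puz ppl σ τ θ P₀) := by
  refine monotone_nat_of_le_succ fun t => ?_
  rw [jigsaw_succ]
  exact le_jigsawStep

theorem jigsawStopTime_le {T : ℕ}
    (h : jigsaw puz ppl σ τ θ ⊥ (T + 1) ≤ jigsaw puz ppl σ τ θ ⊥ T) :
    jigsawStopTime puz ppl σ τ θ ≤ T :=
  Nat.sInf_le (le_antisymm h (jigsaw_mono _ (Nat.le_succ T)))

/-- The partition at the stopping time is the final one. -/
theorem jigsaw_le_jigsaw_stopTime [Finite V] (t : ℕ) :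
    jigsaw puz ppl σ τ θ ⊥ t ≤ jigsaw puz ppl σ τ θ ⊥ (jigsawStopTime puz ppl σ τ θ) := by
  have hT : jigsaw puz ppl σ τ θ ⊥ (jigsawStopTime puz ppl σ τ θ + 1) =
      jigsaw puz ppl σ τ θ ⊥ (jigsawStopTime puz ppl σ τ θ) :=
    Nat.sInf_mem (s := {t | jigsaw puz ppl σ τ θ ⊥ (t + 1) = jigsaw puz ppl σ τ θ ⊥ t})
      (jigsaw_stops puz ppl σ τ θ ⊥)
  have hconst : ∀ k, jigsaw puz ppl σ τ θ ⊥ (jigsawStopTime puz ppl σ τ θ + k) =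
      jigsaw puz ppl σ τ θ ⊥ (jigsawStopTime puz ppl σ τ θ) := by
    intro k
    induction k with
    | zero => rfl
    | succ k ih => rw [← add_assoc, jigsaw_succ, ih, ← jigsaw_succ, hT]
  rcases le_total t (jigsawStopTime puz ppl σ τ θ) with h | h
  · exact jigsaw_mono _ h
  · obtain ⟨k, rfl⟩ := Nat.exists_eq_add_of_le h
    exact (hconst k).le

theorem joinRule_cases [Finite V] {W W' : Set V} (h : JoinRule puz ppl σ 1 ⊤ W W') :
    (∃ v ∈ W, ∃ v' ∈ W', puz.Adj v v' ∧ ppl.Adj v v') ∨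
    (∃ v ∈ W, ∃ v' ∈ W', puz.Adj v v' ∧ (σ : ℕ∞) ≤ nbrCount ppl v W') := by
  rcases h with h | ⟨v, _, hv⟩ | ⟨v, hv, h₁, h₂⟩
  · exact Or.inl h
  · rw [top_le_iff, nbrCount, Set.encard_eq_top_iff] at hv
    exact absurd (Set.toFinite _) hv
  · right
    rw [nbrCount, Nat.cast_one, Set.one_le_encard_iff_nonempty] at h₂
    obtain ⟨v', hv', hv''⟩ := h₂
    exact ⟨v, hv, v', hv'', hv', h₁⟩

theorem joinRule_of_adj {W W' : Set V} {v v' : V} (hv : v ∈ W) (hv' : v' ∈ W')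
    (h₁ : puz.Adj v v') (h₂ : ppl.Adj v v') : JoinRule puz ppl σ τ θ W W' :=
  Or.inl ⟨v, hv, v', hv', h₁, h₂⟩

theorem joinRule_of_le_nbrCount {W W' : Set V} {v v' : V} (hv : v ∈ W) (hv' : v' ∈ W')
    (h₁ : puz.Adj v v') (h₂ : (σ : ℕ∞) ≤ nbrCount ppl v W') : JoinRule puz ppl σ 1 θ W W' := by
  refine Or.inr (Or.inr ⟨v, hv, h₂, ?_⟩)
  rw [nbrCount, Nat.cast_one, Set.one_le_encard_iff_nonempty]
  exact ⟨v', h₁, hv'⟩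

end Step

/-! ### Clusters of the ring and spanned intervals -/

section Clusters

variable {n : ℕ} [NeZero n] {G : SimpleGraph (Fin n)} {σ : ℕ}

theorem le_nbrCount_of_degIn {x a b : ℤ} {W : Set (Fin n)} (hab : b ≤ a + n)
    (h : σ ≤ degIn (unroll G) x (Finset.Ico a b)) (hW : ∀ y, a ≤ y → y < b → ringPt n y ∈ W) :
    (σ : ℕ∞) ≤ nbrCount G (ringPt n x) W := by
  classical
  rw [degIn] at h
  have hinj : Set.InjOn (ringPt n) ((Finset.Ico a b).filter ((unroll G).Adj x) : Set ℤ) := by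
    refine (ringPt_injOn a hab).mono fun y hy => ?_
    simp only [Finset.coe_filter, Set.mem_ofPred_eq, Finset.mem_Ico] at hy
    exact hy.1
  calc (σ : ℕ∞) ≤ (((Finset.Ico a b).filter ((unroll G).Adj x)).card : ℕ∞) := by exact_mod_cast h
    _ = (ringPt n '' ((Finset.Ico a b).filter ((unroll G).Adj x) : Set ℤ)).encard := by
      rw [hinj.encard_image, Set.encard_coe_eq_coe_finsetCard]
    _ ≤ nbrCount G (ringPt n x) W := by
      refine Set.encard_le_encard ?_
      rintro _ ⟨y, hy, rfl⟩
      simp only [Finset.coe_filter, Set.mem_ofPred_eq, Finset.mem_Ico] at hy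
      exact ⟨hy.2, hW y hy.1.1 hy.1.2⟩

theorem degIn_of_le_nbrCount {x a b : ℤ} {W : Set (Fin n)}
    (h : (σ : ℕ∞) ≤ nbrCount G (ringPt n x) W)
    (hW : ∀ v ∈ W, ∃ y, a ≤ y ∧ y < b ∧ ringPt n y = v) :
    σ ≤ degIn (unroll G) x (Finset.Ico a b) := by
  classical
  have hsub : G.neighborSet (ringPt n x) ∩ W ⊆
      ringPt n '' ((Finset.Ico a b).filter ((unroll G).Adj x) : Set ℤ) := by
    rintro v ⟨hv, hvW⟩
    obtain ⟨y, hay, hyb, rfl⟩ := hW v hvW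
    refine ⟨y, ?_, rfl⟩
    simp only [Finset.coe_filter, Set.mem_ofPred_eq, Finset.mem_Ico]
    exact ⟨⟨hay, hyb⟩, hv⟩
  have := (h.trans (Set.encard_le_encard hsub)).trans (Set.encard_image_le _ _)
  rw [Set.encard_coe_eq_coe_finsetCard] at this
  exact_mod_cast this

/-- The partition of the ring at time `t`. -/
abbrev ringClusters (σ : ℕ) (G : SimpleGraph (Fin n)) (t : ℕ) : Setoid (Fin n) :=
  jigsaw (SimpleGraph.cycleGraph n) G σ 1 ⊤ ⊥ t

/-- An internally spanned interval lies in one cluster from a time given by its length onwards. -/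
theorem Spanned.ringClusters {a b : ℤ} (h : Spanned σ (unroll G) a b) (hn : 2 ≤ n)
    (hab : b ≤ a + n) {t : ℕ} (ht : b - a ≤ t + 1) {x y : ℤ} (hx : a ≤ x) (hx' : x < b)
    (hy : a ≤ y) (hy' : y < b) : ringClusters σ G t (ringPt n x) (ringPt n y) := by
  induction h generalizing t x y with
  | single a =>
    obtain rfl : x = y := by omega
    exact Setoid.refl' _ _
  | @merge a m c ham hmc hl ih₁ ih₂ =>
    have h₁ := ham.lt
    have h₂ := hmc.lt
    obtain ⟨t, rfl⟩ : ∃ t', t = t' + 1 := ⟨t - 1, by omega⟩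
    have hleft : ∀ z, a ≤ z → z < m → _root_.ringClusters σ G t (ringPt n z) (ringPt n (m - 1)) :=
      fun z hz hz' => ih₁ (by omega) (by omega) hz hz' (by omega) (by omega)
    have hright : ∀ z, m ≤ z → z < c → _root_.ringClusters σ G t (ringPt n z) (ringPt n m) :=
      fun z hz hz' => ih₂ (by omega) (by omega) hz hz' (by omega) (by omega)
    have hstep : _root_.ringClusters σ G t ≤ _root_.ringClusters σ G (t + 1) :=
      jigsaw_mono _ (Nat.le_succ t)
    have hadj : (SimpleGraph.cycleGraph n).Adj (ringPt n (m - 1)) (ringPt n m) := by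
      simpa using cycleGraph_adj_ringPt (n := n) (m - 1) hn
    have hjoin : _root_.ringClusters σ G (t + 1) (ringPt n (m - 1)) (ringPt n m) := by
      rw [_root_.ringClusters, jigsaw_succ]
      rcases hl with hl | hl | hl
      · exact jigsawStep_of_joinRule (joinRule_of_adj (Setoid.refl' _ _) (Setoid.refl' _ _) hadj hl)
      · exact jigsawStep_of_joinRule (joinRule_of_le_nbrCount (Setoid.refl' _ _)
          (Setoid.refl' _ _) hadj (le_nbrCount_of_degIn (by omega) hl fun z hz hz' =>
            hright z hz hz'))
      · exact Setoid.symm' _ (jigsawStep_of_joinRule (joinRule_of_le_nbrCount (Setoid.refl' _ _)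
          (Setoid.refl' _ _) hadj.symm (le_nbrCount_of_degIn (by omega) hl fun z hz hz' =>
            hleft z hz hz')))
    have hall : ∀ z, a ≤ z → z < c → _root_.ringClusters σ G (t + 1) (ringPt n z) (ringPt n m) := by
      intro z hz hz'
      rcases lt_or_ge z m with h | h
      · exact Setoid.trans' _ (hstep (hleft z hz h)) hjoin
      · exact hstep (hright z h hz')
    exact Setoid.trans' _ (hall x hx hx') (Setoid.symm' _ (hall y hy hy'))

/-- If every vertex has `σ` people neighbours in each of the two intervals of length `m` next to it,
then a cluster that contains an interval of length `m` grows by one vertex per step on both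
sides. -/
theorem ringClusters_growth {m : ℕ} (hn : 2 ≤ n) (hmn : m ≤ n)
    (hright : ∀ x : ℤ, σ ≤ degIn (unroll G) x (Finset.Ico (x - m) x))
    (hleft : ∀ x : ℤ, σ ≤ degIn (unroll G) x (Finset.Ico (x + 1) (x + 1 + m)))
    {a : ℤ} {t : ℕ} (hm : 1 ≤ m)
    (h : ∀ x, a ≤ x → x < a + m → ringClusters σ G t (ringPt n x) (ringPt n a)) (k : ℕ) :
    ∀ x, a - k ≤ x → x < a + m + k → ringClusters σ G (t + k) (ringPt n x) (ringPt n a) := by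
  induction k with
  | zero => intro x hx hx'; exact h x (by omega) (by omega)
  | succ k ih =>
    have hstep : ringClusters σ G (t + k) ≤ ringClusters σ G (t + (k + 1)) :=
      jigsaw_mono _ (by omega)
    intro x hx hx'
    rcases (show x = a - k - 1 ∨ x = a + m + k ∨ (a - k ≤ x ∧ x < a + m + k) by
      push_cast at hx hx'; omega) with rfl | rfl | ⟨h₁, h₂⟩
    · refine Setoid.trans' _ (y := ringPt n (a - k - 1 + 1)) ?_
        (hstep (ih _ (by omega) (by omega)))
      rw [ringClusters, ← add_assoc, jigsaw_succ]
      refine jigsawStep_of_joinRule (joinRule_of_le_nbrCount (Setoid.refl' _ _) (Setoid.refl' _ _)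
        (cycleGraph_adj_ringPt _ hn) (le_nbrCount_of_degIn (by omega) (hleft _) fun y hy hy' => ?_))
      exact Setoid.trans' _ (ih y (by omega) (by omega))
        (Setoid.symm' _ (ih _ (by omega) (by omega)))
    · refine Setoid.trans' _ (y := ringPt n (a + m + k - 1)) ?_
        (hstep (ih _ (by omega) (by omega)))
      rw [ringClusters, ← add_assoc, jigsaw_succ]
      have hadj := cycleGraph_adj_ringPt (n := n) (a + m + k - 1) hn
      rw [sub_add_cancel] at hadj
      refine jigsawStep_of_joinRule (joinRule_of_le_nbrCount (Setoid.refl' _ _) (Setoid.refl' _ _)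
        hadj.symm (le_nbrCount_of_degIn (by omega) (hright _) fun y hy hy' => ?_))
      exact Setoid.trans' _ (ih y (by omega) (by omega))
        (Setoid.symm' _ (ih _ (by omega) (by omega)))
    · exact hstep (ih x h₁ h₂)

/-- If, in addition, every interval of length `N` contains an internally spanned interval of length
`m`, then the whole ring is one cluster at time `m + N`. -/
theorem ringClusters_eq_top {m N : ℕ} (hn : 2 ≤ n) (hmn : m ≤ n) (hm : 1 ≤ m) (hN : 2 ≤ N)
    (hright : ∀ x : ℤ, σ ≤ degIn (unroll G) x (Finset.Ico (x - m) x))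
    (hleft : ∀ x : ℤ, σ ≤ degIn (unroll G) x (Finset.Ico (x + 1) (x + 1 + m)))
    (hnuc : ∀ a : ℤ, ∃ c, a ≤ c ∧ c + m ≤ a + N ∧ Spanned σ (unroll G) c (c + m)) :
    ringClusters σ G (m + N) = ⊤ := by
  have hsucc : ∀ a : ℤ, ringClusters σ G (m + N) (ringPt n a) (ringPt n (a + 1)) := by
    intro a
    obtain ⟨c, hac, hcN, hc⟩ := hnuc a
    have h := ringClusters_growth (σ := σ) (t := m) hn hmn hright hleft (a := c) hm
      (fun x hx hx' => hc.ringClusters hn (by omega) (by omega) hx hx' le_rfl (by omega)) N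
    exact Setoid.trans' _ (h a (by omega) (by omega))
      (Setoid.symm' _ (h (a + 1) (by omega) (by omega)))
  have hnat : ∀ k : ℕ, ringClusters σ G (m + N) (ringPt n 0) (ringPt n k) := by
    intro k
    induction k with
    | zero => exact Setoid.refl' _ _
    | succ k ih => exact Setoid.trans' _ ih (by exact_mod_cast hsucc k)
  refine eq_top_iff.2 fun x y _ => ?_
  have hx := hnat x
  have hy := hnat y
  rw [ringPt_natCast] at hx hy
  exact Setoid.trans' _ (Setoid.symm' _ hx) hy

/-- Let `U` be a set of vertices such that no internally spanned interval that starts in `U` has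
length in `[L, 2L]`, and let `S t` consist of vertices with a margin of `2Lt` in `U`. Then at time
`t` the clusters of the vertices in `S t` are contained in internally spanned intervals shorter than
`L`: in one step, the cluster of a vertex in `S (t + 1)` does not outgrow a maximal such interval
around it. -/
theorem exists_spanned_of_ringClusters {L : ℤ} (hL : 2 ≤ L) (S : ℕ → Set ℤ)
    (hS : ∀ t i j, i ∈ S (t + 1) → |j - i| ≤ 2 * L → j ∈ S t) (hS0 : ∀ t, S t ⊆ S 0)
    (hno : ∀ a b, Spanned σ (unroll G) a b → a ∈ S 0 → b - a ≤ 2 * L → b - a < L) (t : ℕ) :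
    ∀ i ∈ S t, ∀ y, ringClusters σ G t (ringPt n i) y →
      ∃ a b, Spanned σ (unroll G) a b ∧ a ≤ i ∧ i < b ∧ b - a < L ∧
        ∃ j, a ≤ j ∧ j < b ∧ ringPt n j = y := by
  classical
  induction t with
  | zero =>
    intro i _ y hy
    exact ⟨i, i + 1, .single i, le_rfl, by omega, by omega, i, le_rfl, by omega, hy⟩
  | succ t ih =>
    intro i hi y hy
    have hnear : ∀ j, |j - i| ≤ 2 * L → j ∈ S 0 := fun j hj => hS0 t (hS t i j hi hj)
    -- A spanned interval around `i` of maximal length below `L`.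
    obtain ⟨ℓ, ⟨a, b, hab, hai, hib, hlt, hlen⟩, hmax⟩ :
        ∃ ℓ : ℕ, (∃ a b, Spanned σ (unroll G) a b ∧ a ≤ i ∧ i < b ∧ b - a < L ∧ b - a = ℓ) ∧
          ∀ ℓ' : ℕ, (∃ a b, Spanned σ (unroll G) a b ∧ a ≤ i ∧ i < b ∧ b - a < L ∧ b - a = ℓ') →
            ℓ' ≤ ℓ := by
      have hex : ∃ ℓ : ℕ, ∃ a b, Spanned σ (unroll G) a b ∧ a ≤ i ∧ i < b ∧ b - a < L ∧
          b - a = ℓ := ⟨1, i, i + 1, .single i, le_rfl, by omega, by omega, by simp⟩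
      have hbd : ∀ ℓ : ℕ, (∃ a b, Spanned σ (unroll G) a b ∧ a ≤ i ∧ i < b ∧ b - a < L ∧
          b - a = ℓ) → ℓ ≤ L.toNat := by
        rintro ℓ ⟨a, b, -, -, -, h₁, h₂⟩
        omega
      exact ⟨Nat.findGreatest _ L.toNat, Nat.findGreatest_spec (P := fun ℓ : ℕ => ∃ a b,
        Spanned σ (unroll G) a b ∧ a ≤ i ∧ i < b ∧ b - a < L ∧ b - a = ℓ)
        (hbd _ hex.choose_spec) hex.choose_spec, fun ℓ' h => Nat.le_findGreatest (hbd _ h) h⟩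
    -- Longer spanned intervals around `i` would contradict maximality.
    have hmax' : ∀ a' b', Spanned σ (unroll G) a' b' → a' ≤ a → b ≤ b' → b' - a' ≤ 2 * L →
        a' = a ∧ b' = b := by
      intro a' b' h h₁ h₂ h₃
      have hlt' := hno a' b' h (hnear a' (abs_le.2 ⟨by omega, by omega⟩)) h₃
      have := hmax (b' - a').toNat ⟨a', b', h, by omega, by omega, hlt', by omega⟩
      omega
    have habs : ∀ a' b', Spanned σ (unroll G) a' b' → b' - a' < L → a' < b → a < b' →
        a ≤ a' ∧ b' ≤ b := by
      intro a' b' h h₁ h₂ h₃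
      have hu := hab.exists_union h h₂ h₃
      obtain ⟨e₁, e₂⟩ := hmax' _ _ hu (min_le_left _ _) (le_max_left _ _) (by omega)
      omega
    have hinS : ∀ j, a - 1 ≤ j → j ≤ b → j ∈ S t := fun j h₁ h₂ =>
      hS t i j hi (abs_le.2 ⟨by omega, by omega⟩)
    set R : Fin n → Prop := fun v => ∃ j, a ≤ j ∧ j < b ∧ ringPt n j = v with hRdef
    have hRP : ∀ z z', ringClusters σ G t z z' → R z → R z' := by
      rintro z z' hz ⟨j, hj, hj', rfl⟩
      obtain ⟨a', b', h, h₁, h₂, h₃, j', h₄, h₅, h₆⟩ := ih j (hinS j (by omega) (by omega)) z' hz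
      obtain ⟨h₇, h₈⟩ := habs a' b' h h₃ (by omega) (by omega)
      exact ⟨j', by omega, by omega, h₆⟩
    -- The cluster of the vertex next to `[a, b)` on the right lies in a spanned interval from `b`.
    have hclR : ¬ R (ringPt n b) → ∃ b', Spanned σ (unroll G) b b' ∧ b' - b < L ∧
        ∀ v, ringClusters σ G t v (ringPt n b) → ∃ y, b ≤ y ∧ y < b' ∧ ringPt n y = v := by
      intro hRb
      -- Again a maximal interval, now around `b`; it cannot meet `[a, b)`.
      have hstart : ∀ a' b', Spanned σ (unroll G) a' b' → b' - a' < L → a' ≤ b → b < b' →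
          a' = b := by
        intro a' b' h h₁ h₂ h₃
        by_contra hne
        have := habs a' b' h h₁ (by omega) (by omega)
        omega
      have hex : ∃ ℓ : ℕ, Spanned σ (unroll G) b (b + ℓ) ∧ (ℓ : ℤ) < L :=
        ⟨1, by exact_mod_cast Spanned.single b, by push_cast; omega⟩
      have hbd : ∀ ℓ : ℕ, (Spanned σ (unroll G) b (b + ℓ) ∧ (ℓ : ℤ) < L) → ℓ ≤ L.toNat := by
        rintro ℓ ⟨-, h⟩
        omega
      have hspec := Nat.findGreatest_spec (P := fun ℓ : ℕ => Spanned σ (unroll G) b (b + ℓ) ∧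
        (ℓ : ℤ) < L) (hbd _ hex.choose_spec) hex.choose_spec
      refine ⟨_, hspec.1, by have := hspec.2; omega, fun v hv => ?_⟩
      obtain ⟨a', b', h, h₁, h₂, h₃, j', h₄, h₅, h₆⟩ := ih b (hinS b (by omega) le_rfl) v
        (Setoid.symm' _ hv)
      obtain rfl := hstart a' b' h h₃ h₁ h₂
      obtain ⟨k, rfl⟩ := Int.le.dest (show a' ≤ b' by omega)
      have hk := Nat.le_findGreatest (P := fun ℓ : ℕ => Spanned σ (unroll G) a' (a' + ℓ) ∧
        (ℓ : ℤ) < L) (hbd k ⟨h, by omega⟩) ⟨h, by omega⟩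
      exact ⟨j', h₄, by omega, h₆⟩
    have hclL : ¬ R (ringPt n (a - 1)) → ∃ a', Spanned σ (unroll G) a' a ∧ a - a' < L ∧
        ∀ v, ringClusters σ G t v (ringPt n (a - 1)) → ∃ y, a' ≤ y ∧ y < a ∧ ringPt n y = v := by
      intro hRa
      have hstart : ∀ a' b', Spanned σ (unroll G) a' b' → b' - a' < L → a' ≤ a - 1 → a - 1 < b' →
          b' = a := by
        intro a' b' h h₁ h₂ h₃
        by_contra hne
        have := habs a' b' h h₁ (by omega) (by omega)
        omega
      have hex : ∃ ℓ : ℕ, Spanned σ (unroll G) (a - ℓ) a ∧ (ℓ : ℤ) < L :=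
        ⟨1, by simpa using Spanned.single (σ := σ) (H := unroll G) (a - 1), by push_cast; omega⟩
      have hbd : ∀ ℓ : ℕ, (Spanned σ (unroll G) (a - ℓ) a ∧ (ℓ : ℤ) < L) → ℓ ≤ L.toNat := by
        rintro ℓ ⟨-, h⟩
        omega
      have hspec := Nat.findGreatest_spec (P := fun ℓ : ℕ => Spanned σ (unroll G) (a - ℓ) a ∧
        (ℓ : ℤ) < L) (hbd _ hex.choose_spec) hex.choose_spec
      refine ⟨_, hspec.1, by have := hspec.2; omega, fun v hv => ?_⟩
      obtain ⟨a', b', h, h₁, h₂, h₃, j', h₄, h₅, h₆⟩ := ih (a - 1) (hinS _ le_rfl (by omega)) v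
        (Setoid.symm' _ hv)
      obtain rfl := hstart a' b' h h₃ h₁ h₂
      obtain ⟨k, hk⟩ := Int.le.dest (show a' ≤ b' by omega)
      obtain rfl : a' = b' - k := by omega
      have hk := Nat.le_findGreatest (P := fun ℓ : ℕ => Spanned σ (unroll G) (b' - ℓ) b' ∧
        (ℓ : ℤ) < L) (hbd k ⟨h, by omega⟩) ⟨h, by omega⟩
      exact ⟨j', by omega, by omega, h₆⟩
    -- Neither gap at the ends of `[a, b)` can be closed.
    have hgapR : ∀ b', Spanned σ (unroll G) b b' → b' - b < L → ¬ Linked σ (unroll G) a b b' := by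
      intro b' h h₁ hl
      have := h.lt
      have := hmax' a b' (hab.merge h hl) le_rfl (by omega) (by omega)
      omega
    have hgapL : ∀ a', Spanned σ (unroll G) a' a → a - a' < L → ¬ Linked σ (unroll G) a' a b := by
      intro a' h h₁ hl
      have := h.lt
      have := hmax' a' b (h.merge hab hl) (by omega) le_rfl (by omega)
      omega
    have hsingleR : Spanned σ (unroll G) b (b + 1) := .single b
    have hsingleL : Spanned σ (unroll G) (a - 1) a := by
      simpa using Spanned.single (σ := σ) (H := unroll G) (a - 1)
    -- A ring neighbour of `[a, b)` outside of it is one of the two vertices next to it.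
    have hnbr : ∀ k v, a ≤ k → k < b → (SimpleGraph.cycleGraph n).Adj (ringPt n k) v → ¬ R v →
        (k = a ∧ v = ringPt n (a - 1)) ∨ (k = b - 1 ∧ v = ringPt n b) := by
      intro k v hk hk' hadj hv
      rcases eq_ringPt_of_cycleGraph_adj hadj with rfl | rfl
      · by_cases h : k = a
        · exact Or.inl ⟨h, by rw [h]⟩
        · exact absurd ⟨k - 1, by omega, by omega, rfl⟩ hv
      · by_cases h : k = b - 1
        · exact Or.inr ⟨h, by rw [h, sub_add_cancel]⟩
        · exact absurd ⟨k + 1, by omega, by omega, rfl⟩ hv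
    have hRstep : ∀ z z', R z →
        JoinRule (SimpleGraph.cycleGraph n) G σ 1 ⊤ {v | ringClusters σ G t v z}
          {v | ringClusters σ G t v z'} ∨
        JoinRule (SimpleGraph.cycleGraph n) G σ 1 ⊤ {v | ringClusters σ G t v z'}
          {v | ringClusters σ G t v z} → R z' := by
      intro z z' hz hjoin
      by_contra hz'
      have hin : ∀ v, ringClusters σ G t v z → R v := fun v hv => hRP z v (Setoid.symm' _ hv) hz
      have hout : ∀ v, ringClusters σ G t v z' → ¬ R v := fun v hv h => hz' (hRP v z' hv h)
      -- No people edge goes along a ring edge from the inside to the outside.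
      have hdouble : ∀ v v', ringClusters σ G t v z → ringClusters σ G t v' z' →
          (SimpleGraph.cycleGraph n).Adj v v' → ¬ G.Adj v v' := by
        intro v v' hv hv' hpuz hppl
        obtain ⟨k, hk, hk', rfl⟩ := hin v hv
        rcases hnbr k v' hk hk' hpuz (hout v' hv') with ⟨rfl, rfl⟩ | ⟨rfl, rfl⟩
        · exact hgapL _ hsingleL (by omega) (Or.inl hppl.symm)
        · exact hgapR _ hsingleR (by omega) (Or.inl hppl)
      rcases hjoin with hjoin | hjoin
      · rcases joinRule_cases hjoin with ⟨v, hv, v', hv', hpuz, hppl⟩ | ⟨v, hv, v', hv', hpuz, hcnt⟩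
        · exact hdouble v v' hv hv' hpuz hppl
        · obtain ⟨k, hk, hk', rfl⟩ := hin v hv
          rcases hnbr k v' hk hk' hpuz (hout v' hv') with ⟨rfl, rfl⟩ | ⟨rfl, rfl⟩
          · obtain ⟨a', h₁, h₂, h₃⟩ := hclL (hout _ hv')
            refine hgapL a' h₁ h₂ (Or.inr (Or.inr (degIn_of_le_nbrCount hcnt fun v hv => ?_)))
            exact h₃ v (Setoid.trans' _ hv (Setoid.symm' _ hv'))
          · obtain ⟨b', h₁, h₂, h₃⟩ := hclR (hout _ hv')
            refine hgapR b' h₁ h₂ (Or.inr (Or.inl (degIn_of_le_nbrCount hcnt fun v hv => ?_)))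
            exact h₃ v (Setoid.trans' _ hv (Setoid.symm' _ hv'))
      · rcases joinRule_cases hjoin with ⟨v', hv', v, hv, hpuz, hppl⟩ | ⟨v', hv', v, hv, hpuz, hcnt⟩
        · exact hdouble v v' hv hv' hpuz.symm hppl.symm
        · obtain ⟨k, hk, hk', rfl⟩ := hin v hv
          rcases hnbr k v' hk hk' hpuz.symm (hout v' hv') with ⟨rfl, rfl⟩ | ⟨rfl, rfl⟩
          · exact hgapL _ hsingleL (by omega)
              (Or.inr (Or.inl (degIn_of_le_nbrCount hcnt fun v hv => hin v hv)))
          · exact hgapR _ hsingleR (by omega)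
              (Or.inr (Or.inr (degIn_of_le_nbrCount hcnt fun v hv => hin v hv)))
    rw [ringClusters, jigsaw_succ] at hy
    obtain ⟨j, hj, hj', hjy⟩ := jigsawStep_induction hy (R := R) ⟨i, hai, hib, rfl⟩ hRP hRstep
    exact ⟨a, b, hab, hai, hib, hlt, j, hj, hj', hjy⟩

/-- If no internally spanned interval has length in `[L, 2L]`, then the dynamics stops by time
`L`. -/
theorem ringStopTime_le {L : ℕ} (hL : 2 ≤ L) (hLn : L ≤ n)
    (hno : ∀ a b, Spanned σ (unroll G) a b → b - a ≤ 2 * L → b - a < L) :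
    ringStopTime σ n G ≤ L := by
  refine jigsawStopTime_le fun x y hxy => ?_
  obtain ⟨i, rfl⟩ := ringPt_surjective x
  obtain ⟨a, b, hab, hai, hib, hlt, j, hj, hj', rfl⟩ :=
    exists_spanned_of_ringClusters (L := L) (by omega) (fun _ => Set.univ)
      (fun _ _ _ _ _ => Set.mem_univ _) (fun _ => subset_rfl) (fun a b h _ => hno a b h) (L + 1) i
      (Set.mem_univ _) y hxy
  exact hab.ringClusters (by omega) (by omega) (by omega) hai hib hj hj'

/-- If the whole ring becomes one cluster, but no internally spanned interval that starts in
`[0, N)` has length in `[L, 2L]`, then this takes at least `N / (4L)` steps. -/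
theorem le_ringStopTime {L N : ℕ} (hL : 2 ≤ L) (hLn : 2 * L ≤ n)
    (hno : ∀ a b, Spanned σ (unroll G) a b → 0 ≤ a → a < N → b - a ≤ 2 * L → b - a < L)
    {t : ℕ} (htop : ringClusters σ G t = ⊤) : N ≤ 4 * L * ringStopTime σ n G := by
  by_contra hlt
  push Not at hlt
  set T := ringStopTime σ n G with hT
  have hT' : ringClusters σ G T = ⊤ := by
    rw [eq_top_iff, ← htop]
    exact jigsaw_le_jigsaw_stopTime t
  have hmain := exists_spanned_of_ringClusters (σ := σ) (G := G) (L := L) (by omega)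
    (fun t => {i : ℤ | 2 * L * t ≤ i ∧ i < N - 2 * L * t}) (fun t i j hi hj => by
      simp only [Set.mem_ofPred_eq] at hi ⊢
      have hj' := abs_le.1 hj
      push_cast at hi
      constructor <;> nlinarith [hi.1, hi.2, hj'.1, hj'.2])
    (fun t i hi => by
      simp only [Set.mem_ofPred_eq] at hi ⊢
      have : (0 : ℤ) ≤ 2 * L * t := by positivity
      push_cast
      omega)
    (fun a b h ha => hno a b h (by simpa using ha.1) (by simpa using ha.2)) T (2 * L * T) (by
      simp only [Set.mem_ofPred_eq]
      refine ⟨le_rfl, ?_⟩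
      have : (4 * L * T : ℤ) < N := by exact_mod_cast hlt
      linarith)
  -- The whole ring would fit into fewer than `2L` consecutive vertices.
  have hsub : (Finset.univ : Finset (Fin n)) ⊆
      (Finset.Ioo ((2 * L * T : ℤ) - L) (2 * L * T + L)).image (ringPt n) := by
    intro y _
    obtain ⟨a, b, -, h₁, h₂, h₃, j, h₄, h₅, rfl⟩ := hmain y (by rw [hT']; trivial)
    exact Finset.mem_image_of_mem _ (Finset.mem_Ioo.2 ⟨by omega, by omega⟩)
  have hcard := (Finset.card_le_card hsub).trans Finset.card_image_le
  rw [Finset.card_univ, Fintype.card_fin, Int.card_Ioo] at hcard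
  omega

end Clusters

/-! ### Independence of people edges -/

section Independence

variable {n : ℕ} {p : unitInterval}

theorem iIndepFun_mem_edgeSet (V : Type*) [Countable V] (p : unitInterval) :
    iIndepFun (fun (e : Sym2 V) (G : SimpleGraph V) => e ∈ G.edgeSet)
      (SimpleGraph.binomialRandom V p) := by
  have hmeas : ∀ e : Sym2 V, Measurable fun G : SimpleGraph V => e ∈ G.edgeSet := fun e =>
    measurable_set_mem e |>.comp SimpleGraph.measurable_edgeSet
  have hof : Measurable fun f : Sym2 V → Prop => {i | f i} :=
    measurable_set_iff.2 fun i => measurable_pi_apply i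
  have hprob : ∀ e : Sym2 V, IsProbabilityMeasure
      (unitInterval.toNNReal p • Measure.dirac (e ∈ (Sym2.diagSetᶜ : Set (Sym2 V))) +
        unitInterval.toNNReal (unitInterval.symm p) • Measure.dirac False) := by
    intro e
    infer_instance
  have hind := iIndepFun_infinitePi (P := fun e : Sym2 V =>
      (unitInterval.toNNReal p • Measure.dirac (e ∈ (Sym2.diagSetᶜ : Set (Sym2 V))) +
        unitInterval.toNNReal (unitInterval.symm p) • Measure.dirac False))
      (X := fun e (q : Prop) => (q ∧ ¬ e.IsDiag : Prop)) (fun e => measurable_from_top)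
  rw [iIndepFun_iff_measure_inter_preimage_eq_mul] at hind ⊢
  intro S sets hsets
  have hcomp : ∀ A : Set (SimpleGraph V), MeasurableSet A → SimpleGraph.binomialRandom V p A =
      Measure.infinitePi (fun e : Sym2 V =>
        (unitInterval.toNNReal p • Measure.dirac (e ∈ (Sym2.diagSetᶜ : Set (Sym2 V))) +
        unitInterval.toNNReal (unitInterval.symm p) • Measure.dirac False))
        ((fun f => SimpleGraph.fromEdgeSet {i | f i}) ⁻¹' A) := by
    intro A hA
    rw [SimpleGraph.binomialRandom_eq_map, setBernoulli_eq_map,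
      Measure.map_apply SimpleGraph.measurable_fromEdgeSet hA,
      Measure.map_apply hof (SimpleGraph.measurable_fromEdgeSet hA)]
    rfl
  have hpre : ∀ e, (fun f : Sym2 V → Prop => SimpleGraph.fromEdgeSet {i | f i}) ⁻¹'
      ((fun G : SimpleGraph V => e ∈ G.edgeSet) ⁻¹' sets e) =
      (fun f : Sym2 V → Prop => (f e ∧ ¬ e.IsDiag : Prop)) ⁻¹' sets e := by
    intro e
    ext f
    simp [SimpleGraph.edgeSet_fromEdgeSet]
  rw [hcomp _ (Finset.measurableSet_biInter _ fun e he => hmeas e (hsets e he)),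
    Set.preimage_iInter₂]
  simp_rw [hpre]
  rw [hind S hsets]
  refine Finset.prod_congr rfl fun e he => ?_
  rw [hcomp _ (hmeas e (hsets e he)), hpre]

instance {n : ℕ} : MeasurableSingletonClass (SimpleGraph (Fin n)) where
  measurableSet_singleton G := by
    have : ({G} : Set (SimpleGraph (Fin n))) = SimpleGraph.edgeSet ⁻¹' {G.edgeSet} := by
      ext G'
      simp
    rw [this]
    exact SimpleGraph.measurable_edgeSet (MeasurableSet.of_discrete)

theorem measurableSet_simpleGraph {n : ℕ} (A : Set (SimpleGraph (Fin n))) : MeasurableSet A :=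
  (Set.toFinite A).measurableSet

theorem binomialRandom_real_adj {u v : Fin n} (huv : u ≠ v) :
    (SimpleGraph.binomialRandom (Fin n) p).real {G | G.Adj u v} = p := by
  have hpre : (fun q : Sym2 (Fin n) → Prop => {i | q i}) ⁻¹'
      (SimpleGraph.fromEdgeSet ⁻¹' {G : SimpleGraph (Fin n) | G.Adj u v}) =
      (fun f => f s(u, v)) ⁻¹' {q : Prop | q} := by
    ext f
    simp [huv]
  rw [measureReal_def, SimpleGraph.binomialRandom_eq_map,
    Measure.map_apply SimpleGraph.measurable_fromEdgeSet (measurableSet_simpleGraph _),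
    setBernoulli_apply', hpre]
  have hmap := Measure.infinitePi_map_eval (fun e : Sym2 (Fin n) =>
    (unitInterval.toNNReal p • Measure.dirac (e ∈ (Sym2.diagSetᶜ : Set (Sym2 (Fin n)))) +
      unitInterval.toNNReal (unitInterval.symm p) • Measure.dirac False)) s(u, v)
  have happly := Measure.map_apply (μ := Measure.infinitePi (fun e : Sym2 (Fin n) =>
    (unitInterval.toNNReal p • Measure.dirac (e ∈ (Sym2.diagSetᶜ : Set (Sym2 (Fin n)))) +
      unitInterval.toNNReal (unitInterval.symm p) • Measure.dirac False)))
      (measurable_pi_apply (s(u, v))) (s := {q : Prop | q}) trivial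
  rw [hmap] at happly
  refine (congrArg ENNReal.toReal happly.symm).trans ?_
  have hdiag : (s(u, v) ∈ (Sym2.diagSetᶜ : Set (Sym2 (Fin n)))) = True := by simp [huv]
  have hT : (Measure.dirac True) {q : Prop | q} = 1 := by
    rw [Measure.dirac_apply' _ MeasurableSpace.measurableSet_top]
    exact Set.indicator_of_mem (show True ∈ {q : Prop | q} from trivial) _
  have hF : (Measure.dirac False) {q : Prop | q} = 0 := by
    rw [Measure.dirac_apply' _ MeasurableSpace.measurableSet_top]
    exact Set.indicator_of_notMem (show False ∉ {q : Prop | q} from fun h => h) _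
  rw [hdiag, Measure.add_apply, Measure.smul_apply, Measure.smul_apply, hT, hF, smul_zero, add_zero,
    ENNReal.smul_def, smul_eq_mul, mul_one]
  rfl

/-- Events of the random graph that are determined by disjoint sets of edges are independent. -/
theorem binomialRandom_real_inter {A B : Set (SimpleGraph (Fin n))} {S T : Finset (Sym2 (Fin n))}
    (hST : Disjoint S T)
    (hA : ∀ G G' : SimpleGraph (Fin n), (∀ e ∈ S, e ∈ G.edgeSet ↔ e ∈ G'.edgeSet) →
      G ∈ A → G' ∈ A)
    (hB : ∀ G G' : SimpleGraph (Fin n), (∀ e ∈ T, e ∈ G.edgeSet ↔ e ∈ G'.edgeSet) →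
      G ∈ B → G' ∈ B) :
    (SimpleGraph.binomialRandom (Fin n) p).real (A ∩ B) =
      (SimpleGraph.binomialRandom (Fin n) p).real A *
        (SimpleGraph.binomialRandom (Fin n) p).real B := by
  have hind := (iIndepFun_mem_edgeSet (Fin n) p).indepFun_finset S T hST
    (fun e => (measurable_set_mem e).comp SimpleGraph.measurable_edgeSet)
  have hpre : ∀ (C : Set (SimpleGraph (Fin n))) (S : Finset (Sym2 (Fin n))),
      (∀ G G' : SimpleGraph (Fin n), (∀ e ∈ S, e ∈ G.edgeSet ↔ e ∈ G'.edgeSet) →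
        G ∈ C → G' ∈ C) →
      C = (fun (G : SimpleGraph (Fin n)) (i : S) => (i : Sym2 (Fin n)) ∈ G.edgeSet) ⁻¹'
        ((fun (G : SimpleGraph (Fin n)) (i : S) => (i : Sym2 (Fin n)) ∈ G.edgeSet) '' C) := by
    intro C S hC
    refine Set.Subset.antisymm (Set.subset_preimage_image _ _) ?_
    rintro G ⟨G', hG', h⟩
    exact hC G' G (fun e he => by simpa using congrFun h ⟨e, he⟩) hG'
  have := hind.measure_inter_preimage_eq_mul
    ((fun (G : SimpleGraph (Fin n)) (i : S) => (i : Sym2 (Fin n)) ∈ G.edgeSet) '' A)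
    ((fun (G : SimpleGraph (Fin n)) (i : T) => (i : Sym2 (Fin n)) ∈ G.edgeSet) '' B)
    (Set.toFinite _).measurableSet (Set.toFinite _).measurableSet
  rw [← hpre A S hA, ← hpre B T hB] at this
  simp only [measureReal_def, this, ENNReal.toReal_mul]

/-- The set `A` of graphs on `ℤ` is determined by the presence or absence of the edges in `E`. -/
def EdgeDetermined (A : Set (SimpleGraph ℤ)) (E : Set (Sym2 ℤ)) : Prop :=
  ∀ H H' : SimpleGraph ℤ, (∀ e ∈ E, e ∈ H.edgeSet ↔ e ∈ H'.edgeSet) → H ∈ A → H' ∈ A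

theorem EdgeDetermined.mono {A : Set (SimpleGraph ℤ)} {E E' : Set (Sym2 ℤ)}
    (h : EdgeDetermined A E) (hE : E ⊆ E') : EdgeDetermined A E' :=
  fun H H' hH => h H H' fun e he => hH e (hE he)

theorem EdgeDetermined.compl {A : Set (SimpleGraph ℤ)} {E : Set (Sym2 ℤ)}
    (h : EdgeDetermined A E) : EdgeDetermined Aᶜ E :=
  fun H H' hH hA hA' => hA (h H' H (fun e he => (hH e he).symm) hA')

theorem EdgeDetermined.iInter {ι : Type*} {T : Set ι} {A : ι → Set (SimpleGraph ℤ)}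
    {E : ι → Set (Sym2 ℤ)} (h : ∀ i ∈ T, EdgeDetermined (A i) (E i)) :
    EdgeDetermined (⋂ i ∈ T, A i) (⋃ i ∈ T, E i) := by
  intro H H' hH hA
  rw [Set.mem_iInter₂] at hA ⊢
  exact fun i hi => h i hi H H' (fun e he => hH e (Set.mem_biUnion hi he)) (hA i hi)

/-- The probability that the unrolled random people graph lies in `A`. -/
noncomputable def ringProb (n : ℕ) [NeZero n] (p : unitInterval) (A : Set (SimpleGraph ℤ)) : ℝ :=
  (SimpleGraph.binomialRandom (Fin n) p).real {G | unroll G ∈ A}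

/-- The pairs formed by `x` and the elements of `Y`. -/
def starPairs (x : ℤ) (Y : Finset ℤ) : Set (Sym2 ℤ) := {e | ∃ y ∈ Y, e = s(x, y)}

theorem edgeDetermined_adj (x y : ℤ) : EdgeDetermined {H | H.Adj x y} {s(x, y)} :=
  fun _ _ hH h => (hH _ rfl).1 h

theorem edgeDetermined_degIn (σ : ℕ) (x : ℤ) (Y : Finset ℤ) :
    EdgeDetermined {H | σ ≤ degIn H x Y} (starPairs x Y) := by
  classical
  intro H H' hH h
  refine le_trans h (Finset.card_le_card fun y hy => ?_)
  rw [Finset.mem_filter] at hy ⊢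
  exact ⟨hy.1, (hH s(x, y) ⟨y, hy.1, rfl⟩).1 hy.2⟩

variable [NeZero n]

theorem ringProb_nonneg (A : Set (SimpleGraph ℤ)) : 0 ≤ ringProb n p A := measureReal_nonneg

theorem ringProb_le_one (A : Set (SimpleGraph ℤ)) : ringProb n p A ≤ 1 := measureReal_le_one

theorem ringProb_mono {A B : Set (SimpleGraph ℤ)} (h : A ⊆ B) : ringProb n p A ≤ ringProb n p B :=
  measureReal_mono fun _ hG => h hG

theorem ringProb_univ : ringProb n p Set.univ = 1 := by
  simp [ringProb]

theorem ringProb_empty : ringProb n p ∅ = 0 := by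
  simp [ringProb]

theorem ringProb_compl (A : Set (SimpleGraph ℤ)) : ringProb n p Aᶜ = 1 - ringProb n p A := by
  have := probReal_compl_eq_one_sub (μ := SimpleGraph.binomialRandom (Fin n) p)
    (measurableSet_simpleGraph {G | unroll G ∈ A})
  exact this

theorem ringProb_biUnion_le {ι : Type*} (T : Finset ι) (A : ι → Set (SimpleGraph ℤ)) :
    ringProb n p (⋃ i ∈ T, A i) ≤ ∑ i ∈ T, ringProb n p (A i) := by
  have := measureReal_biUnion_finset_le (μ := SimpleGraph.binomialRandom (Fin n) p) T
    (fun i => {G | unroll G ∈ A i})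
  have heq : {G : SimpleGraph (Fin n) | unroll G ∈ ⋃ i ∈ T, A i} =
      ⋃ i ∈ T, {G | unroll G ∈ A i} := by
    ext G
    simp
  rwa [← heq] at this

theorem ringProb_union_le (A B : Set (SimpleGraph ℤ)) :
    ringProb n p (A ∪ B) ≤ ringProb n p A + ringProb n p B :=
  measureReal_union_le _ _

/-- The pairs of vertices in `[a, b)`. The people edges among them are independent if `b ≤ a + n`,
since then unrolling is faithful on `[a, b)`. -/
def pairsIn (a b : ℤ) : Set (Sym2 ℤ) := {e | ∀ x ∈ e, x ∈ Set.Ico a b}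

theorem mk_mem_pairsIn {a b x y : ℤ} :
    s(x, y) ∈ pairsIn a b ↔ x ∈ Set.Ico a b ∧ y ∈ Set.Ico a b := by
  simp [pairsIn]

theorem pairsIn_subset {a b c d : ℤ} (h₁ : c ≤ a) (h₂ : b ≤ d) : pairsIn a b ⊆ pairsIn c d :=
  fun _ he x hx => Set.Ico_subset_Ico h₁ h₂ (he x hx)

theorem ringProb_inter {A B : Set (SimpleGraph ℤ)} {E F : Set (Sym2 ℤ)} (a : ℤ)
    (hA : EdgeDetermined A E) (hB : EdgeDetermined B F) (hE : E ⊆ pairsIn a (a + n))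
    (hF : F ⊆ pairsIn a (a + n)) (hEF : Disjoint E F) :
    ringProb n p (A ∩ B) = ringProb n p A * ringProb n p B := by
  classical
  have hmem : ∀ (G : SimpleGraph (Fin n)) (e : Sym2 ℤ),
      e ∈ (unroll G).edgeSet ↔ Sym2.map (ringPt n) e ∈ G.edgeSet := by
    intro G e
    induction e with
    | _ x y => exact Iff.rfl
  have hinj : Set.InjOn (Sym2.map (ringPt n)) (pairsIn a (a + n)) := by
    intro e he f hf hef
    induction e with
    | _ x y =>
    induction f with
    | _ u v =>
      rw [mk_mem_pairsIn] at he hf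
      have hi := ringPt_injOn (n := n) a le_rfl
      simp only [Sym2.map_mk, Sym2.eq_iff] at hef ⊢
      rcases hef with ⟨h₁, h₂⟩ | ⟨h₁, h₂⟩
      · exact Or.inl ⟨hi he.1 hf.1 h₁, hi he.2 hf.2 h₂⟩
      · exact Or.inr ⟨hi he.1 hf.2 h₁, hi he.2 hf.1 h₂⟩
  refine binomialRandom_real_inter (S := (Set.toFinite (Sym2.map (ringPt n) '' E)).toFinset)
    (T := (Set.toFinite (Sym2.map (ringPt n) '' F)).toFinset) ?_ ?_ ?_
  · rw [Set.Finite.disjoint_toFinset, Set.disjoint_left]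
    rintro _ ⟨e, he, rfl⟩ ⟨f, hf, hef⟩
    obtain rfl := hinj (hF hf) (hE he) hef
    exact Set.disjoint_left.1 hEF he hf
  · intro G G' h hG
    refine hA _ _ (fun e he => ?_) hG
    rw [hmem, hmem]
    exact h _ (by simpa using ⟨e, he, rfl⟩)
  · intro G G' h hG
    refine hB _ _ (fun e he => ?_) hG
    rw [hmem, hmem]
    exact h _ (by simpa using ⟨e, he, rfl⟩)

/-- Events determined by pairwise disjoint sets of edges in a common window are independent. -/
theorem ringProb_biInter {ι : Type*} (T : Finset ι) {A : ι → Set (SimpleGraph ℤ)}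
    {E : ι → Set (Sym2 ℤ)} (a : ℤ) (hA : ∀ i ∈ T, EdgeDetermined (A i) (E i))
    (hE : ∀ i ∈ T, E i ⊆ pairsIn a (a + n))
    (hdisj : ∀ i ∈ T, ∀ j ∈ T, i ≠ j → Disjoint (E i) (E j)) :
    ringProb n p (⋂ i ∈ T, A i) = ∏ i ∈ T, ringProb n p (A i) := by
  classical
  induction T using Finset.induction_on with
  | empty => simp [ringProb_univ]
  | insert i T hi ih =>
    rw [Finset.prod_insert hi, ← ih (fun j hj => hA j (Finset.mem_insert_of_mem hj))
      (fun j hj => hE j (Finset.mem_insert_of_mem hj))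
      (fun j hj k hk => hdisj j (Finset.mem_insert_of_mem hj) k (Finset.mem_insert_of_mem hk)),
      Finset.set_biInter_insert]
    refine ringProb_inter a (hA i (Finset.mem_insert_self i T))
      (EdgeDetermined.iInter (T := (T : Set ι)) (E := E) fun j hj =>
        hA j (Finset.mem_insert_of_mem hj))
      (hE i (Finset.mem_insert_self i T)) (Set.iUnion₂_subset fun j hj =>
        hE j (Finset.mem_insert_of_mem hj)) ?_
    rw [Set.disjoint_iUnion₂_right]
    intro j hj
    exact hdisj i (Finset.mem_insert_self i T) j (Finset.mem_insert_of_mem hj)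
      fun h => hi (h ▸ hj)

theorem ringProb_adj {x y : ℤ} (hxy : x < y) (hyx : y < x + n) :
    ringProb n p {H | H.Adj x y} = p := by
  refine binomialRandom_real_adj (u := ringPt n x) (v := ringPt n y) fun h => ?_
  have := ringPt_injOn (n := n) x le_rfl (Set.mem_Ico.2 ⟨le_rfl, by omega⟩)
    (Set.mem_Ico.2 ⟨hxy.le, hyx⟩) h
  omega

theorem ringProb_inter_add_inter_compl (A B : Set (SimpleGraph ℤ)) :
    ringProb n p (A ∩ B) + ringProb n p (A ∩ Bᶜ) = ringProb n p A :=
  measureReal_inter_add_sdiff (measurableSet_simpleGraph {G | unroll G ∈ B})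

theorem edgeDetermined_spanned (σ : ℕ) (a b : ℤ) :
    EdgeDetermined {H | Spanned σ H a b} (pairsIn a b) :=
  fun _ _ hH h => Spanned.congr h fun x hx y hy hxy =>
    (hH s(x, y) (mk_mem_pairsIn.2 ⟨Finset.mem_Ico.1 hx, Finset.mem_Ico.1 hy⟩)).1 hxy

end Independence

/-! ### The binomial tail -/

/-- The probability that a binomial variable with parameters `k` and `p` is at least `σ`, through
the recursion that conditions on the last trial. -/
noncomputable def binTail (p : ℝ) : ℕ → ℕ → ℝ
  | _, 0 => 1
  | 0, _ + 1 => 0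
  | k + 1, σ + 1 => p * binTail p k σ + (1 - p) * binTail p k (σ + 1)

section BinTail

variable {p : ℝ}

@[simp] theorem binTail_zero_right (k : ℕ) : binTail p k 0 = 1 := by cases k <;> rfl

@[simp] theorem binTail_zero_succ (σ : ℕ) : binTail p 0 (σ + 1) = 0 := rfl

theorem binTail_succ_succ (k σ : ℕ) :
    binTail p (k + 1) (σ + 1) = p * binTail p k σ + (1 - p) * binTail p k (σ + 1) := rfl

theorem binTail_nonneg (h₀ : 0 ≤ p) (h₁ : p ≤ 1) (k σ : ℕ) : 0 ≤ binTail p k σ := by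
  induction k generalizing σ with
  | zero => cases σ <;> simp
  | succ k ih =>
    cases σ with
    | zero => simp
    | succ σ =>
      rw [binTail_succ_succ]
      have := mul_nonneg h₀ (ih σ)
      have := mul_nonneg (sub_nonneg.2 h₁) (ih (σ + 1))
      linarith

theorem binTail_le_one (h₀ : 0 ≤ p) (h₁ : p ≤ 1) (k σ : ℕ) : binTail p k σ ≤ 1 := by
  induction k generalizing σ with
  | zero => cases σ <;> simp
  | succ k ih =>
    cases σ with
    | zero => simp
    | succ σ =>
      rw [binTail_succ_succ]
      nlinarith [ih σ, ih (σ + 1)]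

theorem binTail_succ_right_le (h₀ : 0 ≤ p) (h₁ : p ≤ 1) (k σ : ℕ) :
    binTail p k (σ + 1) ≤ binTail p k σ := by
  induction k generalizing σ with
  | zero => cases σ <;> simp
  | succ k ih =>
    cases σ with
    | zero => simpa using binTail_le_one h₀ h₁ (k + 1) 1
    | succ σ =>
      rw [binTail_succ_succ, binTail_succ_succ]
      nlinarith [ih σ, ih (σ + 1)]

theorem binTail_mono (h₀ : 0 ≤ p) (h₁ : p ≤ 1) (σ : ℕ) : Monotone fun k => binTail p k σ := by
  refine monotone_nat_of_le_succ fun k => ?_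
  cases σ with
  | zero => simp
  | succ σ =>
    change binTail p k (σ + 1) ≤ binTail p (k + 1) (σ + 1)
    rw [binTail_succ_succ]
    nlinarith [binTail_succ_right_le h₀ h₁ k σ]

/-- Splitting the trials into two groups. -/
theorem binTail_mul_le (h₀ : 0 ≤ p) (h₁ : p ≤ 1) (k l a b : ℕ) :
    binTail p k a * binTail p l b ≤ binTail p (k + l) (a + b) := by
  induction l generalizing b with
  | zero =>
    cases b with
    | zero => simp
    | succ b => simpa using binTail_nonneg h₀ h₁ k (a + (b + 1))
  | succ l ih =>
    cases b with
    | zero => simpa using binTail_mono h₀ h₁ a (show k ≤ k + (l + 1) by omega)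
    | succ b =>
      rw [binTail_succ_succ, ← add_assoc, ← add_assoc, binTail_succ_succ]
      have h₂ := mul_le_mul_of_nonneg_left (ih b) h₀
      have h₃ := mul_le_mul_of_nonneg_left (ih (b + 1)) (sub_nonneg.2 h₁)
      rw [← add_assoc] at h₃
      linarith

theorem binTail_pow_le (h₀ : 0 ≤ p) (h₁ : p ≤ 1) (j σ : ℕ) :
    binTail p j 1 ^ σ ≤ binTail p (σ * j) σ := by
  induction σ with
  | zero => simp
  | succ σ ih =>
    rw [pow_succ, add_mul, one_mul]
    exact (mul_le_mul_of_nonneg_right ih (binTail_nonneg h₀ h₁ j 1)).trans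
      (binTail_mul_le h₀ h₁ _ _ _ _)

theorem binTail_one (k : ℕ) : binTail p k 1 = 1 - (1 - p) ^ k := by
  induction k with
  | zero => simp
  | succ k ih =>
    rw [show (1 : ℕ) = 0 + 1 from rfl, binTail_succ_succ, zero_add, ih, binTail_zero_right]
    ring

theorem binTail_one_le (h₁ : p ≤ 1) (k : ℕ) : binTail p k 1 ≤ k * p := by
  have := one_add_mul_le_pow (a := -p) (by linarith) k
  rw [binTail_one, sub_eq_add_neg 1 p]
  linarith

theorem binTail_eq (k σ : ℕ) : binTail p k σ =
    1 - ∑ i ∈ Finset.range σ, (k.choose i : ℝ) * p ^ i * (1 - p) ^ (k - i) := by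
  induction k generalizing σ with
  | zero =>
    cases σ with
    | zero => simp
    | succ σ =>
      rw [binTail_zero_succ, Finset.sum_range_succ']
      simp
  | succ k ih =>
    induction σ with
    | zero => simp
    | succ σ ihσ =>
      rw [Finset.sum_range_succ, ← sub_sub, ← ihσ]
      have h₁ := ih σ
      have h₂ := ih (σ + 1)
      rw [Finset.sum_range_succ, ← sub_sub, ← h₁] at h₂
      cases σ with
      | zero =>
        rw [binTail_succ_succ, h₂]
        simp only [binTail_zero_right, Nat.choose_zero_right, pow_zero, Nat.cast_one, tsub_zero]
        ring
      | succ σ =>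
        have h₃ := ih σ
        rw [Finset.sum_range_succ, ← sub_sub, ← h₃] at h₁
        rw [binTail_succ_succ, binTail_succ_succ, h₂, h₁, Nat.choose_succ_succ, Nat.succ_eq_add_one]
        push_cast
        rcases lt_or_ge k (σ + 1) with hk | hk
        · rw [Nat.choose_eq_zero_of_lt hk]
          push_cast
          ring
        · obtain ⟨d, rfl⟩ := Nat.exists_eq_add_of_le hk
          rw [show σ + 1 + d - σ = d + 1 by omega,
            show σ + 1 + d - (σ + 1) = d by omega]
          ring

/-- The number of people neighbours of a vertex in a given set is binomial. -/
theorem ringProb_degIn {n : ℕ} [NeZero n] {p : unitInterval} (a : ℤ) (σ : ℕ) {x : ℤ}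
    (hx : x ∈ Set.Ico a (a + n)) (Y : Finset ℤ) (hY : ∀ y ∈ Y, y ∈ Set.Ico a (a + n))
    (hxY : x ∉ Y) : ringProb n p {H | σ ≤ degIn H x Y} = binTail p Y.card σ := by
  classical
  induction Y using Finset.induction_on generalizing σ with
  | empty =>
    cases σ with
    | zero =>
      rw [binTail_zero_right, ← ringProb_univ (n := n) (p := p)]
      congr 1
      ext H
      simp
    | succ σ =>
      rw [Finset.card_empty, binTail_zero_succ, ← ringProb_empty (n := n) (p := p)]
      congr 1
      ext H
      simp [degIn]
  | insert y Y hy ih =>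
    rw [Finset.card_insert_of_notMem hy]
    cases σ with
    | zero =>
      rw [binTail_zero_right, ← ringProb_univ (n := n) (p := p)]
      congr 1
      ext H
      simp
    | succ σ =>
      have hyI := hY y (Finset.mem_insert_self y Y)
      have hYI : ∀ z ∈ Y, z ∈ Set.Ico a (a + n) := fun z hz => hY z (Finset.mem_insert_of_mem hz)
      have hxy : x ≠ y := fun h => hxY (h ▸ Finset.mem_insert_self y Y)
      have hxY' : x ∉ Y := fun h => hxY (Finset.mem_insert_of_mem h)
      have hadj : ringProb n p {H | H.Adj x y} = p := by
        rcases lt_or_gt_of_ne hxy with h | h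
        · exact ringProb_adj h (by have := hx.1; have := hyI.2; omega)
        · simp_rw [SimpleGraph.adj_comm _ x y]
          exact ringProb_adj h (by have := hyI.1; have := hx.2; omega)
      have hin : {H : SimpleGraph ℤ | σ + 1 ≤ degIn H x (insert y Y)} ∩ {H | H.Adj x y} =
          {H | H.Adj x y} ∩ {H | σ ≤ degIn H x Y} := by
        ext H
        simp only [Set.mem_inter_iff, Set.mem_ofPred_eq, degIn]
        rw [and_comm]
        refine and_congr_right fun h => ?_
        rw [Finset.filter_insert, if_pos h, Finset.card_insert_of_notMem (by simp [hy])]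
        omega
      have hout : {H : SimpleGraph ℤ | σ + 1 ≤ degIn H x (insert y Y)} ∩ {H | H.Adj x y}ᶜ =
          {H | H.Adj x y}ᶜ ∩ {H | σ + 1 ≤ degIn H x Y} := by
        ext H
        simp only [Set.mem_inter_iff, Set.mem_ofPred_eq, Set.mem_compl_iff, degIn]
        rw [and_comm]
        refine and_congr_right fun h => ?_
        rw [Finset.filter_insert, if_neg h]
      have hsub : starPairs x Y ⊆ pairsIn a (a + n) := by
        rintro _ ⟨z, hz, rfl⟩
        exact mk_mem_pairsIn.2 ⟨hx, hYI z hz⟩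
      have hsub' : {s(x, y)} ⊆ pairsIn a (a + n) := by
        rintro _ rfl
        exact mk_mem_pairsIn.2 ⟨hx, hyI⟩
      have hdisj : Disjoint {s(x, y)} (starPairs x Y) := by
        rw [Set.disjoint_singleton_left]
        rintro ⟨z, hz, h⟩
        rw [Sym2.eq_iff] at h
        rcases h with ⟨-, rfl⟩ | ⟨rfl, -⟩
        · exact hy hz
        · exact hxY' hz
      rw [← ringProb_inter_add_inter_compl _ {H : SimpleGraph ℤ | H.Adj x y}, hin, hout,
        ringProb_inter a (edgeDetermined_adj x y) (edgeDetermined_degIn _ x Y) hsub' hsub hdisj,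
        ringProb_inter a (edgeDetermined_adj x y).compl (edgeDetermined_degIn _ x Y) hsub' hsub
          hdisj, ringProb_compl, hadj, ih σ hYI hxY', ih (σ + 1) hYI hxY', binTail_succ_succ]

end BinTail

/-! ### Upper bound for the probability of internal spanning -/

section UpperBound

variable {n : ℕ} [NeZero n] {p : unitInterval} {σ : ℕ}

/-- Given an event `A` inside `[c, d)`, the probability that in addition `[a, b)` is internally
spanned carries a factor of almost `f` for each of the `m` vertices of the annulus
`[a, b) \ [c, d)`, where `f` bounds the probability of having `σ` neighbours in `[c, d)`. The
vertices at people edges inside the annulus are few if `m * p` is small; they are summed over. -/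
theorem ringProb_inter_spanned_le (hσ : 1 ≤ σ) {a b c d : ℤ} (hac : a ≤ c) (hcd : c ≤ d)
    (hdb : d ≤ b) (hn : b ≤ a + n) {A : Set (SimpleGraph ℤ)} (hA : EdgeDetermined A (pairsIn c d))
    {f r : ℝ} (hf₀ : 0 < f) (hf₁ : f ≤ 1) (hf : binTail p (d - c).toNat σ ≤ f) (hr₀ : 0 ≤ r)
    (hr₁ : r ≤ 1) {m : ℕ} (hm : (m : ℤ) = (b - a) - (d - c)) (hr : (m : ℝ) * p ≤ r ^ 2) :
    ringProb n p (A ∩ {H | Spanned σ H a b}) ≤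
      ringProb n p A * (f ^ m / f ^ 2 * (1 + r / f ^ 2) ^ (2 * m)) := by
  classical
  set J := Finset.Ico c d with hJ
  set X := Finset.Ico a b \ J with hX
  have hXcard : X.card = m := by
    rw [hX, Finset.card_sdiff_of_subset (Finset.Ico_subset_Ico hac hdb), Int.card_Ico,
      Int.card_Ico]
    omega
  have memX : ∀ x, x ∈ X ↔ (a ≤ x ∧ x < b) ∧ ¬ (c ≤ x ∧ x < d) := fun x => by
    simp only [hX, hJ, Finset.mem_sdiff, Finset.mem_Ico]
  -- The neighbour of `x` in the direction of `J`, and its inverse.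
  set back : ℤ → ℤ := fun y => if y < c then y - 1 else y + 1 with hback
  set X' := (X.erase d).erase (c - 1) with hX'
  set good : Finset ℤ → Finset ℤ → Finset ℤ := fun S T =>
    X' \ ((S ∪ T) ∪ (S ∪ T).image back) with hgood
  set lower : ℤ → Set (SimpleGraph ℤ) := fun x => {H | 1 ≤ degIn H x (X.filter (· < x))} with hlow
  set upper : ℤ → Set (SimpleGraph ℤ) := fun x => {H | 1 ≤ degIn H x (X.filter (x < ·))} with hup
  set many : ℤ → Set (SimpleGraph ℤ) := fun x => {H | σ ≤ degIn H x J} with hmany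
  -- The covering by the events that fix the dirty vertices.
  have hcover : A ∩ {H | Spanned σ H a b} ⊆ ⋃ ST ∈ X.powerset ×ˢ X.powerset,
      (A ∩ ((⋂ x ∈ ST.1, lower x) ∩ ⋂ x ∈ good ST.1 ST.2, many x)) ∩
      (A ∩ ((⋂ x ∈ ST.2, upper x) ∩ ⋂ x ∈ good ST.1 ST.2, many x)) := by
    rintro H ⟨hHA, hH⟩
    have hH' : Spanned σ H a b := hH
    have hdirty : ∀ x ∈ X, (∃ y ∈ X, H.Adj x y) → H ∈ lower x ∨ H ∈ upper x := by
      rintro x hx ⟨y, hy, hxy⟩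
      rcases lt_or_gt_of_ne hxy.ne with h | h
      · exact Or.inr (Finset.card_pos.2 ⟨y, by simp [hy, h, hxy]⟩)
      · exact Or.inl (Finset.card_pos.2 ⟨y, by simp [hy, h, hxy]⟩)
    refine Set.mem_iUnion₂.2 ⟨(X.filter (H ∈ lower ·), X.filter (H ∈ upper ·)), ?_, ?_⟩
    · simp only [Finset.mem_product, Finset.mem_powerset]
      exact ⟨Finset.filter_subset _ _, Finset.filter_subset _ _⟩
    have hmany' : H ∈ ⋂ x ∈ good (X.filter (H ∈ lower ·)) (X.filter (H ∈ upper ·)), many x := by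
      refine Set.mem_iInter₂.2 fun x hx => ?_
      simp only [hgood, Finset.mem_sdiff, Finset.mem_union, Finset.mem_image, not_or,
        Finset.mem_filter, hX', Finset.mem_erase] at hx
      obtain ⟨⟨hxc, hxd, hxX⟩, ⟨hlo, hhi⟩, hb⟩ := hx
      have hclean : ¬ ∃ y ∈ X, H.Adj x y := fun h => by
        rcases hdirty x hxX h with h' | h'
        · exact hlo ⟨hxX, h'⟩
        · exact hhi ⟨hxX, h'⟩
      have hclean' : ∀ x', x' ∈ X → back x' = x → ¬ ∃ y ∈ X, H.Adj x' y := fun x' hx' he h => by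
        rcases hdirty x' hx' h with h' | h'
        · exact hb ⟨x', Or.inl ⟨hx', h'⟩, he⟩
        · exact hb ⟨x', Or.inr ⟨hx', h'⟩, he⟩
      have hxX' := (memX x).1 hxX
      rcases (show x < c ∨ d ≤ x by omega) with hlt | hge
      · rcases hH'.left_annulus hσ hcd hdb (x := x) (by omega) hxX'.1.1 with h | h | h
        · exact h
        · exact absurd h hclean
        · refine absurd h (hclean' (x + 1) ((memX _).2 (by omega)) ?_)
          rw [hback]
          simp only
          rw [if_pos (by omega)]
          ring
      · rcases hH'.right_annulus hσ hac hcd (x := x) (by omega) hxX'.1.2 with h | h | h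
        · exact h
        · exact absurd h hclean
        · refine absurd h (hclean' (x - 1) ((memX _).2 (by omega)) ?_)
          rw [hback]
          simp only
          rw [if_neg (by omega)]
          ring
    refine ⟨⟨hHA, ?_, hmany'⟩, ⟨hHA, ?_, hmany'⟩⟩
    · exact Set.mem_iInter₂.2 fun x hx => (Finset.mem_filter.1 hx).2
    · exact Set.mem_iInter₂.2 fun x hx => (Finset.mem_filter.1 hx).2
  -- The three disjoint classes of edges.
  set EX : Set (Sym2 ℤ) := {e | ∀ x ∈ e, x ∈ X} with hEX
  have mkEX : ∀ x y, s(x, y) ∈ EX ↔ x ∈ X ∧ y ∈ X := fun x y => by simp [hEX]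
  set EC : Set (Sym2 ℤ) := {e | ∃ x ∈ X, ∃ y ∈ J, e = s(x, y)} with hEC
  have hJX : ∀ x, x ∈ J → x ∉ X := fun x hx hx' => (Finset.mem_sdiff.1 hx').2 hx
  have hXI : ∀ x, x ∈ X → x ∈ Set.Ico a (a + n) := fun x hx => by
    have := (memX x).1 hx
    exact ⟨this.1.1, by omega⟩
  have hJI : ∀ x, x ∈ J → x ∈ Set.Ico a (a + n) := fun x hx => by
    rw [hJ, Finset.mem_Ico] at hx
    exact ⟨by omega, by omega⟩
  have hEXsub : EX ⊆ pairsIn a (a + n) := fun e he x hx => hXI x (he x hx)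
  have hECsub : EC ⊆ pairsIn a (a + n) := by
    rintro _ ⟨x, hx, y, hy, rfl⟩
    exact mk_mem_pairsIn.2 ⟨hXI x hx, hJI y hy⟩
  have hXC : Disjoint EX EC := by
    rw [Set.disjoint_left]
    rintro _ he ⟨x, hx, y, hy, rfl⟩
    exact hJX y hy ((mkEX x y).1 he).2
  have hJXC : Disjoint (pairsIn c d) (EX ∪ EC) := by
    rw [Set.disjoint_left]
    rintro e he (he' | ⟨x, hx, y, hy, rfl⟩)
    · induction e with
      | _ x y =>
        refine hJX x ?_ ((mkEX x y).1 he').1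
        exact Finset.mem_Ico.2 (mk_mem_pairsIn.1 he).1
    · exact hJX x (Finset.mem_Ico.2 (mk_mem_pairsIn.1 he).1) hx
  have hstar : ∀ (S : Finset ℤ) (Y : ℤ → Finset ℤ), S ⊆ X → (∀ x, Y x ⊆ X) →
      (⋃ x ∈ (S : Set ℤ), starPairs x (Y x)) ⊆ EX := by
    intro S Y hS hY
    refine Set.iUnion₂_subset fun x hx => ?_
    rintro _ ⟨y, hy, rfl⟩
    exact (mkEX x y).2 ⟨hS hx, hY x hy⟩
  have hstarJ : ∀ S : Finset ℤ, S ⊆ X → (⋃ x ∈ (S : Set ℤ), starPairs x J) ⊆ EC := by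
    intro S hS
    refine Set.iUnion₂_subset fun x hx => ?_
    rintro _ ⟨y, hy, rfl⟩
    exact ⟨x, hS hx, y, hy, rfl⟩
  have hgoodX : ∀ S T, good S T ⊆ X := fun S T =>
    Finset.sdiff_subset.trans ((Finset.erase_subset _ _).trans (Finset.erase_subset _ _))
  have hp₁ : (p : ℝ) ≤ 1 := p.2.2
  have hp₀ : (0 : ℝ) ≤ p := p.2.1
  -- The probability of either half of the intersection.
  have hhalf : ∀ (S G : Finset ℤ) (Y : ℤ → Finset ℤ), S ⊆ X → G ⊆ X → (∀ x, Y x ⊆ X) →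
      (∀ x, x ∉ Y x) → (∀ x ∈ S, ∀ y ∈ S, y ∈ Y x → x ∉ Y y) →
      ringProb n p (A ∩ ((⋂ x ∈ S, {H | 1 ≤ degIn H x (Y x)}) ∩ ⋂ x ∈ G, many x)) ≤
        ringProb n p A * ((r ^ 2) ^ S.card * f ^ G.card) := by
    intro S G Y hS hG hY hxY hanti
    have hdet₁ : EdgeDetermined (⋂ x ∈ (S : Set ℤ), {H | 1 ≤ degIn H x (Y x)}) EX :=
      (EdgeDetermined.iInter fun x _ => edgeDetermined_degIn 1 x (Y x)).mono (hstar S Y hS hY)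
    have hdet₂ : EdgeDetermined (⋂ x ∈ (G : Set ℤ), many x) EC :=
      (EdgeDetermined.iInter fun x _ => edgeDetermined_degIn σ x J).mono (hstarJ G hG)
    have hdet₃ : EdgeDetermined ((⋂ x ∈ (S : Set ℤ), {H | 1 ≤ degIn H x (Y x)}) ∩
        ⋂ x ∈ (G : Set ℤ), many x) (EX ∪ EC) := fun H H' hH h =>
      ⟨hdet₁ H H' (fun e he => hH e (Or.inl he)) h.1, hdet₂ H H' (fun e he => hH e (Or.inr he)) h.2⟩
    have e₁ := ringProb_inter (n := n) (p := p) a hA hdet₃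
      (pairsIn_subset hac (by omega)) (Set.union_subset hEXsub hECsub) hJXC
    have e₂ := ringProb_inter (n := n) (p := p) a hdet₁ hdet₂ hEXsub hECsub hXC
    have e₃ := ringProb_biInter (n := n) (p := p) S a
      (fun x _ => edgeDetermined_degIn 1 x (Y x))
      (fun x hx => by
        rintro _ ⟨y, hy, rfl⟩
        exact mk_mem_pairsIn.2 ⟨hXI x (hS hx), hXI y (hY x hy)⟩)
      (fun x hx y hy hne => by
        rw [Set.disjoint_left]
        rintro _ ⟨u, hu, rfl⟩ ⟨v, hv, huv⟩
        rw [Sym2.eq_iff] at huv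
        rcases huv with ⟨h, -⟩ | ⟨rfl, rfl⟩
        · exact hne h
        · exact hanti _ hx _ hy hu hv)
    have e₄ := ringProb_biInter (n := n) (p := p) G a
      (fun x _ => edgeDetermined_degIn σ x J)
      (fun x hx => by
        rintro _ ⟨y, hy, rfl⟩
        exact mk_mem_pairsIn.2 ⟨hXI x (hG hx), hJI y hy⟩)
      (fun x hx y hy hne => by
        rw [Set.disjoint_left]
        rintro _ ⟨u, hu, rfl⟩ ⟨v, hv, huv⟩
        rw [Sym2.eq_iff] at huv
        rcases huv with ⟨h, -⟩ | ⟨rfl, rfl⟩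
        · exact hne h
        · exact hJX _ hv (hG hx))
    have hone : ∀ x ∈ S, ringProb n p {H | 1 ≤ degIn H x (Y x)} ≤ r ^ 2 := by
      intro x hx
      rw [ringProb_degIn a 1 (hXI x (hS hx)) (Y x) (fun y hy => hXI y (hY x hy)) (hxY x)]
      refine (binTail_one_le hp₁ _).trans (le_trans ?_ hr)
      refine mul_le_mul_of_nonneg_right ?_ hp₀
      exact_mod_cast hXcard ▸ Finset.card_le_card (hY x)
    have hmanyf : ∀ x ∈ G, ringProb n p (many x) ≤ f := by
      intro x hx
      rw [hmany, ringProb_degIn a σ (hXI x (hG hx)) J hJI (fun h => hJX x h (hG hx)), hJ,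
        Int.card_Ico]
      exact hf
    simp only [Finset.mem_coe] at e₁ e₂
    rw [e₁, e₂, e₃, e₄]
    refine mul_le_mul_of_nonneg_left ?_ (ringProb_nonneg A)
    refine mul_le_mul ?_ ?_ (Finset.prod_nonneg fun _ _ => ringProb_nonneg _) (by positivity)
    · rw [← Finset.prod_const]
      exact Finset.prod_le_prod (fun _ _ => ringProb_nonneg _) hone
    · rw [← Finset.prod_const]
      exact Finset.prod_le_prod (fun _ _ => ringProb_nonneg _) hmanyf
  have hgoodcard : ∀ S T, S ⊆ X → T ⊆ X → m ≤ (good S T).card + 2 * (S.card + T.card) + 2 := by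
    intro S T hS hT
    have h₁ := Finset.le_card_sdiff ((S ∪ T) ∪ (S ∪ T).image back) X'
    have h₂ : ((S ∪ T) ∪ (S ∪ T).image back).card ≤ 2 * (S.card + T.card) := by
      have h₃ := Finset.card_union_le (S ∪ T) ((S ∪ T).image back)
      have h₄ := Finset.card_image_le (s := S ∪ T) (f := back)
      have h₅ := Finset.card_union_le S T
      omega
    have h₆ : m ≤ X'.card + 2 := by
      have h₇ := Finset.pred_card_le_card_erase (s := X) (a := d)
      have h₈ := Finset.pred_card_le_card_erase (s := X.erase d) (a := c - 1)
      have h₁₀ : X'.card = ((X.erase d).erase (c - 1)).card := rfl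
      omega
    have h₉ : (good S T).card = (X' \ ((S ∪ T) ∪ (S ∪ T).image back)).card := rfl
    omega
  have hpair : ∀ ST ∈ X.powerset ×ˢ X.powerset, ringProb n p
      ((A ∩ ((⋂ x ∈ ST.1, lower x) ∩ ⋂ x ∈ good ST.1 ST.2, many x)) ∩
      (A ∩ ((⋂ x ∈ ST.2, upper x) ∩ ⋂ x ∈ good ST.1 ST.2, many x))) ≤
      ringProb n p A * (f ^ m / f ^ 2) * ((r / f ^ 2) ^ ST.1.card * (r / f ^ 2) ^ ST.2.card) := by
    rintro ⟨S, T⟩ hST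
    simp only [Finset.mem_product, Finset.mem_powerset] at hST
    obtain ⟨hS, hT⟩ := hST
    have h₁ := hhalf S (good S T) (fun x => X.filter (· < x)) hS (hgoodX S T)
      (fun x => Finset.filter_subset _ _) (fun x => by simp)
      (fun x _ y _ h h' => by
        simp only [Finset.mem_filter] at h h'
        omega)
    have h₂ := hhalf T (good S T) (fun x => X.filter (x < ·)) hT (hgoodX S T)
      (fun x => Finset.filter_subset _ _) (fun x => by simp)
      (fun x _ y _ h h' => by
        simp only [Finset.mem_filter] at h h'
        omega)
    have h₃ : f ^ (good S T).card ≤ f ^ m / f ^ 2 / (f ^ 2) ^ S.card / (f ^ 2) ^ T.card := by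
      rw [le_div_iff₀ (by positivity), le_div_iff₀ (by positivity), le_div_iff₀ (by positivity),
        ← pow_mul, ← pow_mul, ← pow_add, ← pow_add, ← pow_add]
      refine pow_le_pow_of_le_one hf₀.le hf₁ ?_
      have := hgoodcard S T hS hT
      omega
    -- The smaller of two powers of `r` is bounded by their geometric mean.
    have hmin : ∀ k l : ℕ, k ≤ l → (r ^ 2) ^ l ≤ r ^ k * r ^ l := by
      intro k l hkl
      rw [← pow_mul, ← pow_add]
      exact pow_le_pow_of_le_one hr₀ hr₁ (by omega)
    have hfin : ringProb n p A * (r ^ S.card * r ^ T.card * f ^ (good S T).card) ≤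
        ringProb n p A * (f ^ m / f ^ 2) * ((r / f ^ 2) ^ S.card * (r / f ^ 2) ^ T.card) := by
      rw [mul_assoc (ringProb n p A)]
      refine mul_le_mul_of_nonneg_left ?_ (ringProb_nonneg A)
      calc r ^ S.card * r ^ T.card * f ^ (good S T).card
          ≤ r ^ S.card * r ^ T.card * (f ^ m / f ^ 2 / (f ^ 2) ^ S.card / (f ^ 2) ^ T.card) :=
            mul_le_mul_of_nonneg_left h₃ (by positivity)
        _ = _ := by
            rw [div_pow, div_pow]
            ring
    refine le_trans ?_ hfin
    rcases le_total S.card T.card with h | h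
    · refine (ringProb_mono Set.inter_subset_right).trans (h₂.trans ?_)
      gcongr
      · exact ringProb_nonneg A
      · exact hmin _ _ h
    · refine (ringProb_mono Set.inter_subset_left).trans (h₁.trans ?_)
      gcongr
      · exact ringProb_nonneg A
      · rw [mul_comm]
        exact hmin _ _ h
  refine (ringProb_mono hcover).trans ((ringProb_biUnion_le _ _).trans
    ((Finset.sum_le_sum hpair).trans ?_))
  have hsum : ∑ S ∈ X.powerset, (r / f ^ 2) ^ S.card = (1 + r / f ^ 2) ^ m := by
    have := Finset.sum_pow_mul_eq_add_pow (r / f ^ 2) 1 X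
    simp only [one_pow, mul_one] at this
    rw [this, hXcard, add_comm]
  rw [← Finset.mul_sum, Finset.sum_product]
  simp_rw [← Finset.mul_sum]
  rw [← Finset.sum_mul, hsum]
  apply le_of_eq
  ring

/-- An upper bound for the probability that an interval of length `ℓ` is internally spanned, at
scales `s ≤ ℓ ≤ L` with `s` much smaller than `1 / p`. Up to the correction factors `θ` and `v`, it
is the product over `k < ℓ` of the probabilities that a vertex has `σ` neighbours in an interval of
length `k`. The induction on `ℓ` follows `Spanned.descent`: an interval that arises by small steps
pays for the annulus by `ringProb_inter_spanned_le`, while two large intervals that merge pay more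
than this together, since the factors increase with `k`; the prefactor `K` pays for the loss of at
most `s` vertices in this case. -/
theorem ringProb_spanned_le (hσ : 1 ≤ σ) {s L : ℕ} (hs : 1 ≤ s) (hLn : L ≤ n) {θ v r K : ℝ}
    (hθ₀ : 0 < θ) (hθ₁ : θ ≤ 1) (hv : 1 ≤ v) (hr₀ : 0 ≤ r) (hr₁ : r ≤ 1)
    (hr : (3 * s : ℝ) * p ≤ r ^ 2) (hrv : (1 + r / θ ^ 8) ^ 2 ≤ v)
    (hsmall : 2 * ((L : ℝ) + 1) ^ 2 ≤ θ ^ 2 * v ^ s)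
    (hbase : 2 * ((L : ℝ) + 1) ^ 3 * θ ^ (2 * s) ≤ θ ^ 8)
    (hK : K = θ ^ s / (2 * ((L : ℝ) + 1) ^ 3)) (ℓ : ℕ) (hsℓ : s ≤ ℓ) (hℓL : ℓ ≤ L) (a : ℤ) :
    ringProb n p {H | Spanned σ H a (a + ℓ)} ≤
      K * ∏ k ∈ Finset.range ℓ, (max (binTail p k σ) θ * v ^ 2) := by
  have hp₁ : (p : ℝ) ≤ 1 := p.2.2
  have hp₀ : (0 : ℝ) ≤ p := p.2.1
  have hL₀ : (0 : ℝ) < (L : ℝ) + 1 := by positivity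
  have hK₀ : 0 < K := by rw [hK]; positivity
  have hv₀ : 0 < v := by linarith
  set φ : ℕ → ℝ := fun k => max (binTail p k σ) θ with hφ
  have hφθ : ∀ k, θ ≤ φ k := fun k => le_max_right _ _
  have hφ₀ : ∀ k, 0 < φ k := fun k => hθ₀.trans_le (hφθ k)
  have hφ₁ : ∀ k, φ k ≤ 1 := fun k => max_le (binTail_le_one hp₀ hp₁ k σ) hθ₁
  have hφmono : Monotone φ := fun i j hij => max_le_max_right _ (binTail_mono hp₀ hp₁ σ hij)
  set w : ℕ → ℝ := fun k => φ k * v ^ 2 with hw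
  have hw₀ : ∀ k, 0 < w k := fun k => mul_pos (hφ₀ k) (by positivity)
  have hwθ : ∀ k, θ ≤ w k := fun k => by
    have h1 : 1 ≤ v ^ 2 := one_le_pow₀ hv
    have := hφθ k
    have := hφ₀ k
    calc θ ≤ φ k := hφθ k
      _ = φ k * 1 := (mul_one _).symm
      _ ≤ φ k * v ^ 2 := mul_le_mul_of_nonneg_left h1 (hφ₀ k).le
  have hwmono : Monotone w := fun i j hij =>
    mul_le_mul_of_nonneg_right (hφmono hij) (by positivity)
  change _ ≤ K * ∏ k ∈ Finset.range ℓ, w k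
  induction ℓ using Nat.strong_induction_on generalizing a with
  | _ ℓ ih =>
  have hprod₀ : ∀ k, 0 < ∏ i ∈ Finset.range k, w i := fun k => Finset.prod_pos fun i _ => hw₀ i
  rcases lt_or_ge ℓ (3 * s) with hlt | hge
  · -- Intervals shorter than `3s`: the annulus is the whole interval.
    have hdet : EdgeDetermined Set.univ (pairsIn a a) := fun _ _ _ _ => trivial
    have h := ringProb_inter_spanned_le (n := n) (p := p) hσ (a := a) (b := a + ℓ) (c := a) (d := a)
      le_rfl le_rfl (by omega) (by omega) hdet (f := θ ^ 4) (r := r) (m := ℓ) (by positivity)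
      (pow_le_one₀ hθ₀.le hθ₁) (by
        obtain ⟨σ, rfl⟩ : ∃ σ', σ = σ' + 1 := ⟨σ - 1, by omega⟩
        simp only [sub_self, Int.toNat_zero, binTail_zero_succ]
        positivity) hr₀ hr₁ (by omega) (by
        refine le_trans (mul_le_mul_of_nonneg_right ?_ hp₀) hr
        exact_mod_cast hlt.le)
    rw [Set.univ_inter, ringProb_univ, one_mul] at h
    refine h.trans ?_
    have h₁ : (1 + r / (θ ^ 4) ^ 2) ^ (2 * ℓ) ≤ v ^ ℓ := by
      rw [pow_mul, ← pow_mul θ]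
      exact pow_le_pow_left₀ (by positivity) hrv ℓ
    have h₂ : (θ * v ^ 2) ^ ℓ ≤ ∏ k ∈ Finset.range ℓ, w k := by
      calc (θ * v ^ 2) ^ ℓ = ∏ _k ∈ Finset.range ℓ, (θ * v ^ 2) := by
            rw [Finset.prod_const, Finset.card_range]
        _ ≤ _ := Finset.prod_le_prod (fun _ _ => by positivity) fun k _ =>
            mul_le_mul_of_nonneg_right (hφθ k) (by positivity)
    have h₃ : (θ ^ 4) ^ ℓ / (θ ^ 4) ^ 2 ≤ K * θ ^ ℓ := by
      rw [hK, div_mul_eq_mul_div, div_le_div_iff₀ (by positivity) (by positivity)]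
      have e₁ : (θ ^ 4) ^ ℓ = θ ^ ℓ * θ ^ s * θ ^ (3 * ℓ - s) := by
        rw [← pow_mul, ← pow_add, ← pow_add]
        congr 1
        omega
      have e₂ : θ ^ (3 * ℓ - s) ≤ θ ^ (2 * s) := pow_le_pow_of_le_one hθ₀.le hθ₁ (by omega)
      calc (θ ^ 4) ^ ℓ * (2 * ((L : ℝ) + 1) ^ 3)
          = θ ^ ℓ * θ ^ s * (2 * ((L : ℝ) + 1) ^ 3 * θ ^ (3 * ℓ - s)) := by rw [e₁]; ring
        _ ≤ θ ^ ℓ * θ ^ s * (2 * ((L : ℝ) + 1) ^ 3 * θ ^ (2 * s)) := by gcongr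
        _ ≤ θ ^ ℓ * θ ^ s * θ ^ 8 := by gcongr
        _ = θ ^ s * θ ^ ℓ * (θ ^ 4) ^ 2 := by ring
    calc (θ ^ 4) ^ ℓ / (θ ^ 4) ^ 2 * (1 + r / (θ ^ 4) ^ 2) ^ (2 * ℓ)
        ≤ (K * θ ^ ℓ) * v ^ ℓ := mul_le_mul h₃ h₁ (by positivity) (by positivity)
      _ ≤ (K * θ ^ ℓ) * (v ^ 2) ^ ℓ := by
          gcongr
          nlinarith
      _ = K * (θ * v ^ 2) ^ ℓ := by rw [mul_pow]; ring
      _ ≤ _ := mul_le_mul_of_nonneg_left h₂ hK₀.le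
  set b : ℤ := a + ℓ with hb
  set I := Finset.Icc a b with hI
  have hIcard : I.card = ℓ + 1 := by rw [hI, Int.card_Icc]; omega
  set T₁ := (I ×ˢ I).filter fun cd => (s : ℤ) ≤ (b - a) - (cd.2 - cd.1) ∧
    (b - a) - (cd.2 - cd.1) ≤ 2 * s with hT₁
  set T₂ := (I ×ˢ I ×ˢ I).filter fun ced => (s : ℤ) ≤ ced.2.1 - ced.1 ∧
    (s : ℤ) ≤ ced.2.2 - ced.2.1 ∧ (b - a) - (ced.2.2 - ced.1) < s with hT₂
  have hcover : {H | Spanned σ H a b} ⊆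
      (⋃ cd ∈ T₁, ({H | Spanned σ H cd.1 cd.2} ∩ {H | Spanned σ H a b})) ∪
      ⋃ ced ∈ T₂, ({H | Spanned σ H ced.1 ced.2.1} ∩ {H | Spanned σ H ced.2.1 ced.2.2}) := by
    intro H hH
    rcases Spanned.descent (s := s) (by omega) hH (by omega) with
      ⟨c, d, hac, hdb, hcd, h₁, h₂⟩ | ⟨c, e, d, hac, hdb, hce, hed, h₁, h₂, h₃⟩
    · left
      have := hcd.lt
      refine Set.mem_iUnion₂.2 ⟨(c, d), ?_, hcd, hH⟩
      simp only [hT₁, hI, Finset.mem_filter, Finset.mem_product, Finset.mem_Icc]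
      omega
    · right
      refine Set.mem_iUnion₂.2 ⟨(c, e, d), ?_, hce, hed⟩
      simp only [hT₂, hI, Finset.mem_filter, Finset.mem_product, Finset.mem_Icc]
      omega
  have hone : ∀ cd ∈ T₁, ringProb n p ({H | Spanned σ H cd.1 cd.2} ∩ {H | Spanned σ H a b}) ≤
      (K * ∏ k ∈ Finset.range ℓ, w k) / (θ ^ 2 * v ^ s) := by
    rintro ⟨c, d⟩ hcd
    simp only [hT₁, hI, Finset.mem_filter, Finset.mem_product, Finset.mem_Icc] at hcd
    obtain ⟨⟨⟨hac, hcb⟩, had, hdb⟩, h₁, h₂⟩ := hcd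
    obtain ⟨j, hj⟩ := Int.le.dest (show c ≤ d by omega)
    obtain rfl : d = c + j := hj.symm
    obtain ⟨m, hm⟩ : ∃ m : ℕ, ℓ = j + m := Nat.exists_eq_add_of_le (by omega)
    have hsm : s ≤ m := by omega
    have hm2 : m ≤ 2 * s := by omega
    have h := ringProb_inter_spanned_le (n := n) (p := p) hσ (a := a) (b := b) (c := c)
      (d := c + j) hac (by omega) hdb (by omega) (edgeDetermined_spanned σ c (c + j)) (f := φ j)
      (r := r) (m := m) (hφ₀ j) (hφ₁ j) (by
        rw [add_sub_cancel_left, Int.toNat_natCast]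
        exact le_max_left _ _) hr₀ hr₁ (by omega) (by
        refine le_trans (mul_le_mul_of_nonneg_right ?_ hp₀) hr
        exact_mod_cast (show m ≤ 3 * s by omega))
    refine h.trans ?_
    have hih := ih j (by omega) (by omega) (by omega) c
    have hv' : (1 + r / φ j ^ 2) ^ (2 * m) ≤ v ^ m := by
      rw [pow_mul]
      refine pow_le_pow_left₀ (by positivity) (le_trans ?_ hrv) m
      have : θ ^ 8 ≤ φ j ^ 2 := calc
        θ ^ 8 ≤ θ ^ 2 := pow_le_pow_of_le_one hθ₀.le hθ₁ (by norm_num)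
        _ ≤ φ j ^ 2 := pow_le_pow_left₀ hθ₀.le (hφθ j) 2
      have hφj := hφ₀ j
      gcongr
    have hprod : (∏ k ∈ Finset.range j, w k) * (φ j * v ^ 2) ^ m ≤ ∏ k ∈ Finset.range ℓ, w k := by
      rw [hm, Finset.prod_range_add]
      refine mul_le_mul_of_nonneg_left ?_ (hprod₀ j).le
      calc (φ j * v ^ 2) ^ m = ∏ _k ∈ Finset.range m, w j := by
            rw [Finset.prod_const, Finset.card_range]
        _ ≤ _ := Finset.prod_le_prod (fun _ _ => (hw₀ j).le) fun k _ =>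
            hwmono (Nat.le_add_right j k)
    have hvs : v ^ s ≤ v ^ m := pow_le_pow_right₀ hv hsm
    have hφj := hφ₀ j
    calc ringProb n p {H | Spanned σ H c (c + j)} *
          (φ j ^ m / φ j ^ 2 * (1 + r / φ j ^ 2) ^ (2 * m))
        ≤ (K * ∏ k ∈ Finset.range j, w k) * (φ j ^ m / θ ^ 2 * v ^ m) := by
          refine mul_le_mul hih ?_ (by positivity) (mul_pos hK₀ (hprod₀ j)).le
          refine mul_le_mul ?_ hv' (by positivity) (by positivity)
          have := hφθ j
          gcongr
      _ = (K * ((∏ k ∈ Finset.range j, w k) * (φ j * v ^ 2) ^ m)) / (θ ^ 2 * v ^ m) := by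
          rw [mul_pow, ← pow_mul, mul_comm 2 m, pow_mul]
          field_simp
      _ ≤ (K * ∏ k ∈ Finset.range ℓ, w k) / (θ ^ 2 * v ^ s) := by
          have := hprod₀ ℓ
          gcongr
  have htwo : ∀ ced ∈ T₂, ringProb n p
      ({H | Spanned σ H ced.1 ced.2.1} ∩ {H | Spanned σ H ced.2.1 ced.2.2}) ≤
      (K * ∏ k ∈ Finset.range ℓ, w k) / (2 * ((L : ℝ) + 1) ^ 3) := by
    rintro ⟨c, e, d⟩ hced
    simp only [hT₂, hI, Finset.mem_filter, Finset.mem_product, Finset.mem_Icc] at hced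
    obtain ⟨⟨⟨hac, hcb⟩, ⟨hae, heb⟩, had, hdb⟩, h₁, h₂, h₃⟩ := hced
    obtain ⟨i, hi⟩ := Int.le.dest (show c ≤ e by omega)
    obtain rfl : e = c + i := hi.symm
    obtain ⟨j, hj⟩ := Int.le.dest (show c + i ≤ d by omega)
    obtain rfl : d = c + i + j := hj.symm
    obtain ⟨m, hm⟩ : ∃ m : ℕ, ℓ = i + j + m := Nat.exists_eq_add_of_le (by omega)
    have hms : m ≤ s := by omega
    have hdisj : Disjoint (pairsIn c (c + i)) (pairsIn (c + i) (c + i + j)) := by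
      rw [Set.disjoint_left]
      intro q hq hq'
      induction q with
      | _ x y =>
        rw [mk_mem_pairsIn] at hq hq'
        have := hq.1.2
        have := hq'.1.1
        omega
    simp only
    rw [ringProb_inter a (edgeDetermined_spanned σ c (c + i))
      (edgeDetermined_spanned σ (c + i) (c + i + j)) (pairsIn_subset hac (by omega))
      (pairsIn_subset hae (by omega)) hdisj]
    have hi' := ih i (by omega) (by omega) (by omega) c
    have hj' := ih j (by omega) (by omega) (by omega) (c + i)
    have hprod : (∏ k ∈ Finset.range i, w k) * (∏ k ∈ Finset.range j, w k) * θ ^ s ≤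
        ∏ k ∈ Finset.range ℓ, w k := by
      rw [hm, Finset.prod_range_add, Finset.prod_range_add]
      refine mul_le_mul (mul_le_mul_of_nonneg_left ?_ (hprod₀ i).le) ?_ (by positivity)
        (mul_nonneg (hprod₀ i).le (Finset.prod_nonneg fun k _ => (hw₀ _).le))
      · exact Finset.prod_le_prod (fun k _ => (hw₀ k).le) fun k _ => hwmono (Nat.le_add_left k i)
      · calc θ ^ s ≤ θ ^ m := pow_le_pow_of_le_one hθ₀.le hθ₁ hms
          _ = ∏ _k ∈ Finset.range m, θ := by rw [Finset.prod_const, Finset.card_range]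
          _ ≤ _ := Finset.prod_le_prod (fun _ _ => hθ₀.le) fun k _ => hwθ _
    calc ringProb n p {H | Spanned σ H c (c + i)} *
          ringProb n p {H | Spanned σ H (c + i) (c + i + j)}
        ≤ (K * ∏ k ∈ Finset.range i, w k) * (K * ∏ k ∈ Finset.range j, w k) :=
          mul_le_mul hi' hj' (ringProb_nonneg _) (mul_pos hK₀ (hprod₀ i)).le
      _ = (K * ((∏ k ∈ Finset.range i, w k) * (∏ k ∈ Finset.range j, w k) * θ ^ s)) /
            (2 * ((L : ℝ) + 1) ^ 3) := by
          nth_rewrite 2 [hK]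
          ring
      _ ≤ _ := by gcongr
  have hc₁ : (T₁.card : ℝ) ≤ ((L : ℝ) + 1) ^ 2 := by
    have : T₁.card ≤ (L + 1) ^ 2 := by
      refine (Finset.card_filter_le _ _).trans ?_
      rw [Finset.card_product, hIcard, ← sq]
      gcongr
    exact_mod_cast this
  have hc₂ : (T₂.card : ℝ) ≤ ((L : ℝ) + 1) ^ 3 := by
    have : T₂.card ≤ (L + 1) ^ 3 := by
      refine (Finset.card_filter_le _ _).trans ?_
      rw [Finset.card_product, Finset.card_product, hIcard]
      calc (ℓ + 1) * ((ℓ + 1) * (ℓ + 1)) = (ℓ + 1) ^ 3 := by ring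
        _ ≤ _ := by gcongr
    exact_mod_cast this
  set Q := K * ∏ k ∈ Finset.range ℓ, w k with hQ
  have hQ₀ : 0 < Q := mul_pos hK₀ (hprod₀ ℓ)
  calc ringProb n p {H | Spanned σ H a b}
      ≤ ∑ _cd ∈ T₁, Q / (θ ^ 2 * v ^ s) + ∑ _ced ∈ T₂, Q / (2 * ((L : ℝ) + 1) ^ 3) :=
        (ringProb_mono hcover).trans ((ringProb_union_le _ _).trans (add_le_add
          ((ringProb_biUnion_le _ _).trans (Finset.sum_le_sum hone))
          ((ringProb_biUnion_le _ _).trans (Finset.sum_le_sum htwo))))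
    _ ≤ ((L : ℝ) + 1) ^ 2 * (Q / (θ ^ 2 * v ^ s)) +
          ((L : ℝ) + 1) ^ 3 * (Q / (2 * ((L : ℝ) + 1) ^ 3)) := by
        rw [Finset.sum_const, Finset.sum_const, nsmul_eq_mul, nsmul_eq_mul]
        gcongr
    _ ≤ Q / 2 + Q / 2 := by
        refine add_le_add ?_ (le_of_eq (by field_simp))
        rw [mul_div_assoc', div_le_div_iff₀ (by positivity) two_pos]
        nlinarith
    _ = Q := by ring

end UpperBound

/-! ### Lower bounds from growth in one direction -/

section LowerBound

variable {n : ℕ} [NeZero n] {p : unitInterval} {σ : ℕ}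

/-- An interval is internally spanned if the first `σ` vertices are joined to each other by people
edges along the ring and each of the following ones has `σ` neighbours among its predecessors. -/
theorem le_ringProb_spanned {m : ℕ} (hσ : 1 ≤ σ) (hm : σ ≤ m) (hmn : m ≤ n) (a : ℤ) :
    (p : ℝ) ^ (σ - 1) * ∏ k ∈ Finset.Ico σ m, binTail p k σ ≤
      ringProb n p {H | Spanned σ H a (a + m)} := by
  classical
  set Y : ℕ → Finset ℤ := fun k =>
    if k < σ then {a + k - 1} else Finset.Ico a (a + k) with hY
  set τ : ℕ → ℕ := fun k => if k < σ then 1 else σ with hτ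
  have hsub : (⋂ k ∈ Finset.Ico 1 m, {H | τ k ≤ degIn H (a + k) (Y k)}) ⊆
      {H | Spanned σ H a (a + m)} := by
    intro H hH
    refine spanned_of_growth a m (fun k hk hkm => ?_) (by omega)
    have h := Set.mem_iInter₂.1 hH k (Finset.mem_Ico.2 ⟨hk, hkm⟩)
    simp only [Set.mem_ofPred_eq, hτ, hY] at h
    by_cases hkσ : k < σ
    · left
      rw [if_pos hkσ, if_pos hkσ] at h
      obtain ⟨y, hy, hxy⟩ := exists_adj_of_degIn_pos h
      rw [Finset.mem_singleton] at hy
      exact hy ▸ hxy.symm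
    · right
      rwa [if_neg hkσ, if_neg hkσ] at h
  have hYk : ∀ k : ℕ, 1 ≤ k → ∀ y ∈ Y k, a ≤ y ∧ y < a + k := by
    intro k hk y hy
    by_cases hkσ : k < σ
    · simp only [hY, if_pos hkσ, Finset.mem_singleton] at hy
      omega
    · simpa only [hY, if_neg hkσ, Finset.mem_Ico] using hy
  have hind := ringProb_biInter (n := n) (p := p) (Finset.Ico 1 m) a
    (fun k _ => edgeDetermined_degIn (τ k) (a + k) (Y k))
    (fun k hk => by
      rw [Finset.mem_Ico] at hk
      rintro _ ⟨y, hy, rfl⟩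
      have := hYk k hk.1 y hy
      exact mk_mem_pairsIn.2 ⟨⟨by omega, by omega⟩, ⟨by omega, by omega⟩⟩)
    (fun k hk l hl hne => by
      rw [Finset.mem_Ico] at hk hl
      rw [Set.disjoint_left]
      rintro _ ⟨u, hu, rfl⟩ ⟨v, hv, huv⟩
      have := hYk k hk.1 u hu
      have := hYk l hl.1 v hv
      rw [Sym2.eq_iff] at huv
      omega)
  refine le_trans ?_ (ringProb_mono hsub)
  have hprob : ∀ k ∈ Finset.Ico 1 m, ringProb n p {H | τ k ≤ degIn H (a + k) (Y k)} =
      binTail p (Y k).card (τ k) := by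
    intro k hk
    rw [Finset.mem_Ico] at hk
    refine ringProb_degIn a (τ k) ⟨by omega, by omega⟩ (Y k) (fun y hy => ?_) (fun h => ?_)
    · have := hYk k hk.1 y hy
      exact ⟨by omega, by omega⟩
    · have := hYk k hk.1 _ h
      omega
  rw [hind, Finset.prod_congr rfl hprob, ← Finset.prod_Ico_consecutive _ hσ hm]
  apply le_of_eq
  congr 1
  · rw [Finset.prod_congr rfl (g := fun _ => (p : ℝ)), Finset.prod_const, Nat.card_Ico]
    intro k hk
    rw [Finset.mem_Ico] at hk
    simp only [hτ, hY, if_pos hk.2, Finset.card_singleton, binTail_one]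
    ring
  · refine Finset.prod_congr rfl fun k hk => ?_
    rw [Finset.mem_Ico] at hk
    simp only [hτ, hY, if_neg (not_lt.2 hk.1), Int.card_Ico, add_sub_cancel_left,
      Int.toNat_natCast]

/-- Disjoint intervals of length `m` are internally spanned independently, so that among `N` of them
in a row there is one with high probability if `N` is large compared with the inverse of the
probability `ρ` of one. -/
theorem ringProb_no_spanned_le {m N : ℕ} (hmN : N * m ≤ n) {ρ : ℝ}
    (hρ : ∀ c : ℤ, ρ ≤ ringProb n p {H | Spanned σ H c (c + m)}) (a : ℤ) :
    ringProb n p {H | ¬ ∃ c, a ≤ c ∧ c + m ≤ a + N * m ∧ Spanned σ H c (c + m)} ≤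
      (1 - ρ) ^ N := by
  have hsub : {H | ¬ ∃ c, a ≤ c ∧ c + m ≤ a + N * m ∧ Spanned σ H c (c + m)} ⊆
      ⋂ i ∈ Finset.range N, {H | Spanned σ H (a + i * m) (a + i * m + m)}ᶜ := by
    intro H hH
    refine Set.mem_iInter₂.2 fun i hi hsp => hH ⟨a + i * m, ?_, ?_, hsp⟩
    · have : (0 : ℤ) ≤ i * m := by positivity
      omega
    · have : (i + 1) * m ≤ N * m := Nat.mul_le_mul_right m (Finset.mem_range.1 hi)
      have : ((i + 1) * m : ℤ) ≤ N * m := by exact_mod_cast this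
      linarith
  have hblock : ∀ i j : ℕ, i < j → ((i : ℤ) * m + m) ≤ j * m := by
    intro i j hij
    have : (i + 1) * m ≤ j * m := Nat.mul_le_mul_right m hij
    have : ((i + 1) * m : ℤ) ≤ j * m := by exact_mod_cast this
    linarith
  have hNn : ((N : ℤ) * m) ≤ n := by exact_mod_cast hmN
  have hind := ringProb_biInter (n := n) (p := p) (Finset.range N) a
    (fun i _ => (edgeDetermined_spanned σ (a + i * m) (a + i * m + m)).compl)
    (fun i hi => pairsIn_subset (by have : (0 : ℤ) ≤ i * m := by positivity
                                    omega) (by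
      have := hblock i N (Finset.mem_range.1 hi)
      omega))
    (fun i _ j _ hne => by
      rw [Set.disjoint_left]
      intro e he he'
      induction e with
      | _ x y =>
        rw [mk_mem_pairsIn, Set.mem_Ico] at he he'
        rcases lt_or_gt_of_ne hne with h | h
        · have := hblock i j h
          omega
        · have := hblock j i h
          omega)
  refine (ringProb_mono hsub).trans ?_
  rw [hind]
  calc _ ≤ ∏ _i ∈ Finset.range N, (1 - ρ) := Finset.prod_le_prod (fun _ _ => ringProb_nonneg _)
        fun i _ => by
          rw [ringProb_compl]
          have := hρ (a + i * m)
          linarith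
    _ = (1 - ρ) ^ N := by rw [Finset.prod_const, Finset.card_range]

end LowerBound

/-! ### The Poisson limit and the integral of `gFun` -/

section Poisson

/-- The probability that a Poisson variable with mean `x` is at least `σ`. -/
noncomputable def poisTail (σ : ℕ) (x : ℝ) : ℝ :=
  1 - ∑ i ∈ Finset.range σ, Real.exp (-x) * x ^ i / i.factorial

theorem gFun_eq {σ : ℕ} {x : ℝ} (hx : 0 ≤ x) : gFun σ x = -Real.log (poisTail σ x) := by
  have hset : {k : ℕ | σ ≤ k} = ((Finset.range σ : Finset ℕ) : Set ℕ)ᶜ := by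
    ext k
    simp
  rw [gFun, hset, probReal_compl_eq_one_sub (Finset.measurableSet _), poisTail,
    ← sum_measureReal_singleton]
  simp_rw [poissonMeasure_real_singleton, Real.coe_toNNReal x hx]

theorem poisTail_le_one {σ : ℕ} {x : ℝ} (hx : 0 ≤ x) : poisTail σ x ≤ 1 := by
  rw [poisTail, sub_le_self_iff]
  exact Finset.sum_nonneg fun i _ => by positivity

theorem measurable_poisTail (σ : ℕ) : Measurable (poisTail σ) := by
  unfold poisTail
  fun_prop

theorem tendsto_one_sub_pow {ι : Type*} {l : Filter ι} {p : ι → ℝ} {k : ι → ℕ} {x : ℝ}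
    (hp : Tendsto p l (𝓝 0)) (hp₀ : ∀ᶠ i in l, 0 < p i)
    (hk : Tendsto (fun i => (k i : ℝ) * p i) l (𝓝 x)) :
    Tendsto (fun i => (1 - p i) ^ k i) l (𝓝 (Real.exp (-x))) := by
  have h₁ : Tendsto (fun i => Real.exp (-((k i : ℝ) * p i) / (1 - p i))) l
      (𝓝 (Real.exp (-x))) := by
    have := (hk.neg).div (tendsto_const_nhds.sub hp) (by norm_num : (1 : ℝ) - 0 ≠ 0)
    rw [sub_zero, div_one] at this
    exact (Real.continuous_exp.tendsto _).comp this
  have h₂ : Tendsto (fun i => Real.exp (-((k i : ℝ) * p i))) l (𝓝 (Real.exp (-x))) :=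
    (Real.continuous_exp.tendsto _).comp hk.neg
  have hp₁ : ∀ᶠ i in l, p i < 1 := hp.eventually (gt_mem_nhds one_pos)
  refine tendsto_of_tendsto_of_tendsto_of_le_of_le' h₁ h₂ ?_ ?_
  · filter_upwards [hp₀, hp₁] with i h₀ h₁
    have hpos : 0 < 1 - p i := by linarith
    have h : Real.exp (-p i / (1 - p i)) ≤ 1 - p i := by
      have := Real.add_one_le_exp (p i / (1 - p i))
      rw [neg_div, Real.exp_neg, inv_le_comm₀ (Real.exp_pos _) hpos]
      refine le_trans (le_of_eq ?_) this
      field_simp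
      ring
    calc Real.exp (-((k i : ℝ) * p i) / (1 - p i)) = Real.exp (-p i / (1 - p i)) ^ k i := by
          rw [← Real.exp_nat_mul]
          congr 1
          ring
      _ ≤ _ := pow_le_pow_left₀ (Real.exp_pos _).le h _
  · filter_upwards [hp₁] with i h₁
    calc (1 - p i) ^ k i ≤ Real.exp (-p i) ^ k i :=
          pow_le_pow_left₀ (by linarith) (by have := Real.add_one_le_exp (-p i); linarith) _
      _ = _ := by rw [← Real.exp_nat_mul]; congr 1; ring

/-- The Poisson limit theorem for binomial tails. -/
theorem tendsto_binTail {ι : Type*} {l : Filter ι} {p : ι → ℝ} {k : ι → ℕ} {x : ℝ} (hx : 0 < x)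
    (hp : Tendsto p l (𝓝 0)) (hp₀ : ∀ᶠ i in l, 0 < p i)
    (hk : Tendsto (fun i => (k i : ℝ) * p i) l (𝓝 x)) (σ : ℕ) :
    Tendsto (fun i => binTail (p i) (k i) σ) l (𝓝 (poisTail σ x)) := by
  simp_rw [binTail_eq]
  refine tendsto_const_nhds.sub (tendsto_finsetSum _ fun j _ => ?_)
  have hp0 : Tendsto p l (𝓝[>] 0) := tendsto_nhdsWithin_iff.2 ⟨hp, hp₀⟩
  have hkr : Tendsto (fun i => (k i : ℝ)) l atTop := by
    have h := (hk.pos_mul_atTop hx (tendsto_inv_nhdsGT_zero.comp hp0))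
    refine h.congr' ?_
    filter_upwards [hp₀] with i hi
    simp only [Function.comp]
    field_simp
  have hkn : Tendsto k l atTop := tendsto_natCast_atTop_iff.1 hkr
  have h₁ : Tendsto (fun i => ((k i).choose j : ℝ) * p i ^ j) l (𝓝 (x ^ j / j.factorial)) := by
    have he : (fun i => ((k i).choose j : ℝ) * p i ^ j) ~[l]
        fun i => ((k i : ℝ) * p i) ^ j / j.factorial :=
      (((isEquivalent_choose j).comp_tendsto hkn).mul IsEquivalent.refl).trans
        (EventuallyEq.isEquivalent (.of_eq (by
          ext i; simp only [Function.comp, Pi.mul_apply]; ring)))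
    refine he.symm.tendsto_nhds ?_
    exact (hk.pow j).div_const _
  have h₂ : Tendsto (fun i => (1 - p i) ^ (k i - j)) l (𝓝 (Real.exp (-x))) := by
    refine tendsto_one_sub_pow hp hp₀ ?_
    have : Tendsto (fun i => (k i : ℝ) * p i - j * p i) l (𝓝 (x - j * 0)) :=
      hk.sub (hp.const_mul _)
    rw [mul_zero, sub_zero] at this
    refine this.congr' ?_
    filter_upwards [hkn.eventually_ge_atTop j] with i hi
    rw [Nat.cast_sub hi]
    ring
  have := h₁.mul h₂
  rwa [mul_comm, ← mul_div_assoc] at this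

/-- A lower bound for binomial tails, by splitting the trials into `σ` groups with one success in
each of them. -/
theorem pow_le_binTail {p : ℝ} (h₀ : 0 ≤ p) (h₁ : p ≤ 1) {σ k : ℕ} (hσ : 1 ≤ σ) (hk : σ ≤ k) :
    (1 - Real.exp (-(p * (k + 1)) / (2 * σ))) ^ σ ≤ binTail p k σ := by
  set j := k / σ with hj
  have hj₁ : σ * j ≤ k := Nat.mul_div_le k σ
  have hj₂ : k + 1 ≤ 2 * σ * j := by
    have h := Nat.lt_mul_div_succ k hσ
    have : 1 ≤ j := (Nat.one_le_div_iff hσ).2 hk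
    rw [← hj] at h
    nlinarith
  have hσ' : (0 : ℝ) < σ := by exact_mod_cast hσ
  have hexp : (1 - p) ^ j ≤ Real.exp (-(p * (k + 1)) / (2 * σ)) := by
    calc (1 - p) ^ j ≤ Real.exp (-p) ^ j :=
          pow_le_pow_left₀ (by linarith) (by have := Real.add_one_le_exp (-p); linarith) _
      _ = Real.exp (-(p * j)) := by rw [← Real.exp_nat_mul]; congr 1; ring
      _ ≤ _ := by
        rw [Real.exp_le_exp, neg_div, neg_le_neg_iff, div_le_iff₀ (by positivity)]
        have : (k : ℝ) + 1 ≤ 2 * σ * j := by exact_mod_cast hj₂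
        nlinarith
  have hle : Real.exp (-(p * (k + 1)) / (2 * σ)) ≤ 1 := by
    rw [Real.exp_le_one_iff, neg_div, neg_nonpos]
    positivity
  calc (1 - Real.exp (-(p * (k + 1)) / (2 * σ))) ^ σ ≤ binTail p j 1 ^ σ := by
        rw [binTail_one]
        exact pow_le_pow_left₀ (by linarith) (by linarith) _
    _ ≤ binTail p (σ * j) σ := binTail_pow_le h₀ h₁ j σ
    _ ≤ binTail p k σ := binTail_mono h₀ h₁ σ hj₁

/-- An integrable majorant for `gFun σ` and for its discrete versions. -/
noncomputable def gBound (σ : ℕ) (x : ℝ) : ℝ :=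
  2 * σ * ((x / (2 * σ)) ^ (-(1 / 2) : ℝ) * Real.exp (-(x / (8 * σ))))

theorem neg_log_one_sub_exp_le {y : ℝ} (hy : 0 < y) :
    -Real.log (1 - Real.exp (-y)) ≤ 2 * (y ^ (-(1 / 2) : ℝ) * Real.exp (-(y / 4))) := by
  set u := y ^ (-(1 / 2) : ℝ) * Real.exp (-(y / 4)) with hu
  have hu₀ : 0 < u := by positivity
  have hlt : Real.exp (-y) < 1 := by rw [Real.exp_lt_one_iff]; linarith
  have hu2 : u ^ 2 = (y * Real.exp (y / 2))⁻¹ := by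
    rw [hu, mul_pow, ← Real.rpow_natCast, ← Real.rpow_mul hy.le, ← Real.exp_nat_mul, mul_inv,
      ← Real.exp_neg]
    norm_num
    rw [Real.rpow_neg_one]
    congr 2
    ring
  have hsinh : y * Real.exp (y / 2) ≤ Real.exp y - 1 := by
    have h := Real.self_le_sinh_iff.2 (show 0 ≤ y / 2 by linarith)
    rw [Real.sinh_eq] at h
    have e₁ : Real.exp (y / 2) * Real.exp (y / 2) = Real.exp y := by
      rw [← Real.exp_add]; congr 1; ring
    have e₂ : Real.exp (-(y / 2)) * Real.exp (y / 2) = 1 := by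
      rw [← Real.exp_add, neg_add_cancel, Real.exp_zero]
    nlinarith [Real.exp_pos (y / 2)]
  have hmain : (1 - Real.exp (-y))⁻¹ ≤ (1 + u) ^ 2 := by
    have hyexp : 0 < y * Real.exp (y / 2) := by positivity
    have e : (1 - Real.exp (-y))⁻¹ = 1 + (Real.exp y - 1)⁻¹ := by
      have h₁ : Real.exp y - 1 ≠ 0 := (hyexp.trans_le hsinh).ne'
      have h₂ : 1 - Real.exp (-y) ≠ 0 := by linarith
      have e₂ : Real.exp (-y) * Real.exp y = 1 := by
        rw [← Real.exp_add, neg_add_cancel, Real.exp_zero]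
      field_simp
      linarith
    have : (Real.exp y - 1)⁻¹ ≤ u ^ 2 := by
      rw [hu2]
      exact inv_anti₀ hyexp hsinh
    rw [e]
    nlinarith
  rw [← Real.log_inv]
  calc Real.log (1 - Real.exp (-y))⁻¹ ≤ Real.log ((1 + u) ^ 2) :=
        Real.log_le_log (inv_pos.2 (by linarith)) hmain
    _ = 2 * Real.log (1 + u) := by rw [Real.log_pow]; norm_num
    _ ≤ 2 * u := by
        have := Real.log_le_sub_one_of_pos (show 0 < 1 + u by linarith)
        linarith

theorem neg_log_le_gBound {σ : ℕ} (hσ : 1 ≤ σ) {x q : ℝ} (hx : 0 < x)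
    (hq : (1 - Real.exp (-x / (2 * σ))) ^ σ ≤ q) : -Real.log q ≤ gBound σ x := by
  have hσ' : (0 : ℝ) < σ := by exact_mod_cast hσ
  have hlt : Real.exp (-x / (2 * σ)) < 1 := by
    rw [Real.exp_lt_one_iff, neg_div, neg_lt_zero]
    positivity
  have h := Real.log_le_log (pow_pos (by linarith) σ) hq
  rw [Real.log_pow] at h
  have h₂ := neg_log_one_sub_exp_le (show 0 < x / (2 * σ) by positivity)
  rw [← neg_div] at h₂
  have h₃ : x / (2 * σ) / 4 = x / (8 * σ) := by
    rw [div_div]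
    congr 1
    ring
  rw [h₃] at h₂
  rw [gBound]
  nlinarith

theorem integrableOn_gBound {σ : ℕ} (hσ : 1 ≤ σ) : IntegrableOn (gBound σ) (Set.Ioi 0) := by
  have hσ' : (0 : ℝ) < σ := by exact_mod_cast hσ
  have h := integrableOn_rpow_mul_exp_neg_mul_rpow (s := -(1 / 2)) (p := 1) (b := 1 / (8 * σ))
    (by norm_num) one_pos (by positivity)
  have h₂ := h.const_mul (2 * σ * (1 / (2 * σ)) ^ (-(1 / 2) : ℝ))
  refine IntegrableOn.congr_fun h₂ (fun x hx => ?_) measurableSet_Ioi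
  rw [Set.mem_Ioi] at hx
  simp only [gBound, Real.rpow_one]
  rw [show x / (2 * σ) = 1 / (2 * σ) * x by ring, Real.mul_rpow (by positivity) hx.le]
  have e : -(1 / (8 * (σ : ℝ))) * x = -(x / (8 * σ)) := by ring
  rw [e]
  ring

theorem tendsto_floor_div_mul {x : ℝ} (hx : 0 ≤ x) :
    Tendsto (fun p : ℝ => (⌊x / p⌋₊ : ℝ) * p) (𝓝[>] 0) (𝓝 x) := by
  have h := tendsto_nat_floor_mul_div_atTop hx
  have h₂ := h.comp tendsto_inv_nhdsGT_zero
  refine h₂.congr' ?_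
  filter_upwards [self_mem_nhdsWithin] with p hp
  simp only [Function.comp, div_eq_mul_inv, inv_inv]

theorem tendsto_binTail_floor {x : ℝ} (hx : 0 < x) (σ : ℕ) :
    Tendsto (fun p : ℝ => binTail p ⌊x / p⌋₊ σ) (𝓝[>] 0) (𝓝 (poisTail σ x)) :=
  tendsto_binTail hx (tendsto_id.mono_left nhdsWithin_le_nhds) self_mem_nhdsWithin
    (tendsto_floor_div_mul hx.le) σ

theorem pow_le_binTail_floor {p x : ℝ} (h₀ : 0 < p) (h₁ : p ≤ 1) {σ : ℕ} (hσ : 1 ≤ σ)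
    (hx : σ * p ≤ x) : (1 - Real.exp (-x / (2 * σ))) ^ σ ≤ binTail p ⌊x / p⌋₊ σ := by
  have hσ' : (0 : ℝ) < σ := by exact_mod_cast hσ
  have hx₀ : 0 ≤ x := le_trans (by positivity) hx
  refine le_trans ?_ (pow_le_binTail h₀.le h₁ hσ (Nat.le_floor ((le_div_iff₀ h₀).2 hx)))
  have hle : Real.exp (-x / (2 * σ)) ≤ 1 := by
    rw [Real.exp_le_one_iff, neg_div, neg_nonpos]
    positivity
  refine pow_le_pow_left₀ (by linarith) (sub_le_sub_left (Real.exp_le_exp.2 ?_) 1) σ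
  rw [neg_div, neg_div, neg_le_neg_iff]
  refine div_le_div_of_nonneg_right ?_ (by positivity)
  have := Nat.lt_floor_add_one (x / p)
  rw [div_lt_iff₀ h₀] at this
  linarith

theorem pow_le_poisTail {σ : ℕ} (hσ : 1 ≤ σ) {x : ℝ} (hx : 0 < x) :
    (1 - Real.exp (-x / (2 * σ))) ^ σ ≤ poisTail σ x := by
  have hσ' : (0 : ℝ) < σ := by exact_mod_cast hσ
  refine ge_of_tendsto (tendsto_binTail_floor hx σ) ?_
  filter_upwards [self_mem_nhdsWithin, nhdsWithin_le_nhds (Iio_mem_nhds (one_pos)),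
    nhdsWithin_le_nhds (Iio_mem_nhds (show (0 : ℝ) < x / σ by positivity))] with p h₀ h₁ h₂
  refine pow_le_binTail_floor h₀ (le_of_lt h₁) hσ ?_
  have := (lt_div_iff₀ hσ').1 h₂
  linarith

theorem poisTail_pos {σ : ℕ} (hσ : 1 ≤ σ) {x : ℝ} (hx : 0 < x) : 0 < poisTail σ x := by
  refine lt_of_lt_of_le (pow_pos ?_ σ) (pow_le_poisTail hσ hx)
  have hσ' : (0 : ℝ) < σ := by exact_mod_cast hσ
  have : Real.exp (-x / (2 * σ)) < 1 := by
    rw [Real.exp_lt_one_iff, neg_div, neg_lt_zero]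
    positivity
  linarith

theorem gFun_nonneg {σ : ℕ} (hσ : 1 ≤ σ) {x : ℝ} (hx : 0 < x) : 0 ≤ gFun σ x := by
  rw [gFun_eq hx.le, neg_nonneg]
  exact Real.log_nonpos (poisTail_pos hσ hx).le (poisTail_le_one hx.le)

theorem gFun_le_gBound {σ : ℕ} (hσ : 1 ≤ σ) {x : ℝ} (hx : 0 < x) : gFun σ x ≤ gBound σ x := by
  rw [gFun_eq hx.le]
  exact neg_log_le_gBound hσ hx (pow_le_poisTail hσ hx)

theorem integrableOn_gFun {σ : ℕ} (hσ : 1 ≤ σ) : IntegrableOn (gFun σ) (Set.Ioi 0) := by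
  have h : IntegrableOn (fun x => -Real.log (poisTail σ x)) (Set.Ioi 0) := by
    refine Integrable.mono' (integrableOn_gBound hσ)
      ((Real.measurable_log.comp (measurable_poisTail σ)).neg.aestronglyMeasurable) ?_
    filter_upwards [ae_restrict_mem measurableSet_Ioi] with x hx
    rw [← gFun_eq (le_of_lt hx), Real.norm_of_nonneg (gFun_nonneg hσ hx)]
    exact gFun_le_gBound hσ hx
  exact h.congr_fun (fun x hx => (gFun_eq (le_of_lt hx)).symm) measurableSet_Ioi

end Poisson

/-! ### Riemann sums -/

section Riemann

theorem setIntegral_floor_div {p : ℝ} (hp : 0 < p) (h : ℕ → ℝ) {a b : ℕ} (hab : a ≤ b) :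
    IntegrableOn (fun x : ℝ => h ⌊x / p⌋₊) (Set.Ico (a * p) (b * p)) ∧
      ∫ x in Set.Ico (a * p) (b * p), h ⌊x / p⌋₊ = p * ∑ k ∈ Finset.Ico a b, h k := by
  induction b, hab using Nat.le_induction with
  | base => simp
  | succ b hab ih =>
    have hab' : (a : ℝ) * p ≤ b * p := by gcongr
    have hbb : (b : ℝ) * p ≤ (b + 1 : ℕ) * p := by gcongr; simp
    have hfl : Set.EqOn (fun _ : ℝ => h b) (fun x : ℝ => h ⌊x / p⌋₊)
        (Set.Ico ((b : ℝ) * p) ((b + 1 : ℕ) * p)) := by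
      intro x hx
      have hx0 : 0 ≤ x := le_trans (by positivity) hx.1
      have : ⌊x / p⌋₊ = b := by
        rw [Nat.floor_eq_iff (by positivity)]
        refine ⟨(le_div_iff₀ hp).2 hx.1, (div_lt_iff₀ hp).2 ?_⟩
        have := hx.2
        push_cast at this
        exact this
      simp only [this]
    have hvol : volume.real (Set.Ico ((b : ℝ) * p) ((b + 1 : ℕ) * p)) = p := by
      rw [Real.volume_real_Ico_of_le hbb]
      push_cast
      ring
    have hi : IntegrableOn (fun x : ℝ => h ⌊x / p⌋₊)
        (Set.Ico ((b : ℝ) * p) ((b + 1 : ℕ) * p)) :=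
      IntegrableOn.congr_fun (integrableOn_const (by simp)) hfl measurableSet_Ico
    have hint : ∫ x in Set.Ico ((b : ℝ) * p) ((b + 1 : ℕ) * p), h ⌊x / p⌋₊ = p * h b := by
      rw [← setIntegral_congr_fun measurableSet_Ico hfl, setIntegral_const, hvol, smul_eq_mul]
    rw [← Set.Ico_union_Ico_eq_Ico hab' hbb]
    refine ⟨ih.1.union hi, ?_⟩
    rw [setIntegral_union (Set.Ico_disjoint_Ico_same) measurableSet_Ico ih.1 hi, ih.2, hint,
      Finset.sum_Ico_succ_top hab, mul_add]

theorem measurable_comp_floor_div (h : ℕ → ℝ) (p : ℝ) : Measurable fun x : ℝ => h ⌊x / p⌋₊ :=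
  (measurable_from_top (f := h)).comp (Nat.measurable_floor.comp (measurable_id.div_const p))

/-- The cost of growing to the right from `σ` vertices to infinity is at most the integral
`lambdaCrit σ`, in the limit `p → 0` and in units of `1 / p`. -/
theorem eventually_sum_neg_log_binTail_le {σ : ℕ} (hσ : 1 ≤ σ) {ε : ℝ} (hε : 0 < ε) :
    ∀ᶠ p : ℝ in 𝓝[>] 0, ∀ m, σ ≤ m →
      p * ∑ k ∈ Finset.Ico σ m, -Real.log (binTail p k σ) ≤ lambdaCrit σ + ε := by
  have hσ' : (0 : ℝ) < σ := by exact_mod_cast hσ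
  set ψ : ℝ → ℝ → ℝ := fun p => Set.indicator (Set.Ici (σ * p))
    fun x => -Real.log (binTail p ⌊x / p⌋₊ σ) with hψ
  have hp₁ : ∀ᶠ p : ℝ in 𝓝[>] 0, p < 1 := nhdsWithin_le_nhds (Iio_mem_nhds one_pos)
  have hmeas : ∀ p, Measurable (ψ p) := fun p =>
    (measurable_comp_floor_div (fun k => -Real.log (binTail p k σ)) p).indicator measurableSet_Ici
  have hnn : ∀ p, 0 < p → p ≤ 1 → ∀ k, 0 ≤ -Real.log (binTail p k σ) := fun p h₀ h₁ k =>
    neg_nonneg.2 (Real.log_nonpos (binTail_nonneg h₀.le h₁ k σ) (binTail_le_one h₀.le h₁ k σ))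
  have hψnn : ∀ p, 0 < p → p ≤ 1 → ∀ x, 0 ≤ ψ p x := fun p h₀ h₁ x =>
    Set.indicator_nonneg (fun y _ => hnn p h₀ h₁ _) x
  have hbound : ∀ p, 0 < p → p ≤ 1 → ∀ x, 0 < x → ‖ψ p x‖ ≤ gBound σ x := by
    intro p h₀ h₁ x hx
    rw [Real.norm_of_nonneg (hψnn p h₀ h₁ x)]
    by_cases h : x ∈ Set.Ici (σ * p)
    · rw [hψ]
      simp only [Set.indicator_of_mem h]
      exact neg_log_le_gBound hσ hx (pow_le_binTail_floor h₀ h₁ hσ h)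
    · rw [hψ]
      simp only [Set.indicator_of_notMem h]
      exact (gFun_nonneg hσ hx).trans (gFun_le_gBound hσ hx)
  have hlim : Tendsto (fun p => ∫ x in Set.Ioi 0, ψ p x) (𝓝[>] 0) (𝓝 (lambdaCrit σ)) := by
    refine tendsto_integral_filter_of_dominated_convergence (gBound σ)
      (Eventually.of_forall fun p => (hmeas p).aestronglyMeasurable) ?_ (integrableOn_gBound hσ) ?_
    · filter_upwards [self_mem_nhdsWithin, hp₁] with p h₀ h₁
      filter_upwards [ae_restrict_mem measurableSet_Ioi] with x hx
      exact hbound p h₀ h₁.le x hx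
    · filter_upwards [ae_restrict_mem measurableSet_Ioi] with x hx
      rw [Set.mem_Ioi] at hx
      rw [gFun_eq hx.le]
      refine ((tendsto_binTail_floor hx σ).log (poisTail_pos hσ hx).ne').neg.congr' ?_
      filter_upwards [self_mem_nhdsWithin,
        nhdsWithin_le_nhds (Iio_mem_nhds (show (0 : ℝ) < x / σ by positivity))] with p h₀ h₁
      rw [hψ]
      simp only
      rw [Set.indicator_of_mem]
      have := (lt_div_iff₀ hσ').1 h₁
      rw [Set.mem_Ici]
      linarith
  filter_upwards [self_mem_nhdsWithin, hp₁,
    hlim.eventually (gt_mem_nhds (show lambdaCrit σ < lambdaCrit σ + ε by linarith))]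
    with p h₀ h₁ h₂ m hm
  rw [Set.mem_Ioi] at h₀
  rw [← (setIntegral_floor_div h₀ (fun k => -Real.log (binTail p k σ)) hm).2]
  refine le_trans ?_ h₂.le
  have hint : IntegrableOn (ψ p) (Set.Ioi 0) := by
    refine Integrable.mono' (integrableOn_gBound hσ) (hmeas p).aestronglyMeasurable ?_
    filter_upwards [ae_restrict_mem measurableSet_Ioi] with x hx
    exact hbound p h₀ h₁.le x hx
  have hsub : Set.Ico ((σ : ℝ) * p) (m * p) ⊆ Set.Ioi 0 := fun x hx =>
    lt_of_lt_of_le (by positivity) hx.1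
  have heq : ∫ x in Set.Ico ((σ : ℝ) * p) (m * p), -Real.log (binTail p ⌊x / p⌋₊ σ) =
      ∫ x in Set.Ico ((σ : ℝ) * p) (m * p), ψ p x := by
    refine setIntegral_congr_fun measurableSet_Ico fun x hx => ?_
    rw [hψ]
    simp only
    rw [Set.indicator_of_mem]
    exact hx.1
  rw [heq]
  exact setIntegral_mono_set hint
    (Eventually.of_forall fun x => hψnn p h₀ h₁.le x) hsub.eventuallyLE

/-- The truncated cost of reaching length `M / p` is at least `lambdaCrit σ`, up to an arbitrarily
small error for large `M`, in the limit `p → 0` and in units of `1 / p`. -/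
theorem exists_le_sum_neg_log_max {σ : ℕ} (hσ : 1 ≤ σ) {ε : ℝ} (hε : 0 < ε) :
    ∃ M : ℕ, 1 ≤ M ∧ ∀ᶠ p : ℝ in 𝓝[>] 0, lambdaCrit σ - ε ≤
      p * ∑ k ∈ Finset.range ⌈(M : ℝ) / p⌉₊, -Real.log (max (binTail p k σ) (Real.exp (-M))) := by
  set χ : ℕ → ℝ → ℝ := fun N => Set.indicator (Set.Ioo 0 (N : ℝ))
    fun x => -Real.log (max (poisTail σ x) (Real.exp (-N))) with hχ
  have htrunc : ∀ (N : ℕ) (q : ℝ), q ≤ 1 → 0 ≤ -Real.log (max q (Real.exp (-N))) ∧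
      -Real.log (max q (Real.exp (-N))) ≤ N := by
    intro N q hq
    have hpos : 0 < max q (Real.exp (-N)) := lt_of_lt_of_le (Real.exp_pos _) (le_max_right _ _)
    constructor
    · refine neg_nonneg.2 (Real.log_nonpos hpos.le (max_le hq ?_))
      rw [Real.exp_le_one_iff, neg_nonpos]
      positivity
    · have := Real.log_le_log (Real.exp_pos _) (le_max_right q (Real.exp (-N)))
      rw [Real.log_exp] at this
      linarith
  have hlim : Tendsto (fun N => ∫ x in Set.Ioi 0, χ N x) atTop (𝓝 (lambdaCrit σ)) := by
    refine tendsto_integral_filter_of_dominated_convergence (gFun σ)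
      (Eventually.of_forall fun N => Measurable.aestronglyMeasurable ?_)
      (Eventually.of_forall fun N => ?_) (integrableOn_gFun hσ) ?_
    · exact (Real.measurable_log.comp ((measurable_poisTail σ).max measurable_const)).neg.indicator
        measurableSet_Ioo
    · filter_upwards [ae_restrict_mem measurableSet_Ioi] with x hx
      rw [Set.mem_Ioi] at hx
      rw [hχ]
      simp only
      by_cases h : x ∈ Set.Ioo 0 (N : ℝ)
      · rw [Set.indicator_of_mem h, Real.norm_of_nonneg (htrunc N _ (poisTail_le_one hx.le)).1,
          gFun_eq hx.le, neg_le_neg_iff]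
        exact Real.log_le_log (poisTail_pos hσ hx) (le_max_left _ _)
      · rw [Set.indicator_of_notMem h, norm_zero]
        exact gFun_nonneg hσ hx
    · filter_upwards [ae_restrict_mem measurableSet_Ioi] with x hx
      rw [Set.mem_Ioi] at hx
      have hexp : ∀ᶠ N : ℕ in atTop, Real.exp (-(N : ℝ)) < poisTail σ x :=
        (Real.tendsto_exp_neg_atTop_nhds_zero.comp tendsto_natCast_atTop_atTop).eventually
          (gt_mem_nhds (poisTail_pos hσ hx))
      refine tendsto_const_nhds.congr' ?_
      filter_upwards [hexp, tendsto_natCast_atTop_atTop.eventually_gt_atTop x] with N h₁ h₂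
      rw [hχ]
      simp only
      rw [Set.indicator_of_mem (Set.mem_Ioo.2 ⟨hx, h₂⟩), max_eq_left h₁.le, gFun_eq hx.le]
  obtain ⟨M, hM, hM₁⟩ := ((hlim.eventually (lt_mem_nhds
    (show lambdaCrit σ - ε / 2 < lambdaCrit σ by linarith))).and (eventually_ge_atTop 1)).exists
  refine ⟨M, hM₁, ?_⟩
  have hp₁ : ∀ᶠ p : ℝ in 𝓝[>] 0, p < 1 := nhdsWithin_le_nhds (Iio_mem_nhds one_pos)
  have hlim₂ : Tendsto (fun p : ℝ => ∫ x in Set.Ioo 0 (M : ℝ),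
      -Real.log (max (binTail p ⌊x / p⌋₊ σ) (Real.exp (-M)))) (𝓝[>] 0)
      (𝓝 (∫ x in Set.Ioo 0 (M : ℝ), -Real.log (max (poisTail σ x) (Real.exp (-M))))) := by
    refine tendsto_integral_filter_of_dominated_convergence (fun _ => (M : ℝ))
      (Eventually.of_forall fun p => (measurable_comp_floor_div
        (fun k => -Real.log (max (binTail p k σ) (Real.exp (-M)))) p).aestronglyMeasurable) ?_
      (integrableOn_const (by simp)) ?_
    · filter_upwards [self_mem_nhdsWithin, hp₁] with p h₀ h₁
      refine Eventually.of_forall fun x => ?_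
      have := htrunc M _ (binTail_le_one (le_of_lt h₀) h₁.le ⌊x / p⌋₊ σ)
      rw [Real.norm_of_nonneg this.1]
      exact this.2
    · filter_upwards [ae_restrict_mem measurableSet_Ioo] with x hx
      exact (((tendsto_binTail_floor hx.1 σ).max tendsto_const_nhds).log
        (lt_of_lt_of_le (Real.exp_pos _) (le_max_right _ _)).ne').neg
  have hχM : ∫ x in Set.Ioi 0, χ M x =
      ∫ x in Set.Ioo 0 (M : ℝ), -Real.log (max (poisTail σ x) (Real.exp (-M))) := by
    rw [hχ]
    simp only
    rw [setIntegral_indicator measurableSet_Ioo,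
      Set.inter_eq_self_of_subset_right Set.Ioo_subset_Ioi_self]
  rw [hχM] at hM
  filter_upwards [self_mem_nhdsWithin, hp₁, hlim₂.eventually (lt_mem_nhds
    (show lambdaCrit σ - ε < _ from lt_of_le_of_lt (by linarith) hM))] with p h₀ h₁ h₂
  rw [Set.mem_Ioi] at h₀
  refine h₂.le.trans ?_
  have hsum := setIntegral_floor_div h₀ (fun k => -Real.log (max (binTail p k σ) (Real.exp (-M))))
    (Nat.zero_le ⌈(M : ℝ) / p⌉₊)
  rw [Finset.range_eq_Ico, ← hsum.2]
  refine setIntegral_mono_set hsum.1 (Eventually.of_forall fun x =>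
    (htrunc M _ (binTail_le_one h₀.le h₁.le ⌊x / p⌋₊ σ)).1) ?_
  refine LE.le.eventuallyLE fun x hx => ?_
  rw [Nat.cast_zero, zero_mul]
  refine ⟨hx.1.le, hx.2.trans_le ?_⟩
  rw [← div_le_iff₀ h₀]
  exact Nat.le_ceil _

end Riemann

/-! ### Exponential rates of the spanning probabilities -/

section Rates

variable {σ : ℕ}

theorem eventually_mul_pow_le_exp (C : ℝ) (d : ℕ) {b : ℝ} (hb : 0 < b) :
    ∀ᶠ y : ℝ in atTop, C * y ^ d ≤ Real.exp (b * y) := by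
  have h := (isLittleO_pow_exp_pos_mul_atTop d hb).const_mul_left C
  filter_upwards [h.bound one_pos] with y hy
  rw [one_mul, Real.norm_eq_abs, Real.norm_of_nonneg (Real.exp_pos _).le] at hy
  exact (le_abs_self _).trans hy

/-- An interval is internally spanned with probability at least `exp (-(lambdaCrit σ + ε) / p)`,
whatever its length. -/
theorem eventually_exp_le_ringProb_spanned (hσ : 1 ≤ σ) {ε : ℝ} (hε : 0 < ε) :
    ∀ᶠ q : ℝ in 𝓝[>] 0, ∀ p : unitInterval, (p : ℝ) = q → ∀ (n : ℕ) [NeZero n] (m : ℕ),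
      σ ≤ m → m ≤ n → ∀ a : ℤ,
        Real.exp (-(lambdaCrit σ + ε) / q) ≤ ringProb n p {H | Spanned σ H a (a + m)} := by
  have hσ' : (0 : ℝ) < σ := by exact_mod_cast hσ
  have hlog : Tendsto (fun q : ℝ => ((σ - 1 : ℕ) : ℝ) * (Real.log q * q)) (𝓝[>] 0) (𝓝 0) := by
    simpa only [Real.rpow_one, mul_zero] using
      (tendsto_log_mul_rpow_nhdsGT_zero one_pos).const_mul ((σ - 1 : ℕ) : ℝ)
  filter_upwards [self_mem_nhdsWithin, eventually_sum_neg_log_binTail_le hσ (half_pos hε),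
    hlog.eventually (lt_mem_nhds (show -(ε / 2) < 0 by linarith))] with q hq hsum hq' p hp n _ m
    hm hmn a
  rw [Set.mem_Ioi] at hq
  have hq₁ : q ≤ 1 := hp ▸ p.2.2
  refine le_trans ?_ (le_ringProb_spanned hσ hm hmn a)
  rw [hp]
  have hpos : ∀ k ∈ Finset.Ico σ m, 0 < binTail q k σ := by
    intro k hk
    refine lt_of_lt_of_le (pow_pos ?_ σ) (pow_le_binTail hq.le hq₁ hσ (Finset.mem_Ico.1 hk).1)
    rw [sub_pos, Real.exp_lt_one_iff, neg_div, neg_lt_zero]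
    positivity
  have hprod : ∏ k ∈ Finset.Ico σ m, binTail q k σ =
      Real.exp (-∑ k ∈ Finset.Ico σ m, -Real.log (binTail q k σ)) := by
    rw [Finset.sum_neg_distrib, neg_neg, Real.exp_sum]
    exact Finset.prod_congr rfl fun k hk => (Real.exp_log (hpos k hk)).symm
  have hpow : q ^ (σ - 1) = Real.exp ((σ - 1 : ℕ) * Real.log q) := by
    rw [Real.exp_nat_mul, Real.exp_log hq]
  rw [hprod, hpow, ← Real.exp_add, Real.exp_le_exp, div_le_iff₀ hq]
  have := hsum m hm
  nlinarith

/-- For a suitable `M`, the intervals of length between `M / p` and about `2 * M / p` are internally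
spanned with probability at most `exp (-(lambdaCrit σ - ε) / p)`. -/
theorem exists_ringProb_spanned_le_exp (hσ : 1 ≤ σ) {ε : ℝ} (hε : 0 < ε) :
    ∃ M : ℕ, 1 ≤ M ∧ ∀ᶠ q : ℝ in 𝓝[>] 0, ∀ p : unitInterval, (p : ℝ) = q → ∀ (n : ℕ) [NeZero n],
      2 * ⌈(M : ℝ) / q⌉₊ ≤ n → ∀ ℓ, ⌈(M : ℝ) / q⌉₊ ≤ ℓ → ℓ ≤ 2 * ⌈(M : ℝ) / q⌉₊ → ∀ a : ℤ,
        ringProb n p {H | Spanned σ H a (a + ℓ)} ≤ Real.exp (-(lambdaCrit σ - ε) / q) := by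
  obtain ⟨M, hM₁, hM⟩ := exists_le_sum_neg_log_max hσ (half_pos hε)
  refine ⟨M, hM₁, ?_⟩
  have hM₁' : (1 : ℝ) ≤ M := by exact_mod_cast hM₁
  have hM₀ : (0 : ℝ) < M := by linarith
  set θ := Real.exp (-(M : ℝ)) with hθ
  have hθ₀ : 0 < θ := Real.exp_pos _
  have hθ₁ : θ ≤ 1 := by rw [hθ, Real.exp_le_one_iff]; linarith
  -- The factor `v ^ (2 * ℓ)` costs at most `ε / (2 * p)` in the exponent.
  set η := ε / (16 * M) with hη
  have hη₀ : 0 < η := by positivity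
  set v := Real.exp η with hv
  have hv₁ : 1 ≤ v := Real.one_le_exp hη₀.le
  set r := min 1 (θ ^ 8 * (Real.exp (η / 2) - 1)) with hr
  have hr₀ : 0 < r := by
    refine lt_min one_pos (mul_pos (by positivity) ?_)
    have := Real.add_one_lt_exp (show η / 2 ≠ 0 by positivity)
    linarith
  have hr₁ : r ≤ 1 := min_le_left _ _
  have hrv : (1 + r / θ ^ 8) ^ 2 ≤ v := by
    have h : 1 + r / θ ^ 8 ≤ Real.exp (η / 2) := by
      have : r / θ ^ 8 ≤ Real.exp (η / 2) - 1 := by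
        rw [div_le_iff₀ (by positivity), mul_comm]
        exact min_le_right _ _
      linarith
    calc (1 + r / θ ^ 8) ^ 2 ≤ Real.exp (η / 2) ^ 2 := pow_le_pow_left₀ (by positivity) h 2
      _ = v := by rw [← Real.exp_nat_mul, hv]; congr 1; push_cast; ring
  set δ := r ^ 2 / 3 with hδ
  have hδ₀ : 0 < δ := by positivity
  have hinv : Tendsto (fun q : ℝ => q⁻¹) (𝓝[>] 0) atTop := tendsto_inv_nhdsGT_zero
  filter_upwards [self_mem_nhdsWithin, hM,
    hinv.eventually (eventually_ge_atTop 1), hinv.eventually (eventually_ge_atTop (1 / δ)),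
    hinv.eventually (eventually_mul_pow_le_exp (2 * (5 * M) ^ 2 * Real.exp (2 * M + η)) 2
      (show 0 < η * δ by positivity)),
    hinv.eventually (eventually_mul_pow_le_exp (2 * (5 * M) ^ 3 * Real.exp (8 * M + 2 * M)) 3
      (show 0 < 2 * M * δ by positivity))]
    with q hq hsum hq₁ hq₂ hq₃ hq₄ p hp n _ hn ℓ hℓ hℓ' a
  rw [Set.mem_Ioi] at hq
  set y := q⁻¹ with hy
  have hy₀ : 0 < y := inv_pos.2 hq
  have hqy : q * y = 1 := mul_inv_cancel₀ hq.ne'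
  set L := ⌈(M : ℝ) / q⌉₊ with hL
  have hL₁ : (M : ℝ) * y ≤ L := Nat.le_ceil _
  have hL₂ : (L : ℝ) < M * y + 1 := Nat.ceil_lt_add_one (by positivity)
  set s := ⌊δ * y⌋₊ with hs
  have hs₁ : (s : ℝ) ≤ δ * y := Nat.floor_le (by positivity)
  have hs₂ : δ * y < s + 1 := Nat.lt_floor_add_one _
  have hδy : 1 ≤ δ * y := by
    rw [div_le_iff₀ hδ₀] at hq₂
    linarith
  have hs₀ : 1 ≤ s := Nat.le_floor (by exact_mod_cast hδy)
  have hMy : 1 ≤ M * y := by nlinarith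
  have hsL : s ≤ L := by
    have hδ₁ : δ ≤ 1 := by
      rw [hδ]
      nlinarith
    have : (s : ℝ) ≤ L := by nlinarith
    exact_mod_cast this
  have hL5 : ((2 * L : ℕ) : ℝ) + 1 ≤ 5 * M * y := by
    push_cast
    linarith
  have hvs : v ^ s = Real.exp (η * s) := by
    rw [hv, ← Real.exp_nat_mul]; congr 1; ring
  have hmain := ringProb_spanned_le (n := n) (p := p) hσ hs₀ hn hθ₀ hθ₁ hv₁ hr₀.le hr₁ (by
      rw [hp]
      calc 3 * (s : ℝ) * q ≤ 3 * (δ * y) * q := by gcongr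
        _ = r ^ 2 * (q * y) := by rw [hδ]; ring
        _ ≤ r ^ 2 := by rw [hqy, mul_one]) hrv (by
      have e : θ ^ 2 * v ^ s = Real.exp (η * (s + 1)) / Real.exp (2 * M + η) := by
        rw [hvs, hθ, ← Real.exp_nat_mul, ← Real.exp_add, ← Real.exp_sub]
        congr 1
        push_cast
        ring
      rw [e, le_div_iff₀ (Real.exp_pos _)]
      calc 2 * (((2 * L : ℕ) : ℝ) + 1) ^ 2 * Real.exp (2 * M + η)
          ≤ 2 * (5 * M * y) ^ 2 * Real.exp (2 * M + η) := by gcongr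
        _ = 2 * (5 * M) ^ 2 * Real.exp (2 * M + η) * y ^ 2 := by ring
        _ ≤ Real.exp (η * δ * y) := hq₃
        _ ≤ Real.exp (η * (s + 1)) := by
          rw [Real.exp_le_exp, mul_assoc]
          exact mul_le_mul_of_nonneg_left hs₂.le hη₀.le) (by
      have e₁ : θ ^ (2 * s) = Real.exp (2 * M) / Real.exp (2 * M * (s + 1)) := by
        rw [hθ, ← Real.exp_nat_mul, ← Real.exp_sub]
        congr 1
        push_cast
        ring
      have e₂ : θ ^ 8 = (Real.exp (8 * M))⁻¹ := by
        rw [hθ, ← Real.exp_nat_mul, ← Real.exp_neg]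
        congr 1
        push_cast
        ring
      rw [e₁, e₂, mul_div_assoc', div_le_iff₀ (Real.exp_pos _), inv_mul_eq_div,
        le_div_iff₀ (Real.exp_pos _)]
      calc 2 * (((2 * L : ℕ) : ℝ) + 1) ^ 3 * Real.exp (2 * M) * Real.exp (8 * M)
          ≤ 2 * (5 * M * y) ^ 3 * Real.exp (2 * M) * Real.exp (8 * M) := by gcongr
        _ = 2 * (5 * M) ^ 3 * Real.exp (8 * M + 2 * M) * y ^ 3 := by rw [Real.exp_add]; ring
        _ ≤ Real.exp (2 * M * δ * y) := hq₄
        _ ≤ Real.exp (2 * M * (s + 1)) := by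
          rw [Real.exp_le_exp, mul_assoc (2 * (M : ℝ))]
          exact mul_le_mul_of_nonneg_left hs₂.le (by positivity)) rfl ℓ (hsL.trans hℓ) hℓ' a
  refine hmain.trans ?_
  rw [hp]
  have hq1 : q ≤ 1 := hp ▸ p.2.2
  have hφ₀ : ∀ k, 0 < max (binTail q k σ) θ := fun k => lt_of_lt_of_le hθ₀ (le_max_right _ _)
  have hφ₁ : ∀ k, max (binTail q k σ) θ ≤ 1 := fun k =>
    max_le (binTail_le_one hq.le hq1 k σ) hθ₁
  have hK : θ ^ s / (2 * (((2 * L : ℕ) : ℝ) + 1) ^ 3) ≤ 1 := by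
    rw [div_le_one (by positivity)]
    have h₁ : θ ^ s ≤ 1 := pow_le_one₀ hθ₀.le hθ₁
    have h₂ : (1 : ℝ) ≤ (((2 * L : ℕ) : ℝ) + 1) ^ 3 := one_le_pow₀ (by
      have : (0 : ℝ) ≤ ((2 * L : ℕ) : ℝ) := Nat.cast_nonneg _
      linarith)
    linarith
  have hprod : ∏ k ∈ Finset.range ℓ, max (binTail q k σ) θ ≤
      Real.exp (-(lambdaCrit σ - ε / 2) / q) := by
    calc ∏ k ∈ Finset.range ℓ, max (binTail q k σ) θ
        ≤ ∏ k ∈ Finset.range L, max (binTail q k σ) θ := by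
          obtain ⟨d, rfl⟩ := Nat.exists_eq_add_of_le hℓ
          rw [Finset.prod_range_add]
          exact mul_le_of_le_one_right (Finset.prod_nonneg fun k _ => (hφ₀ k).le)
            (Finset.prod_le_one (fun k _ => (hφ₀ _).le) fun k _ => hφ₁ _)
      _ = Real.exp (-∑ k ∈ Finset.range L, -Real.log (max (binTail q k σ) θ)) := by
          rw [Finset.sum_neg_distrib, neg_neg, Real.exp_sum]
          exact Finset.prod_congr rfl fun k _ => (Real.exp_log (hφ₀ k)).symm
      _ ≤ _ := by
          rw [Real.exp_le_exp, neg_div, neg_le_neg_iff, div_le_iff₀ hq]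
          linarith
  have hvℓ : (v ^ 2) ^ ℓ ≤ Real.exp (ε / 2 / q) := by
    rw [hv, ← Real.exp_nat_mul, ← Real.exp_nat_mul, Real.exp_le_exp, div_eq_mul_inv _ q, ← hy]
    have h₁ : (ℓ : ℝ) ≤ 2 * L := by exact_mod_cast hℓ'
    have h₂ : (ℓ : ℝ) ≤ 4 * M * y := by linarith
    have h₃ : η * M = ε / 16 := by rw [hη]; field_simp
    calc (ℓ : ℝ) * ((2 : ℕ) * η) ≤ 4 * M * y * ((2 : ℕ) * η) := by gcongr
      _ = 8 * (η * M) * y := by push_cast; ring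
      _ = ε / 2 * y := by rw [h₃]; ring
  rw [Finset.prod_mul_distrib, Finset.prod_const, Finset.card_range]
  have hprod₀ : 0 ≤ ∏ k ∈ Finset.range ℓ, max (binTail q k σ) θ :=
    Finset.prod_nonneg fun k _ => (hφ₀ k).le
  calc θ ^ s / (2 * (((2 * L : ℕ) : ℝ) + 1) ^ 3) *
        ((∏ k ∈ Finset.range ℓ, max (binTail q k σ) θ) * (v ^ 2) ^ ℓ)
      ≤ 1 * (Real.exp (-(lambdaCrit σ - ε / 2) / q) * Real.exp (ε / 2 / q)) := by
        refine mul_le_mul hK ?_ (mul_nonneg hprod₀ (by positivity)) zero_le_one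
        exact mul_le_mul hprod hvℓ (by positivity) (Real.exp_pos _).le
    _ = Real.exp (-(lambdaCrit σ - ε) / q) := by
        rw [one_mul, ← Real.exp_add]
        congr 1
        ring

end Rates

/-! ### Union bounds over the ring -/

section UnionBounds

variable {n : ℕ} [NeZero n] {p : unitInterval} {σ : ℕ}

theorem ringProb_exists_spanned_le {N L : ℕ} {B : ℝ}
    (hB : ∀ ℓ, L ≤ ℓ → ℓ ≤ 2 * L → ∀ a : ℤ, ringProb n p {H | Spanned σ H a (a + ℓ)} ≤ B) :
    ringProb n p {H | ∃ a b : ℤ, Spanned σ H a b ∧ 0 ≤ a ∧ a < N ∧ L ≤ b - a ∧ b - a ≤ 2 * L} ≤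
      N * (L + 1) * B := by
  have hsub : {H | ∃ a b : ℤ, Spanned σ H a b ∧ 0 ≤ a ∧ a < N ∧ L ≤ b - a ∧ b - a ≤ 2 * L} ⊆
      ⋃ z ∈ Finset.range N ×ˢ Finset.Icc L (2 * L),
        {H | Spanned σ H ((z.1 : ℕ) : ℤ) (((z.1 : ℕ) : ℤ) + (z.2 : ℕ))} := by
    rintro H ⟨a, b, h, h₁, h₂, h₃, h₄⟩
    refine Set.mem_iUnion₂.2 ⟨(a.toNat, (b - a).toNat), ?_, ?_⟩
    · simp only [Finset.mem_product, Finset.mem_range, Finset.mem_Icc]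
      omega
    · have e₁ : ((a.toNat : ℕ) : ℤ) = a := by omega
      have e₂ : (((b - a).toNat : ℕ) : ℤ) = b - a := by omega
      simp only [Set.mem_ofPred_eq]
      rw [e₁, e₂, add_sub_cancel]
      exact h
  refine (ringProb_mono hsub).trans ((ringProb_biUnion_le _ _).trans ?_)
  calc _ ≤ ∑ _z ∈ Finset.range N ×ˢ Finset.Icc L (2 * L), B :=
        Finset.sum_le_sum fun z hz => by
          simp only [Finset.mem_product, Finset.mem_Icc] at hz
          exact hB z.2 hz.2.1 hz.2.2 z.1
    _ = N * (L + 1) * B := by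
        rw [Finset.sum_const, Finset.card_product, Finset.card_range, Nat.card_Icc, nsmul_eq_mul,
          show 2 * L + 1 - L = L + 1 by omega]
        push_cast
        ring

theorem ringProb_exists_degIn_lt_le {m : ℕ} (hσ : 1 ≤ σ) (hσm : σ ≤ m) (hmn : m < n) :
    ringProb n p {H | ∃ x : ℤ, 0 ≤ x ∧ x < n ∧ (degIn H x (Finset.Ico (x - m) x) < σ ∨
      degIn H x (Finset.Ico (x + 1) (x + 1 + m)) < σ)} ≤
      2 * n * σ * Real.exp (-((p : ℝ) * (m + 1)) / (2 * σ)) := by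
  set u := Real.exp (-((p : ℝ) * (m + 1)) / (2 * σ)) with hu
  have hσ' : (0 : ℝ) < σ := by exact_mod_cast hσ
  have hu₁ : u ≤ 1 := by
    rw [hu, Real.exp_le_one_iff, neg_div, neg_nonpos]
    have := p.2.1
    positivity
  have htail : 1 - binTail p m σ ≤ σ * u := by
    have h₁ := pow_le_binTail (p := p) p.2.1 p.2.2 hσ hσm
    have h₂ := one_add_mul_le_pow (a := -u) (by linarith) σ
    rw [← hu, sub_eq_add_neg] at h₁
    linarith
  have hone : ∀ (x c : ℤ), x ∉ Finset.Ico c (c + m) → x ∈ Set.Ico (min x c) (min x c + n) →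
      c + m ≤ min x c + n →
      ringProb n p {H | degIn H x (Finset.Ico c (c + m)) < σ} ≤ σ * u := by
    intro x c hx hxw hc
    have heq : {H : SimpleGraph ℤ | degIn H x (Finset.Ico c (c + m)) < σ} =
        {H | σ ≤ degIn H x (Finset.Ico c (c + m))}ᶜ := by
      ext H
      simp
    rw [heq, ringProb_compl, ringProb_degIn (min x c) σ hxw _ (fun y hy => ?_) hx, Int.card_Ico,
      add_sub_cancel_left, Int.toNat_natCast]
    · exact htail
    · rw [Finset.mem_Ico] at hy
      exact ⟨by omega, by omega⟩
  have hsub : {H : SimpleGraph ℤ | ∃ x : ℤ, 0 ≤ x ∧ x < n ∧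
      (degIn H x (Finset.Ico (x - m) x) < σ ∨
      degIn H x (Finset.Ico (x + 1) (x + 1 + m)) < σ)} ⊆
      ⋃ i ∈ Finset.range n,
        ({H | degIn H ((i : ℕ) : ℤ) (Finset.Ico ((i : ℤ) - m) (i - m + m)) < σ} ∪
        {H | degIn H ((i : ℕ) : ℤ) (Finset.Ico ((i : ℤ) + 1) (i + 1 + m)) < σ}) := by
    rintro H ⟨x, h₀, h₁, h₂⟩
    obtain ⟨i, rfl⟩ := Int.eq_ofNat_of_zero_le h₀
    refine Set.mem_iUnion₂.2 ⟨i, Finset.mem_range.2 (by omega), ?_⟩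
    rw [sub_add_cancel]
    exact h₂
  refine (ringProb_mono hsub).trans ((ringProb_biUnion_le _ _).trans ?_)
  calc _ ≤ ∑ _i ∈ Finset.range n, (σ * u + σ * u) :=
        Finset.sum_le_sum fun i _ => (ringProb_union_le _ _).trans (add_le_add
          (hone _ _ (by simp) ⟨by omega, by omega⟩ (by omega))
          (hone _ _ (by simp) ⟨by omega, by omega⟩ (by omega)))
    _ = 2 * n * σ * u := by
        rw [Finset.sum_const, Finset.card_range, nsmul_eq_mul]
        ring

theorem ringProb_exists_no_spanned_le {m N : ℕ} (hmN : N * m ≤ n) {ρ : ℝ}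
    (hρ : ∀ c : ℤ, ρ ≤ ringProb n p {H | Spanned σ H c (c + m)}) :
    ringProb n p {H | ∃ a : ℤ, 0 ≤ a ∧ a < n ∧
      ¬ ∃ c, a ≤ c ∧ c + m ≤ a + N * m ∧ Spanned σ H c (c + m)} ≤ n * Real.exp (-(ρ * N)) := by
  have hρ₁ : ρ ≤ 1 := (hρ 0).trans (ringProb_le_one _)
  have hsub : {H | ∃ a : ℤ, 0 ≤ a ∧ a < n ∧
      ¬ ∃ c, a ≤ c ∧ c + m ≤ a + N * m ∧ Spanned σ H c (c + m)} ⊆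
      ⋃ i ∈ Finset.range n, {H | ¬ ∃ c, ((i : ℕ) : ℤ) ≤ c ∧ c + m ≤ (i : ℤ) + N * m ∧
        Spanned σ H c (c + m)} := by
    rintro H ⟨a, h₀, h₁, h₂⟩
    obtain ⟨i, rfl⟩ := Int.eq_ofNat_of_zero_le h₀
    exact Set.mem_iUnion₂.2 ⟨i, Finset.mem_range.2 (by omega), h₂⟩
  have hexp : (1 - ρ) ^ N ≤ Real.exp (-(ρ * N)) := by
    calc (1 - ρ) ^ N ≤ Real.exp (-ρ) ^ N :=
          pow_le_pow_left₀ (by linarith) (by have := Real.add_one_le_exp (-ρ); linarith) _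
      _ = _ := by rw [← Real.exp_nat_mul]; congr 1; ring
  refine (ringProb_mono hsub).trans ((ringProb_biUnion_le _ _).trans ?_)
  calc _ ≤ ∑ _i ∈ Finset.range n, Real.exp (-(ρ * N)) :=
        Finset.sum_le_sum fun i _ => (ringProb_no_spanned_le hmN hρ i).trans hexp
    _ = _ := by rw [Finset.sum_const, Finset.card_range, nsmul_eq_mul]

end UnionBounds

/-! ### Bounds for the stopping time on a fixed ring -/

section FixedRing

variable {n : ℕ} [NeZero n] {p : unitInterval} {σ : ℕ}

/-- Integers are translated into `[0, n)` by multiples of `n`. -/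
theorem exists_add_mul_mem_Ico (a : ℤ) : ∃ k : ℤ, 0 ≤ a + k * n ∧ a + k * n < n := by
  have h : (0 : ℤ) < n := by exact_mod_cast NeZero.pos n
  refine ⟨-(a / n), ?_⟩
  have e : a + -(a / n) * n = a % n := by rw [Int.emod_def]; ring
  rw [e]
  exact ⟨Int.emod_nonneg a h.ne', Int.emod_lt_of_pos a h⟩

theorem real_lt_ringStopTime_le {L : ℕ} (hL : 2 ≤ L) (hLn : L ≤ n) {B : ℝ}
    (hB : ∀ ℓ, L ≤ ℓ → ℓ ≤ 2 * L → ∀ a : ℤ, ringProb n p {H | Spanned σ H a (a + ℓ)} ≤ B) :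
    (SimpleGraph.binomialRandom (Fin n) p).real {G | L < ringStopTime σ n G} ≤
      n * (L + 1) * B := by
  refine le_trans (measureReal_mono fun G hG => ?_) (ringProb_exists_spanned_le (N := n) hB)
  simp only [Set.mem_ofPred_eq] at hG ⊢
  by_contra hno
  refine absurd (ringStopTime_le hL hLn fun a b h hab => ?_) (not_le.2 hG)
  by_contra hlt
  obtain ⟨k, hk₁, hk₂⟩ := exists_add_mul_mem_Ico (n := n) a
  exact hno ⟨_, _, h.unroll_shift k, hk₁, hk₂, by omega, by omega⟩

theorem real_ringClusters_ne_top_le {m N : ℕ} (hσ : 1 ≤ σ) (hσm : σ ≤ m) (hN : 2 ≤ N)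
    (hNm : N * m ≤ n) {ρ : ℝ}
    (hρ : ∀ c : ℤ, ρ ≤ ringProb n p {H | Spanned σ H c (c + m)}) :
    (SimpleGraph.binomialRandom (Fin n) p).real
        {G | jigsaw (SimpleGraph.cycleGraph n) G σ 1 ⊤ ⊥ (m + N * m) ≠ ⊤} ≤
      2 * n * σ * Real.exp (-((p : ℝ) * (m + 1)) / (2 * σ)) + n * Real.exp (-(ρ * N)) := by
  have hmN : 2 * m ≤ N * m := Nat.mul_le_mul_right m hN
  have hmn : m < n := by omega
  refine le_trans (measureReal_mono fun G hG => ?_) ((ringProb_union_le _ _).trans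
    (add_le_add (ringProb_exists_degIn_lt_le hσ hσm hmn) (ringProb_exists_no_spanned_le hNm hρ)))
  simp only [Set.mem_ofPred_eq, Set.mem_union] at hG ⊢
  by_contra! hno
  obtain ⟨hdeg, hnuc⟩ := hno
  have hdeg' : ∀ x : ℤ, σ ≤ degIn (unroll G) x (Finset.Ico (x - m) x) ∧
      σ ≤ degIn (unroll G) x (Finset.Ico (x + 1) (x + 1 + m)) := by
    intro x
    obtain ⟨k, hk₁, hk₂⟩ := exists_add_mul_mem_Ico (n := n) x
    obtain ⟨h₁, h₂⟩ := hdeg _ hk₁ hk₂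
    have h₁' := h₁.trans (degIn_le_degIn_unroll_shift _ _ _ (-k))
    have h₂' := h₂.trans (degIn_le_degIn_unroll_shift _ _ _ (-k))
    rw [show x + k * n + -k * n = x by ring, show x + k * n - m + -k * n = x - m by ring] at h₁'
    rw [show x + k * n + -k * n = x by ring, show x + k * n + 1 + -k * n = x + 1 by ring,
      show x + k * n + 1 + m + -k * n = x + 1 + m by ring] at h₂'
    exact ⟨h₁', h₂'⟩
  refine hG (ringClusters_eq_top (by omega) hmn.le (by omega) (by omega) (fun x => (hdeg' x).1)
    (fun x => (hdeg' x).2) fun a => ?_)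
  obtain ⟨k, hk₁, hk₂⟩ := exists_add_mul_mem_Ico (n := n) a
  obtain ⟨c, h₁, h₂, h₃⟩ := hnuc _ hk₁ hk₂
  have := h₃.unroll_shift (-k)
  refine ⟨c + -k * n, by linarith, by push_cast; linarith, ?_⟩
  rwa [add_right_comm] at this

theorem real_mul_ringStopTime_lt_le {L N : ℕ} (hL : 2 ≤ L) (hLn : 2 * L ≤ n) {B : ℝ}
    (hB : ∀ ℓ, L ≤ ℓ → ℓ ≤ 2 * L → ∀ a : ℤ, ringProb n p {H | Spanned σ H a (a + ℓ)} ≤ B) (t : ℕ) :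
    (SimpleGraph.binomialRandom (Fin n) p).real {G | 4 * L * ringStopTime σ n G < N} ≤
      N * (L + 1) * B + (SimpleGraph.binomialRandom (Fin n) p).real
        {G | jigsaw (SimpleGraph.cycleGraph n) G σ 1 ⊤ ⊥ t ≠ ⊤} := by
  refine le_trans (measureReal_mono (s₂ := {G | unroll G ∈ {H | ∃ a b : ℤ, Spanned σ H a b ∧
    0 ≤ a ∧ a < N ∧ L ≤ b - a ∧ b - a ≤ 2 * L}} ∪
      {G | jigsaw (SimpleGraph.cycleGraph n) G σ 1 ⊤ ⊥ t ≠ ⊤}) fun G hG => ?_)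
    ((measureReal_union_le _ _).trans (add_le_add (ringProb_exists_spanned_le hB) le_rfl))
  simp only [Set.mem_ofPred_eq, Set.mem_union] at hG ⊢
  by_contra! hno
  obtain ⟨hno, htop⟩ := hno
  refine absurd (le_ringStopTime hL hLn (fun a b h h₀ h₁ hab => ?_) htop) (not_le.2 hG)
  by_contra! hlt
  exact absurd hab (not_le.2 (hno a b h h₀ h₁ hlt))

end FixedRing

/-! ### Asymptotics along `p ∼ lam / log n` -/

section Asymptotics

variable {lam : ℝ} {p : ℕ → unitInterval} {σ : ℕ}

theorem tendsto_log_natCast_atTop : Tendsto (fun n : ℕ => Real.log n) atTop atTop :=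
  Real.tendsto_log_atTop.comp tendsto_natCast_atTop_atTop

theorem tendsto_mul_log (hp : (fun n => (p n : ℝ)) ~[atTop] (fun n => lam / Real.log n)) :
    Tendsto (fun n : ℕ => (p n : ℝ) * Real.log n) atTop (𝓝 lam) := by
  have h := hp.mul (IsEquivalent.refl (u := fun n : ℕ => Real.log n))
  refine h.symm.tendsto_nhds (tendsto_const_nhds.congr' ?_)
  filter_upwards [tendsto_log_natCast_atTop.eventually_gt_atTop 0] with n hn
  simp only [Pi.mul_apply]
  rw [div_mul_cancel₀ _ hn.ne']

theorem tendsto_nhdsGT_zero (hlam : 0 < lam)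
    (hp : (fun n => (p n : ℝ)) ~[atTop] (fun n => lam / Real.log n)) :
    Tendsto (fun n => (p n : ℝ)) atTop (𝓝[>] 0) := by
  refine tendsto_nhdsWithin_iff.2 ⟨hp.symm.tendsto_nhds
    (tendsto_const_nhds.div_atTop tendsto_log_natCast_atTop), ?_⟩
  filter_upwards [tendsto_log_natCast_atTop.eventually_gt_atTop 0,
    (tendsto_mul_log hp).eventually (lt_mem_nhds hlam)] with n h₁ h₂
  exact pos_of_mul_pos_left h₂ h₁.le

theorem tendsto_div_div_log (hlam : 0 < lam)
    (hp : (fun n => (p n : ℝ)) ~[atTop] (fun n => lam / Real.log n)) (κ : ℝ) :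
    Tendsto (fun n : ℕ => κ / p n / Real.log n) atTop (𝓝 (κ / lam)) := by
  simp only [div_div]
  exact tendsto_const_nhds.div (tendsto_mul_log hp) hlam.ne'

theorem eventually_mul_log_le_div (hlam : 0 < lam)
    (hp : (fun n => (p n : ℝ)) ~[atTop] (fun n => lam / Real.log n)) {κ c : ℝ} (hc : c < κ / lam) :
    ∀ᶠ n : ℕ in atTop, c * Real.log n ≤ κ / p n := by
  filter_upwards [tendsto_log_natCast_atTop.eventually_gt_atTop 0,
    (tendsto_div_div_log hlam hp κ).eventually (lt_mem_nhds hc)] with n h₁ h₂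
  exact ((lt_div_iff₀ h₁).1 h₂).le

theorem eventually_div_le_mul_log (hlam : 0 < lam)
    (hp : (fun n => (p n : ℝ)) ~[atTop] (fun n => lam / Real.log n)) {κ c : ℝ} (hc : κ / lam < c) :
    ∀ᶠ n : ℕ in atTop, κ / p n ≤ c * Real.log n := by
  filter_upwards [tendsto_log_natCast_atTop.eventually_gt_atTop 0,
    (tendsto_div_div_log hlam hp κ).eventually (gt_mem_nhds hc)] with n h₁ h₂
  exact ((div_lt_iff₀ h₁).1 h₂).le

theorem tendsto_exp_neg_mul_log {c : ℝ} (hc : 0 < c) (C : ℝ) :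
    Tendsto (fun n : ℕ => C * Real.exp (-(c * Real.log n))) atTop (𝓝 0) := by
  simpa using ((Real.tendsto_exp_neg_atTop_nhds_zero.comp
    (tendsto_log_natCast_atTop.const_mul_atTop hc)).const_mul C)

/-- The critical length scale `M / p` is of order `log n`. -/
theorem eventually_ceil_div (hlam : 0 < lam)
    (hp : (fun n => (p n : ℝ)) ~[atTop] (fun n => lam / Real.log n)) {M : ℕ} (hM : 1 ≤ M) :
    ∀ᶠ n : ℕ in atTop, 2 ≤ ⌈(M : ℝ) / p n⌉₊ ∧ 2 * ⌈(M : ℝ) / p n⌉₊ ≤ n ∧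
      (⌈(M : ℝ) / p n⌉₊ : ℝ) ≤ (M / lam + 1) * Real.log n := by
  have hM' : (0 : ℝ) < M := by exact_mod_cast hM
  have hc : 0 < M / lam / 2 := by positivity
  filter_upwards [eventually_mul_log_le_div hlam hp (show M / lam / 2 < M / lam by linarith),
    eventually_div_le_mul_log hlam hp (show (M : ℝ) / lam < M / lam + 1 / 2 by linarith),
    tendsto_log_natCast_atTop.eventually_ge_atTop 2,
    (tendsto_log_natCast_atTop.const_mul_atTop hc).eventually_ge_atTop 2,
    tendsto_log_natCast_atTop.eventually
      (eventually_mul_pow_le_exp (2 * (M / lam + 1)) 1 one_pos), eventually_ge_atTop 1]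
    with n h₁ h₂ h₃ h₄ h₅ hn
  have hup : (⌈(M : ℝ) / p n⌉₊ : ℝ) ≤ (M / lam + 1) * Real.log n := by
    have hnn : (0 : ℝ) ≤ M / p n := div_nonneg hM'.le (p n).2.1
    have := Nat.ceil_lt_add_one hnn
    linarith
  refine ⟨?_, ?_, hup⟩
  · have : ((2 : ℕ) : ℝ) ≤ ⌈(M : ℝ) / p n⌉₊ := by
      push_cast
      exact (h₄.trans h₁).trans (Nat.le_ceil _)
    exact_mod_cast this
  · have hn' : (0 : ℝ) < n := by exact_mod_cast hn
    rw [one_mul, Real.exp_log hn', pow_one] at h₅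
    have : ((2 * ⌈(M : ℝ) / p n⌉₊ : ℕ) : ℝ) ≤ n := by
      push_cast
      linarith
    exact_mod_cast this

/-- The union bound over `n ^ β` starting points and a logarithmic number of lengths beats the
probability `exp (-κ / p) = n ^ (-κ / lam + o(1))` of a single interval. -/
theorem tendsto_union_bound (hlam : 0 < lam)
    (hp : (fun n => (p n : ℝ)) ~[atTop] (fun n => lam / Real.log n)) {M : ℕ} (hM : 1 ≤ M)
    {κ β : ℝ} (hκ : β < κ / lam) {N : ℕ → ℕ}
    (hN : ∀ᶠ n : ℕ in atTop, (N n : ℝ) ≤ 2 * Real.exp (β * Real.log n)) :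
    Tendsto (fun n : ℕ => (N n : ℝ) * (⌈(M : ℝ) / p n⌉₊ + 1) * Real.exp (-κ / p n)) atTop
      (𝓝 0) := by
  set δ := (κ / lam - β) / 2 with hδ
  have hδ₀ : 0 < δ := by rw [hδ]; linarith
  refine squeeze_zero' (Eventually.of_forall fun n => by positivity) ?_
    (tendsto_exp_neg_mul_log (half_pos hδ₀) 1)
  filter_upwards [hN, eventually_ceil_div hlam hp hM,
    eventually_mul_log_le_div hlam hp (show β + δ < κ / lam by rw [hδ]; linarith),
    tendsto_log_natCast_atTop.eventually_ge_atTop 1,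
    tendsto_log_natCast_atTop.eventually
      (eventually_mul_pow_le_exp (2 * (M / lam + 2)) 1 (half_pos hδ₀))] with n h₁ h₂ h₃ h₄ h₅
  set x := Real.log n
  rw [pow_one] at h₅
  have h₆ : (⌈(M : ℝ) / p n⌉₊ : ℝ) + 1 ≤ (M / lam + 2) * x := by linarith [h₂.2.2]
  calc (N n : ℝ) * (⌈(M : ℝ) / p n⌉₊ + 1) * Real.exp (-κ / p n)
      ≤ 2 * Real.exp (β * x) * ((M / lam + 2) * x) * Real.exp (-((β + δ) * x)) := by
        rw [neg_div]
        gcongr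
    _ = (2 * (M / lam + 2) * x) * Real.exp (-(δ * x)) := by
        rw [show -(δ * x) = β * x + -((β + δ) * x) by ring, Real.exp_add]
        ring
    _ ≤ Real.exp (δ / 2 * x) * Real.exp (-(δ * x)) := by gcongr
    _ = 1 * Real.exp (-(δ / 2 * x)) := by
        rw [← Real.exp_add, one_mul]
        congr 1
        ring


/-- If `lam` is subcritical, the dynamics stops after logarithmic time, as there are no internally
spanned intervals of length of order `log n`. -/
theorem exists_tendsto_real_mul_log_lt_ringStopTime (hσ : 1 ≤ σ) (hlam : 0 < lam)
    (hcrit : lam < lambdaCrit σ) :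
    ∃ C : ℝ, ∀ p : ℕ → unitInterval, (fun n => (p n : ℝ)) ~[atTop] (fun n => lam / Real.log n) →
      Tendsto (fun n : ℕ => (SimpleGraph.binomialRandom (Fin n) (p n)).real
        {G | C * Real.log n < ringStopTime σ n G}) atTop (𝓝 0) := by
  set ε := (lambdaCrit σ - lam) / 2 with hε
  have hε₀ : 0 < ε := by rw [hε]; linarith
  obtain ⟨M, hM, hspan⟩ := exists_ringProb_spanned_le_exp hσ hε₀
  refine ⟨M / lam + 1, fun p hp => ?_⟩
  have hκ : 1 < (lambdaCrit σ - ε) / lam := by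
    rw [one_lt_div hlam, hε]
    linarith
  refine squeeze_zero' (Eventually.of_forall fun n => measureReal_nonneg) ?_
    (tendsto_union_bound hlam hp hM hκ (N := fun n => n) ?_)
  · filter_upwards [eventually_ceil_div hlam hp hM,
      (tendsto_nhdsGT_zero hlam hp).eventually hspan] with n ⟨h₁, h₂, h₃⟩ h₄
    have : NeZero n := ⟨by omega⟩
    refine le_trans (measureReal_mono fun G hG => ?_)
      (real_lt_ringStopTime_le h₁ (by omega) (h₄ (p n) rfl n h₂))
    simp only [Set.mem_ofPred_eq] at hG ⊢
    exact_mod_cast h₃.trans_lt hG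
  · filter_upwards [eventually_ge_atTop 1] with n hn
    have hn' : (0 : ℝ) < n := by exact_mod_cast hn
    rw [one_mul, Real.exp_log hn']
    linarith

theorem lambdaCrit_nonneg (hσ : 1 ≤ σ) : 0 ≤ lambdaCrit σ :=
  setIntegral_nonneg measurableSet_Ioi fun _ hx => gFun_nonneg hσ hx

/-- The block size `⌈(log n) ^ 3⌉` and the number of blocks `⌈n ^ α⌉` to be searched for a
nucleus. -/
theorem eventually_blocks {α δ : ℝ} (hα₀ : 0 < α) (hα₁ : α < 1) (hδ : 0 < δ) (k : ℕ) :
    ∀ᶠ n : ℕ in atTop, k ≤ ⌈Real.log n ^ 3⌉₊ ∧ 2 ≤ ⌈Real.exp (α * Real.log n)⌉₊ ∧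
      ⌈Real.exp (α * Real.log n)⌉₊ * ⌈Real.log n ^ 3⌉₊ ≤ n ∧
      ((⌈Real.log n ^ 3⌉₊ + ⌈Real.exp (α * Real.log n)⌉₊ * ⌈Real.log n ^ 3⌉₊ : ℕ) : ℝ) ≤
        Real.exp ((α + δ) * Real.log n) := by
  filter_upwards [tendsto_log_natCast_atTop.eventually_ge_atTop 1,
    tendsto_log_natCast_atTop.eventually_ge_atTop k,
    tendsto_log_natCast_atTop.eventually (eventually_mul_pow_le_exp 4 3 (sub_pos.2 hα₁)),
    tendsto_log_natCast_atTop.eventually (eventually_mul_pow_le_exp 8 3 hδ),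
    eventually_ge_atTop 1] with n h₁ h₂ h₃ h₄ hn
  have hn' : (0 : ℝ) < n := by exact_mod_cast hn
  set x := Real.log n with hx
  set m := ⌈x ^ 3⌉₊ with hm
  set N := ⌈Real.exp (α * x)⌉₊ with hN
  have hx3 : x ≤ x ^ 3 := le_self_pow₀ h₁ (by norm_num)
  have hm₁ : x ^ 3 ≤ m := Nat.le_ceil _
  have hm₂ : (m : ℝ) ≤ 2 * x ^ 3 := by
    have := Nat.ceil_lt_add_one (show 0 ≤ x ^ 3 by positivity)
    linarith
  have hexp : 1 < Real.exp (α * x) := Real.one_lt_exp_iff.2 (by positivity)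
  have hN₁ : 2 ≤ N := Nat.lt_ceil.2 (by exact_mod_cast hexp)
  have hN₂ : (N : ℝ) ≤ 2 * Real.exp (α * x) := by
    have := Nat.ceil_lt_add_one (Real.exp_pos (α * x)).le
    linarith
  have hNm : ((N * m : ℕ) : ℝ) ≤ 4 * x ^ 3 * Real.exp (α * x) := by
    push_cast
    calc (N : ℝ) * m ≤ 2 * Real.exp (α * x) * (2 * x ^ 3) := by gcongr
      _ = _ := by ring
  refine ⟨?_, hN₁, ?_, ?_⟩
  · have : (k : ℝ) ≤ m := by linarith
    exact_mod_cast this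
  · have : ((N * m : ℕ) : ℝ) ≤ n := by
      calc ((N * m : ℕ) : ℝ) ≤ 4 * x ^ 3 * Real.exp (α * x) := hNm
        _ ≤ Real.exp ((1 - α) * x) * Real.exp (α * x) := by gcongr
        _ = n := by
          rw [← Real.exp_add, show (1 - α) * x + α * x = x by ring, hx, Real.exp_log hn']
    exact_mod_cast this
  · have hle : m + N * m ≤ 2 * (N * m) := by nlinarith
    calc ((m + N * m : ℕ) : ℝ) ≤ ((2 * (N * m) : ℕ) : ℝ) := by exact_mod_cast hle
      _ ≤ 2 * (4 * x ^ 3 * Real.exp (α * x)) := by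
        rw [Nat.cast_mul, Nat.cast_two]
        gcongr
      _ = 8 * x ^ 3 * Real.exp (α * x) := by ring
      _ ≤ Real.exp (δ * x) * Real.exp (α * x) := by gcongr
      _ = Real.exp ((α + δ) * x) := by
        rw [← Real.exp_add]
        congr 1
        ring

/-- If `lam` is supercritical, then up to `n ^ (lambdaCrit σ / lam + o(1))` consecutive blocks
of polylogarithmic length contain a nucleus, from which the whole ring is taken over. -/
theorem tendsto_real_ringClusters_ne_top (hσ : 1 ≤ σ) (hlam : 0 < lam)
    (hp : (fun n => (p n : ℝ)) ~[atTop] (fun n => lam / Real.log n)) {α : ℝ}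
    (hα : lambdaCrit σ / lam < α) (hα₁ : α < 1) :
    Tendsto (fun n : ℕ => (SimpleGraph.binomialRandom (Fin n) (p n)).real
      {G | jigsaw (SimpleGraph.cycleGraph n) G σ 1 ⊤ ⊥
        (⌈Real.log n ^ 3⌉₊ + ⌈Real.exp (α * Real.log n)⌉₊ * ⌈Real.log n ^ 3⌉₊) ≠ ⊤})
      atTop (𝓝 0) := by
  have hα₀ : 0 < α := (div_nonneg (lambdaCrit_nonneg hσ) hlam.le).trans_lt hα
  have hσ' : (0 : ℝ) < σ := by exact_mod_cast hσ
  rw [div_lt_iff₀ hlam] at hα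
  set ε := (α * lam - lambdaCrit σ) / 2 with hε
  have hε₀ : 0 < ε := by rw [hε]; linarith
  obtain ⟨c, hc₁, hc₂⟩ := exists_between
    (show (lambdaCrit σ + ε) / lam < α by rw [div_lt_iff₀ hlam, hε]; linarith)
  have hlim : Tendsto (fun n : ℕ => 2 * σ * Real.exp (-(1 * Real.log n)) +
      1 * Real.exp (-(1 * Real.log n))) atTop (𝓝 0) := by
    simpa using (tendsto_exp_neg_mul_log one_pos (2 * σ)).add (tendsto_exp_neg_mul_log one_pos 1)
  refine squeeze_zero' (Eventually.of_forall fun n => measureReal_nonneg) ?_ hlim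
  filter_upwards [eventually_blocks hα₀ hα₁ one_pos σ,
    (tendsto_nhdsGT_zero hlam hp).eventually (eventually_exp_le_ringProb_spanned hσ hε₀),
    (tendsto_mul_log hp).eventually (lt_mem_nhds (half_lt_self hlam)),
    eventually_div_le_mul_log hlam hp hc₁,
    tendsto_log_natCast_atTop.eventually_ge_atTop (8 * σ / lam),
    tendsto_log_natCast_atTop.eventually_ge_atTop 1,
    tendsto_log_natCast_atTop.eventually (eventually_mul_pow_le_exp 2 1 (sub_pos.2 hc₂)),
    eventually_ge_atTop 1] with n ⟨h₁, h₂, h₃, _⟩ h₄ h₅ h₆ h₇ h₈ h₉ hn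
  have : NeZero n := ⟨by omega⟩
  have hn' : (0 : ℝ) < n := by exact_mod_cast hn
  have hmn : ⌈Real.log n ^ 3⌉₊ ≤ n := by nlinarith
  refine (real_ringClusters_ne_top_le hσ h₁ h₂ h₃ (h₄ (p n) rfl n _ h₁ hmn)).trans ?_
  set x := Real.log n with hx
  have hnx : (n : ℝ) = Real.exp x := (Real.exp_log hn').symm
  set m := ⌈x ^ 3⌉₊ with hm
  set N := ⌈Real.exp (α * x)⌉₊ with hN
  have hx₀ : 0 < x := by linarith
  have hp₀ : (0 : ℝ) ≤ p n := (p n).2.1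
  refine add_le_add ?_ ?_
  -- The expected degree `p * m` into a block is of order `(log n) ^ 2`, so that the union bound
  -- over the `n` vertices works.
  · rw [hnx, mul_right_comm 2, mul_assoc (2 * (σ : ℝ)), ← Real.exp_add]
    gcongr
    rw [neg_div, ← sub_eq_add_neg, sub_le_iff_le_add, neg_add_eq_sub, le_sub_iff_add_le,
      le_div_iff₀ (by positivity)]
    rw [div_le_iff₀ hlam] at h₇
    have hm₁ : x ^ 3 ≤ m := Nat.le_ceil _
    calc (x + 1 * x) * (2 * σ) = 8 * σ * x / 2 := by ring
      _ ≤ x * lam * x / 2 := by gcongr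
      _ = lam / 2 * (x * x) := by ring
      _ ≤ p n * x * (x * x) := by gcongr
      _ = p n * x ^ 3 := by ring
      _ ≤ p n * (m + 1) := by gcongr; linarith
  -- The expected number of nuclei in a row of `N` blocks is at least `n ^ (α - c)`.
  · rw [hnx, one_mul, ← Real.exp_add, Real.exp_le_exp]
    have hρ : 2 * x ≤ Real.exp (-(lambdaCrit σ + ε) / p n) * N := by
      calc 2 * x = 2 * x ^ 1 := by ring
        _ ≤ Real.exp ((α - c) * x) := h₉
        _ = Real.exp (-(c * x)) * Real.exp (α * x) := by
          rw [← Real.exp_add]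
          congr 1
          ring
        _ ≤ Real.exp (-(lambdaCrit σ + ε) / p n) * N := by
          rw [neg_div]
          gcongr
          exact Nat.le_ceil _
    linarith

theorem tendsto_real_lt_log_ringStopTime (hσ : 1 ≤ σ) (hlam : 0 < lam)
    (hcrit : lambdaCrit σ < lam)
    (hp : (fun n => (p n : ℝ)) ~[atTop] (fun n => lam / Real.log n)) {γ : ℝ}
    (hγ : lambdaCrit σ / lam < γ) :
    Tendsto (fun n : ℕ => (SimpleGraph.binomialRandom (Fin n) (p n)).real
      {G | γ * Real.log n < Real.log (ringStopTime σ n G)}) atTop (𝓝 0) := by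
  obtain ⟨α, hα₁, hα₂⟩ := exists_between (lt_min hγ ((div_lt_one hlam).2 hcrit))
  obtain ⟨hα₂, hα₃⟩ := lt_min_iff.1 hα₂
  have hα₀ : 0 < α := (div_nonneg (lambdaCrit_nonneg hσ) hlam.le).trans_lt hα₁
  refine squeeze_zero' (Eventually.of_forall fun n => measureReal_nonneg) ?_
    (tendsto_real_ringClusters_ne_top hσ hlam hp hα₁ hα₃)
  filter_upwards [eventually_blocks hα₀ hα₃ (sub_pos.2 hα₂) 1,
    tendsto_log_natCast_atTop.eventually_ge_atTop 0] with n h₁ h₂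
  refine measureReal_mono fun G hG htop => ?_
  rw [Set.mem_ofPred_eq, ← not_le] at hG
  refine hG ?_
  have hT : ringStopTime σ n G ≤ _ := jigsawStopTime_le (le_top.trans htop.ge)
  have hT' := (Nat.cast_le (α := ℝ)).2 hT |>.trans h₁.2.2.2
  rw [add_sub_cancel] at hT'
  rcases Nat.eq_zero_or_pos (ringStopTime σ n G) with h | h
  · rw [h, Nat.cast_zero, Real.log_zero]
    have := hα₀.trans hα₂
    positivity
  · rwa [Real.log_le_iff_le_exp (by exact_mod_cast h)]

theorem tendsto_real_log_ringStopTime_lt (hσ : 1 ≤ σ) (hlam : 0 < lam)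
    (hcrit : lambdaCrit σ < lam)
    (hp : (fun n => (p n : ℝ)) ~[atTop] (fun n => lam / Real.log n)) {γ : ℝ}
    (hγ : γ < lambdaCrit σ / lam) :
    Tendsto (fun n : ℕ => (SimpleGraph.binomialRandom (Fin n) (p n)).real
      {G | Real.log (ringStopTime σ n G) < γ * Real.log n}) atTop (𝓝 0) := by
  rcases le_or_gt γ 0 with hγ₀ | hγ₀
  · -- The logarithm of a natural number is nonnegative, also with the value `Real.log 0 = 0`.
    refine tendsto_const_nhds.congr' ?_
    filter_upwards [tendsto_log_natCast_atTop.eventually_ge_atTop 0] with n hn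
    have : {G | Real.log (ringStopTime σ n G) < γ * Real.log n} = ∅ := by
      refine Set.eq_empty_of_forall_notMem fun G hG => ?_
      rw [Set.mem_ofPred_eq, ← not_le] at hG
      refine hG ?_
      exact (mul_nonpos_of_nonpos_of_nonneg hγ₀ hn).trans (Real.log_natCast_nonneg _)
    rw [this, measureReal_empty]
  obtain ⟨β, hβ₁, hβ₂⟩ := exists_between hγ
  have hβ₀ : 0 < β := hγ₀.trans hβ₁
  obtain ⟨α, hα₁, hα₂⟩ := exists_between ((div_lt_one hlam).2 hcrit)
  have hβ₃ := (lt_div_iff₀ hlam).1 hβ₂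
  set ε := (lambdaCrit σ - β * lam) / 2 with hε
  have hε₀ : 0 < ε := by rw [hε]; linarith
  have hκ : β < (lambdaCrit σ - ε) / lam := by
    rw [lt_div_iff₀ hlam, hε]
    linarith
  obtain ⟨M, hM, hspan⟩ := exists_ringProb_spanned_le_exp hσ hε₀
  have hlim := (tendsto_union_bound hlam hp hM hκ
    (N := fun n => ⌈Real.exp (β * Real.log n)⌉₊) (by
      filter_upwards [tendsto_log_natCast_atTop.eventually_ge_atTop 0] with n hn
      have h₁ := Nat.ceil_lt_add_one (Real.exp_pos (β * Real.log n)).le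
      have h₂ := Real.one_le_exp (mul_nonneg hβ₀.le hn)
      linarith)).add (tendsto_real_ringClusters_ne_top hσ hlam hp hα₁ hα₂)
  rw [add_zero] at hlim
  refine squeeze_zero' (Eventually.of_forall fun n => measureReal_nonneg) ?_ hlim
  filter_upwards [eventually_ceil_div hlam hp hM,
    (tendsto_nhdsGT_zero hlam hp).eventually hspan,
    tendsto_log_natCast_atTop.eventually_gt_atTop 0,
    tendsto_log_natCast_atTop.eventually
      (eventually_mul_pow_le_exp (4 * (M / lam + 1)) 1 (sub_pos.2 hβ₁))]
    with n ⟨h₁, h₂, h₃⟩ h₄ h₅ h₆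
  have : NeZero n := ⟨by omega⟩
  refine le_trans (measureReal_mono fun G hG => ?_)
    (real_mul_ringStopTime_lt_le h₁ h₂ (h₄ (p n) rfl n h₂) _)
  simp only [Set.mem_ofPred_eq] at hG ⊢
  refine Nat.lt_ceil.2 ?_
  push_cast
  set x := Real.log n
  have hT : (ringStopTime σ n G : ℝ) < Real.exp (γ * x) := by
    rcases Nat.eq_zero_or_pos (ringStopTime σ n G) with h | h
    · rw [h, Nat.cast_zero]
      exact Real.exp_pos _
    · rwa [← Real.log_lt_iff_lt_exp (by exact_mod_cast h)]
  have hL : (0 : ℝ) < ⌈(M : ℝ) / p n⌉₊ := by exact_mod_cast (by omega : 0 < ⌈(M : ℝ) / p n⌉₊)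
  calc 4 * (⌈(M : ℝ) / p n⌉₊ : ℝ) * ringStopTime σ n G
      < 4 * (⌈(M : ℝ) / p n⌉₊ : ℝ) * Real.exp (γ * x) := by gcongr
    _ ≤ 4 * (M / lam + 1) * x ^ 1 * Real.exp (γ * x) := by
      rw [pow_one, mul_assoc 4 _ x]
      gcongr
    _ ≤ Real.exp ((β - γ) * x) * Real.exp (γ * x) := by gcongr
    _ = Real.exp (β * x) := by
      rw [← Real.exp_add]
      congr 1
      ring

theorem tendsto_measure_of_tendsto_real {μ : ∀ n : ℕ, Measure (SimpleGraph (Fin n))}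
    [∀ n, IsProbabilityMeasure (μ n)] {A : ∀ n : ℕ, Set (SimpleGraph (Fin n))} {r : ℝ}
    (h : Tendsto (fun n => (μ n).real (A n)) atTop (𝓝 r)) :
    Tendsto (fun n => μ n (A n)) atTop (𝓝 (ENNReal.ofReal r)) := by
  have := (ENNReal.continuous_ofReal.tendsto r).comp h
  simpa [Function.comp_def, ofReal_measureReal] using this

end Asymptotics

theorem theorem5 (σ : ℕ) (hσ : 1 ≤ σ) (lam : ℝ) (hlam : 0 < lam) :
    IntegrableOn (gFun σ) (Set.Ioi 0) ∧
    (lam < lambdaCrit σ →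
      ∃ C : ℝ, ∀ p : ℕ → unitInterval,
        (fun n => (p n : ℝ)) ~[atTop] (fun n => lam / Real.log n) →
        Tendsto (fun n : ℕ => SimpleGraph.binomialRandom (Fin n) (p n)
          {G | (ringStopTime σ n G : ℝ) / Real.log n ≤ C}) atTop (𝓝 1)) ∧
    (lambdaCrit σ < lam →
      ∀ p : ℕ → unitInterval,
        (fun n => (p n : ℝ)) ~[atTop] (fun n => lam / Real.log n) →
        ∀ ε : ℝ, 0 < ε →
        Tendsto (fun n : ℕ => SimpleGraph.binomialRandom (Fin n) (p n)
          {G | ε ≤ |Real.log (ringStopTime σ n G) / Real.log n - lambdaCrit σ / lam|})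
          atTop (𝓝 0)) := by
  refine ⟨integrableOn_gFun hσ, fun hcrit => ?_, fun hcrit p hp ε hε => ?_⟩
  · obtain ⟨C, hC⟩ := exists_tendsto_real_mul_log_lt_ringStopTime hσ hlam hcrit
    refine ⟨C, fun p hp => ?_⟩
    have h := (hC p hp).const_sub 1
    rw [sub_zero] at h
    rw [← ENNReal.ofReal_one]
    refine tendsto_measure_of_tendsto_real (h.congr' ?_)
    filter_upwards [tendsto_log_natCast_atTop.eventually_gt_atTop 0] with n hn
    rw [← probReal_compl_eq_one_sub (measurableSet_simpleGraph _)]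
    congr 1
    ext G
    simp [div_le_iff₀ hn]
  · rw [← ENNReal.ofReal_zero]
    refine tendsto_measure_of_tendsto_real ?_
    have h := (tendsto_real_lt_log_ringStopTime hσ hlam hcrit hp
      (show lambdaCrit σ / lam < lambdaCrit σ / lam + ε / 2 by linarith)).add
      (tendsto_real_log_ringStopTime_lt hσ hlam hcrit hp
      (show lambdaCrit σ / lam - ε / 2 < lambdaCrit σ / lam by linarith))
    rw [add_zero] at h
    refine squeeze_zero' (Eventually.of_forall fun n => measureReal_nonneg) ?_ h
    filter_upwards [tendsto_log_natCast_atTop.eventually_gt_atTop 0] with n hn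
    refine (measureReal_mono fun G hG => ?_).trans (measureReal_union_le _ _)
    simp only [Set.mem_ofPred_eq, Set.mem_union] at hG ⊢
    rw [← lt_div_iff₀ hn, ← div_lt_iff₀ hn]
    rcases le_abs.1 hG with h | h
    · left; linarith
    · right; linarith
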